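/- **Proposition (locally finite presentation).** Let $X_k$ be a proper irreducible scheme over a field $k$ and let $r\ge 0$. For a noetherian $k$-scheme $T$ put $X_T = X_k\times_{\operatorname{Spec} k} T$ and let $\Phi(T)$ be the collection of closed subsets $Z\subset X_T$ such that every point $z\in Z$, lying over $t\in T$, has codimension $\ge 3$ in its fibre, i.e. $\dim \mathcal O_{X_t,z}\ge 3$, where $X_t$ is the fibre of $X_T\to T$ over $t$. Let $F(T)$ be the groupoid whose objects are pairs $(E,U)$, where $U\subset X_T$ is an open subscheme with $X_T\setminus U\in\Phi(T)$ and $E$ is a vector bundle of rank $r$ on $U$. A morphism $(E_1,U_1)\to(E_2,U_2)$ is given by an isomorphism $E_1|_W\simeq E_2|_W$ on an open subset $W\subset U_1\cap U_2$ with $X_T\setminus W\in\Phi(T)$, two such isomorphisms, on $W$ and $W'$, being identified if they agree on some open $W''\subset W\cap W'$ with $X_T\setminus W''\in\Phi(T)$. A morphism $T'\to T$ induces a pullback functor $F(T)\to F(T')$. For a noetherian $k$-algebra $A$ write $F(A)=F(\operatorname{Spec} A)$. Let $R=\varinjlim R_\alpha$ be a colimit of commutative $k$-algebras indexed by a small filtered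 category, with $R$ and all $R_\alpha$ noetherian. Let $\varinjlim F(R_\alpha)$ be the category whose objects are pairs $(\alpha,x)$ with $x\in F(R_\alpha)$, and in which the morphisms $(\alpha,x)\to(\beta,y)$ form the filtered colimit, over the indices $\gamma$ equipped with maps $\alpha\to\gamma$ and $\beta\to\gamma$, of the sets of morphisms in $F(R_\gamma)$ from the pullback of $x$ to the pullback of $y$. Then the pullback functor $$\varinjlim F(R_\alpha)\longrightarrow F(R)$$ is an equivalence of categories. -/

import Mathlib

universe u
open CategoryTheory Limits AlgebraicGeometry TopologicalSpace
namespace GenericBundles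

/-! ### Fibrewise codimension three -/

section Base

variable {B : Scheme.{u}} (X : Over B)

/-- The scheme `X_T = X ×_B T`. -/
noncomputable abbrev fam (T : Over B) : Scheme.{u} := pullback X.hom T.hom

/-- The projection `X_T ⟶ T`. -/
noncomputable abbrev famProj (T : Over B) : fam X T ⟶ T.left := pullback.snd X.hom T.hom

/-- The morphism `X_{T'} ⟶ X_T` induced by a morphism `T' ⟶ T` over `B`. -/
noncomputable def famMap {T' T : Over B} (g : T' ⟶ T) : fam X T' ⟶ fam X T :=
  pullback.lift (pullback.fst X.hom T'.hom) (pullback.snd X.hom T'.hom ≫ g.left)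
    (by simp [pullback.condition])

@[simp]
lemma famMap_fst {T' T : Over B} (g : T' ⟶ T) :
    famMap X g ≫ pullback.fst X.hom T.hom = pullback.fst X.hom T'.hom :=
  pullback.lift_fst _ _ _

@[simp]
lemma famMap_snd {T' T : Over B} (g : T' ⟶ T) :
    famMap X g ≫ pullback.snd X.hom T.hom = pullback.snd X.hom T'.hom ≫ g.left :=
  pullback.lift_snd _ _ _

lemma famMap_isPullback {T' T : Over B} (g : T' ⟶ T) :
    IsPullback (famMap X g) (famProj X T') (famProj X T) g.left := by
  refine IsPullback.of_right (h₁₂ := pullback.fst X.hom T.hom) (h₂₂ := T.hom) (v₁₃ := X.hom) ?_ ?_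
    (IsPullback.of_hasPullback _ _)
  · simpa using! IsPullback.of_hasPullback X.hom T'.hom
  · simp

lemma famMap_comp {T'' T' T : Over B} (g : T'' ⟶ T') (h : T' ⟶ T) :
    famMap X g ≫ famMap X h = famMap X (g ≫ h) := by
  apply pullback.hom_ext
  · simp
  · rw [Category.assoc, famMap_snd, famMap_snd, ← Category.assoc, famMap_snd, Category.assoc,
      Over.comp_left]

lemma famMap_id (T : Over B) : famMap X (𝟙 T) = 𝟙 (fam X T) := by
  apply pullback.hom_ext
  · exact (famMap_fst X _).trans (Category.id_comp _).symm
  · exact (famMap_snd X _).trans ((Category.comp_id _).trans (Category.id_comp _).symm)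

/-- The collection `Φ(T)` of the closed subsets of `X_T` all of whose points have codimension at least
three in their fibre over `T`. The codimension of a point `z` of the fibre `X_t` is the Krull
dimension of the local ring of `X_t` at `z`. -/
def Phi (T : Over B) : Set (Set (fam X T)) :=
  {Z | IsClosed Z ∧ ∀ (t : T.left) (z : (famProj X T).fiber t), (famProj X T).fiberι t z ∈ Z →
    3 ≤ ringKrullDim (((famProj X T).fiber t).presheaf.stalk z)}

/-- An open subscheme of `X_T` is *big* if its complement belongs to `Φ(T)`. -/
def IsBig {T : Over B} (U : (fam X T).Opens) : Prop := (U : Set (fam X T))ᶜ ∈ Phi X T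

lemma coheight_le_of_generalizingMap {Y Z : Scheme.{u}} (f : Y ⟶ Z) (hf : GeneralizingMap f)
    (y : Y) : Order.coheight (f y) ≤ Order.coheight y := by
  refine Order.coheight_le fun p hp => ?_
  suffices H : ∀ (n : ℕ) (p : LTSeries Z), p.length = n → ∀ y : Y, p.head = f y →
      (n : ℕ∞) ≤ Order.coheight y by exact H _ p rfl y hp
  intro n
  induction n with
  | zero => intros; simp
  | succ n ih =>
    intro p hpn y hy
    have h0 : p.length ≠ 0 := by omega
    have hlt : p.head < (p.tail h0).head := by
      have := p.step ⟨0, by omega⟩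
      simpa [RelSeries.head, RelSeries.tail] using! this
    rw [hy] at hlt
    obtain ⟨y', hy', hfy'⟩ := hf (show (p.tail h0).head ⤳ f y from hlt.le)
    have := ih (p.tail h0) (by simp [RelSeries.tail]; omega) y' hfy'.symm
    have hyy' : y < y' := by
      refine lt_of_le_not_ge hy' fun h => ?_
      have h2 : f y ⤳ f y' := Specializes.map (show y ⤳ y' from h) f.continuous
      rw [hfy'] at h2
      exact hlt.not_ge h2
    calc ((n + 1 : ℕ) : ℕ∞) = n + 1 := by simp
      _ ≤ Order.coheight y' + 1 := by gcongr
      _ ≤ _ := Order.coheight_add_one_le hyy'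

variable {X}

lemma IsBig.preimage {T' T : Over B} (g : T' ⟶ T) {U : (fam X T).Opens} (hU : IsBig X U) :
    IsBig X (famMap X g ⁻¹ᵁ U) := by
  refine ⟨(famMap X g ⁻¹ᵁ U).isOpen.isClosed_compl, fun t z hz => ?_⟩
  have sq := isPullback_fiberToSpecResidueField_of_isPullback (famMap_isPullback X g) t
  set p := pullback.map (famProj X T') (T'.left.fromSpecResidueField t) (famProj X T)
    (T.left.fromSpecResidueField (g.left t)) (famMap X g)
    (Spec.map (Scheme.Hom.residueFieldMap g.left t)) g.left
    (famMap_isPullback X g).w.symm (by simp) with hp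
  have hflat : Flat (Spec.map (Scheme.Hom.residueFieldMap g.left t)) := by
    infer_instance
  have : Flat p := MorphismProperty.of_isPullback sq.flip hflat
  have h1 : 3 ≤ ringKrullDim (((famProj X T).fiber (g.left t)).presheaf.stalk (p z)) := by
    refine hU.2 (g.left t) (p z) ?_
    have : (famProj X T).fiberι (g.left t) (p z) = famMap X g ((famProj X T').fiberι t z) := by
      have h : p ≫ pullback.fst (famProj X T) (T.left.fromSpecResidueField (g.left t)) =
          pullback.fst _ _ ≫ famMap X g := pullback.lift_fst _ _ _
      exact congrArg (fun q : _ ⟶ fam X T => q z) h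
    rw [this]
    exact hz
  refine h1.trans ?_
  refine (ringKrullDim_stalk_eq_coheight (p z)).le.trans
    (le_trans ?_ (ringKrullDim_stalk_eq_coheight _).ge)
  exact WithBot.coe_le_coe.mpr (coheight_le_of_generalizingMap p (Flat.generalizingMap p) z)

lemma IsBig.inf {T : Over B} {U V : (fam X T).Opens} (hU : IsBig X U) (hV : IsBig X V) :
    IsBig X (U ⊓ V) := by
  refine ⟨(U ⊓ V).isOpen.isClosed_compl, fun t z hz => ?_⟩
  by_cases h : (famProj X T).fiberι t z ∈ U
  · exact hV.2 t z fun h' => hz ⟨h, h'⟩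
  · exact hU.2 t z h

end Base

/-! ### Vector bundles -/

lemma final_opensMap {X Y : Scheme.{u}} (f : X ⟶ Y) : (Opens.map f.base).Final where
  out V := by
    let t : StructuredArrow V (Opens.map f.base) := StructuredArrow.mk (Y := ⊤) (homOfLE le_top)
    have ht : IsTerminal t := IsTerminal.ofUniqueHom
      (fun s => StructuredArrow.homMk (homOfLE le_top) (Subsingleton.elim _ _))
      (fun s m => by ext; exact Subsingleton.elim _ _)
    exact isConnected_of_isTerminal _ ht

/-- The free sheaf of modules of rank `r`. -/
noncomputable def freeModule (r : ℕ) (Y : Scheme.{u}) : Y.Modules :=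
  SheafOfModules.free (R := Y.ringCatSheaf) (ULift.{u} (Fin r))

/-- The pullback of a free sheaf is free. -/
noncomputable def pullbackFreeIso (r : ℕ) {X Y : Scheme.{u}} (f : X ⟶ Y) :
    (Scheme.Modules.pullback f).obj (freeModule r Y) ≅ freeModule r X :=
  haveI := final_opensMap f
  haveI : (SheafOfModules.pushforward f.toRingCatSheafHom).IsRightAdjoint :=
    inferInstanceAs (Scheme.Modules.pushforward f).IsRightAdjoint
  SheafOfModules.pullbackObjFreeIso f.toRingCatSheafHom (ULift.{u} (Fin r))

/-- A sheaf of modules is a vector bundle of rank `r` if it is locally isomorphic to the free sheaf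
of rank `r`. -/
def IsVectorBundle (r : ℕ) {Y : Scheme.{u}} (M : Y.Modules) : Prop :=
  ∀ y : Y, ∃ V : Y.Opens, y ∈ V ∧
    Nonempty ((Scheme.Modules.pullback V.ι).obj M ≅ freeModule r V)

lemma IsVectorBundle.pullback {r : ℕ} {X Y : Scheme.{u}} (f : X ⟶ Y) {M : Y.Modules}
    (hM : IsVectorBundle r M) : IsVectorBundle r ((Scheme.Modules.pullback f).obj M) := by
  intro x
  obtain ⟨V, hxV, ⟨e⟩⟩ := hM (f x)
  refine ⟨f ⁻¹ᵁ V, hxV, ⟨?_⟩⟩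
  exact (Scheme.Modules.pullbackComp (f ⁻¹ᵁ V).ι f).app M ≪≫
    (Scheme.Modules.pullbackCongr (morphismRestrict_ι f V).symm).app M ≪≫
    (Scheme.Modules.pullbackComp (f ∣_ V) V.ι).symm.app M ≪≫
    (Scheme.Modules.pullback (f ∣_ V)).mapIso e ≪≫ pullbackFreeIso r _

/-! ### Base change of isomorphisms between pullbacks of modules -/

section PullIso

/-- The pseudofunctor sending a scheme to its category of sheaves of modules and a morphism to the
pullback functor. -/
noncomputable abbrev modPull : Pseudofunctor (LocallyDiscrete Scheme.{u}ᵒᵖ) Cat.{u, u + 1} :=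
  Scheme.Modules.pseudofunctor.comp Bicategory.Adj.forget₁

section General
open Pseudofunctor.LocallyDiscreteOpToCat Opposite
variable {C : Type*} [Category* C] {F : Pseudofunctor (LocallyDiscrete Cᵒᵖ) Cat}
    ⦃X₁ X₂ X₃ : C⦄ ⦃M₁ : F.obj (.mk (op X₁))⦄ ⦃M₂ : F.obj (.mk (op X₂))⦄
    ⦃M₃ : F.obj (.mk (op X₃))⦄
    ⦃Y : C⦄ ⦃f₁ : Y ⟶ X₁⦄ ⦃f₂ : Y ⟶ X₂⦄ ⦃f₃ : Y ⟶ X₃⦄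

lemma hom_inv_app {a b : Cat} {f g : a ⟶ b} (α : f ≅ g) (x : a) :
    α.hom.toNatTrans.app x ≫ α.inv.toNatTrans.app x = 𝟙 _ := by
  rw [← Cat.Hom₂.comp_app, α.hom_inv_id]; rfl
lemma inv_hom_app {a b : Cat} {f g : a ⟶ b} (α : f ≅ g) (x : a) :
    α.inv.toNatTrans.app x ≫ α.hom.toNatTrans.app x = 𝟙 _ := by
  rw [← Cat.Hom₂.comp_app, α.inv_hom_id]; rfl

lemma pullHom_comp
    (φ : (F.map f₁.op.toLoc).toFunctor.obj M₁ ⟶ (F.map f₂.op.toLoc).toFunctor.obj M₂)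
    (ψ : (F.map f₂.op.toLoc).toFunctor.obj M₂ ⟶ (F.map f₃.op.toLoc).toFunctor.obj M₃) ⦃Y' : C⦄
    (g : Y' ⟶ Y) (gf₁ : Y' ⟶ X₁) (gf₂ : Y' ⟶ X₂) (gf₃ : Y' ⟶ X₃) (h₁ : g ≫ f₁ = gf₁)
    (h₂ : g ≫ f₂ = gf₂) (h₃ : g ≫ f₃ = gf₃) :
    pullHom (φ ≫ ψ) g gf₁ gf₃ h₁ h₃ = pullHom φ g gf₁ gf₂ h₁ h₂ ≫ pullHom ψ g gf₂ gf₃ h₂ h₃ := by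
  have h := inv_hom_app (F.mapComp' f₂.op.toLoc g.op.toLoc gf₂.op.toLoc (by subst h₂; rfl)) M₂
  unfold pullHom
  simp only [Functor.map_comp, Category.assoc]
  congr 2
  rw [← Category.assoc (Cat.Hom₂.toNatTrans _ |>.app _) (Cat.Hom₂.toNatTrans _ |>.app _)]
  exact (((congrArg (· ≫ _) h).trans (Category.id_comp _)).symm)

lemma pullHom_refl ⦃Y' : C⦄ (g : Y' ⟶ Y) (gf₁ : Y' ⟶ X₁) (h₁ : g ≫ f₁ = gf₁) :
    pullHom (𝟙 ((F.map f₁.op.toLoc).toFunctor.obj M₁)) g gf₁ gf₁ h₁ h₁ = 𝟙 _ := by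
  have h := hom_inv_app (F.mapComp' f₁.op.toLoc g.op.toLoc gf₁.op.toLoc (by subst h₁; rfl)) M₁
  unfold pullHom
  rw [CategoryTheory.Functor.map_id]
  exact (congrArg (_ ≫ ·) (Category.id_comp _)).trans h

lemma pullHom_inv
    (φ : (F.map f₁.op.toLoc).toFunctor.obj M₁ ⟶ (F.map f₂.op.toLoc).toFunctor.obj M₂)
    (ψ : (F.map f₂.op.toLoc).toFunctor.obj M₂ ⟶ (F.map f₁.op.toLoc).toFunctor.obj M₁)
    (h : φ ≫ ψ = 𝟙 _) ⦃Y' : C⦄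
    (g : Y' ⟶ Y) (gf₁ : Y' ⟶ X₁) (gf₂ : Y' ⟶ X₂) (h₁ : g ≫ f₁ = gf₁) (h₂ : g ≫ f₂ = gf₂) :
    pullHom φ g gf₁ gf₂ h₁ h₂ ≫ pullHom ψ g gf₂ gf₁ h₂ h₁ = 𝟙 _ := by
  rw [← pullHom_comp, h, pullHom_refl]

end General

variable {Y₁ Y₂ Y₃ W W' W'' : Scheme.{u}} {M₁ : Y₁.Modules} {M₂ : Y₂.Modules} {M₃ : Y₃.Modules}
  {f₁ : W ⟶ Y₁} {f₂ : W ⟶ Y₂} {f₃ : W ⟶ Y₃}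

/-- The base change along `g : W' ⟶ W` of an isomorphism `f₁^* M₁ ≅ f₂^* M₂`, as an isomorphism
`(g ≫ f₁)^* M₁ ≅ (g ≫ f₂)^* M₂`. -/
noncomputable def pullIso
    (φ : (Scheme.Modules.pullback f₁).obj M₁ ≅ (Scheme.Modules.pullback f₂).obj M₂)
    (g : W' ⟶ W) (g₁ : W' ⟶ Y₁) (g₂ : W' ⟶ Y₂) (h₁ : g ≫ f₁ = g₁) (h₂ : g ≫ f₂ = g₂) :
    (Scheme.Modules.pullback g₁).obj M₁ ≅ (Scheme.Modules.pullback g₂).obj M₂ where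
  hom := Pseudofunctor.LocallyDiscreteOpToCat.pullHom (F := modPull) (M₁ := M₁) (M₂ := M₂)
    φ.hom g g₁ g₂ h₁ h₂
  inv := Pseudofunctor.LocallyDiscreteOpToCat.pullHom (F := modPull) (M₁ := M₂) (M₂ := M₁)
    φ.inv g g₂ g₁ h₂ h₁
  hom_inv_id := pullHom_inv (F := modPull) (M₁ := M₁) (M₂ := M₂)
      φ.hom φ.inv φ.hom_inv_id g g₁ g₂ h₁ h₂
  inv_hom_id := pullHom_inv (F := modPull) (M₁ := M₂) (M₂ := M₁)
      φ.inv φ.hom φ.inv_hom_id g g₂ g₁ h₂ h₁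

lemma pullIso_refl (g : W' ⟶ W) (g₁ : W' ⟶ Y₁) (h₁ : g ≫ f₁ = g₁) :
    pullIso (Iso.refl ((Scheme.Modules.pullback f₁).obj M₁)) g g₁ g₁ h₁ h₁ = Iso.refl _ :=
  Iso.ext (pullHom_refl (F := modPull) (M₁ := M₁) (f₁ := f₁) g g₁ h₁)

lemma pullIso_symm (φ : (Scheme.Modules.pullback f₁).obj M₁ ≅ (Scheme.Modules.pullback f₂).obj M₂)
    (g : W' ⟶ W) (g₁ : W' ⟶ Y₁) (g₂ : W' ⟶ Y₂) (h₁ : g ≫ f₁ = g₁) (h₂ : g ≫ f₂ = g₂) :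
    (pullIso φ g g₁ g₂ h₁ h₂).symm = pullIso φ.symm g g₂ g₁ h₂ h₁ :=
  rfl

lemma pullIso_trans
    (φ : (Scheme.Modules.pullback f₁).obj M₁ ≅ (Scheme.Modules.pullback f₂).obj M₂)
    (ψ : (Scheme.Modules.pullback f₂).obj M₂ ≅ (Scheme.Modules.pullback f₃).obj M₃)
    (g : W' ⟶ W) (g₁ : W' ⟶ Y₁) (g₂ : W' ⟶ Y₂) (g₃ : W' ⟶ Y₃)
    (h₁ : g ≫ f₁ = g₁) (h₂ : g ≫ f₂ = g₂) (h₃ : g ≫ f₃ = g₃) :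
    pullIso (φ ≪≫ ψ) g g₁ g₃ h₁ h₃ = pullIso φ g g₁ g₂ h₁ h₂ ≪≫ pullIso ψ g g₂ g₃ h₂ h₃ :=
  Iso.ext (pullHom_comp (F := modPull) (M₁ := M₁) (M₂ := M₂) (M₃ := M₃)
      φ.hom ψ.hom g g₁ g₂ g₃ h₁ h₂ h₃)

lemma pullIso_id (φ : (Scheme.Modules.pullback f₁).obj M₁ ≅ (Scheme.Modules.pullback f₂).obj M₂)
    (g : W ⟶ W) (hg : g = 𝟙 W) (h₁ : g ≫ f₁ = f₁) (h₂ : g ≫ f₂ = f₂) :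
    pullIso φ g f₁ f₂ h₁ h₂ = φ := by
  subst hg
  exact Iso.ext (Pseudofunctor.LocallyDiscreteOpToCat.pullHom_id
    (F := modPull) (M₁ := M₁) (M₂ := M₂) φ.hom)

lemma pullIso_pullIso
    (φ : (Scheme.Modules.pullback f₁).obj M₁ ≅ (Scheme.Modules.pullback f₂).obj M₂)
    (g : W' ⟶ W) (g₁ : W' ⟶ Y₁) (g₂ : W' ⟶ Y₂) (h₁ : g ≫ f₁ = g₁) (h₂ : g ≫ f₂ = g₂)
    (g' : W'' ⟶ W') (g₁' : W'' ⟶ Y₁) (g₂' : W'' ⟶ Y₂) (h₁' : g' ≫ g₁ = g₁')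
    (h₂' : g' ≫ g₂ = g₂') (e : W'' ⟶ W) (he : g' ≫ g = e) :
    pullIso (pullIso φ g g₁ g₂ h₁ h₂) g' g₁' g₂' h₁' h₂' =
      pullIso φ e g₁' g₂' (by rw [← he, Category.assoc, h₁, h₁'])
        (by rw [← he, Category.assoc, h₂, h₂']) := by
  subst he
  exact Iso.ext (Pseudofunctor.LocallyDiscreteOpToCat.pullHom_pullHom
    (F := modPull) (M₁ := M₁) (M₂ := M₂) φ.hom g g₁ g₂ g' g₁' g₂' h₁ h₂ h₁' h₂')

end PullIso

/-! ### The groupoids `F(T)` -/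

section Germs

variable {B : Scheme.{u}} {X : Over B} {r : ℕ}

variable (X r) in
/-- An object of `F(T)`: a vector bundle `E` of rank `r` on an open subscheme `U` of `X_T` whose
complement belongs to `Φ(T)`. -/
structure PartialBundle (T : Over B) where
  /-- The open subscheme on which the bundle is defined. -/
  U : (fam X T).Opens
  isBig : IsBig X U
  /-- The vector bundle. -/
  E : U.toScheme.Modules
  isVectorBundle : IsVectorBundle r E

variable {S S' S'' T₁ T₂ T₃ T₄ : Over B}
  {a : fam X S ⟶ fam X T₁} {x : PartialBundle X r T₁}
  {b : fam X S ⟶ fam X T₂} {y : PartialBundle X r T₂}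
  {c : fam X S ⟶ fam X T₃} {z : PartialBundle X r T₃}
  {d : fam X S ⟶ fam X T₄} {t : PartialBundle X r T₄}

variable (a x b y) in
/-- For `a : X_S ⟶ X_{T₁}`, `b : X_S ⟶ X_{T₂}` and objects `x = (E₁, U₁)` of `F(T₁)` and
`y = (E₂, U₂)` of `F(T₂)`: an isomorphism `(a^* E₁)|_W ≅ (b^* E₂)|_W` on an open subset
`W ⊆ a⁻¹ U₁ ∩ b⁻¹ U₂` of `X_S` whose complement belongs to `Φ(S)`. Here `(a^* E₁)|_W` is formed as
the pullback of `E₁` along the restriction `W ⟶ U₁` of `a`. -/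
structure IsoOnBig where
  /-- The open subset on which the isomorphism is defined. -/
  W : (fam X S).Opens
  isBig : IsBig X W
  le₁ : W ≤ a ⁻¹ᵁ x.U
  le₂ : W ≤ b ⁻¹ᵁ y.U
  /-- The isomorphism. -/
  iso : (Scheme.Modules.pullback (a.resLE x.U W le₁)).obj x.E ≅
    (Scheme.Modules.pullback (b.resLE y.U W le₂)).obj y.E

namespace IsoOnBig

/-- The restriction of the isomorphism to a smaller open subset. -/
noncomputable def res (φ : IsoOnBig a x b y) (W : (fam X S).Opens) (h : W ≤ φ.W) :
    (Scheme.Modules.pullback (a.resLE x.U W (h.trans φ.le₁))).obj x.E ≅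
      (Scheme.Modules.pullback (b.resLE y.U W (h.trans φ.le₂))).obj y.E :=
  pullIso φ.iso ((fam X S).homOfLE h) _ _ (Scheme.Hom.map_resLE _ _ _)
    (Scheme.Hom.map_resLE _ _ _)

lemma pullIso_res (φ : IsoOnBig a x b y) (W W' : (fam X S).Opens) (h : W ≤ φ.W) (h' : W' ≤ W) :
    pullIso (φ.res W h) ((fam X S).homOfLE h') _ _ (Scheme.Hom.map_resLE _ _ _)
      (Scheme.Hom.map_resLE _ _ _) = φ.res W' (h'.trans h) :=
  pullIso_pullIso _ _ _ _ _ _ _ _ _ _ _ _ (by simp)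

/-- Two isomorphisms defined on `W` and `W'` have the same germ if they agree on an open subset of
`W ∩ W'` whose complement belongs to `Φ(S)`. -/
def Rel (φ ψ : IsoOnBig a x b y) : Prop :=
  ∃ (W : (fam X S).Opens) (_ : IsBig X W) (h : W ≤ φ.W) (h' : W ≤ ψ.W), φ.res W h = ψ.res W h'

lemma res_eq_of_le {φ ψ : IsoOnBig a x b y} {W W' : (fam X S).Opens} {h : W ≤ φ.W} {h' : W ≤ ψ.W}
    (e : φ.res W h = ψ.res W h') (hW : W' ≤ W) :
    φ.res W' (hW.trans h) = ψ.res W' (hW.trans h') := by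
  rw [← pullIso_res φ W W' h hW, ← pullIso_res ψ W W' h' hW, e]

lemma Rel.equivalence : Equivalence (Rel (a := a) (x := x) (b := b) (y := y)) where
  refl φ := ⟨φ.W, φ.isBig, le_rfl, le_rfl, rfl⟩
  symm := fun ⟨W, hW, h, h', e⟩ => ⟨W, hW, h', h, e.symm⟩
  trans := fun ⟨W, hW, h, _, e⟩ ⟨W', hW', _, h', e'⟩ =>
    ⟨W ⊓ W', hW.inf hW', inf_le_left.trans h, inf_le_right.trans h',
      (res_eq_of_le e inf_le_left).trans (res_eq_of_le e' inf_le_right)⟩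

variable (a x b y) in
/-- The equivalence relation of having the same germ. -/
@[reducible] def setoid : Setoid (IsoOnBig a x b y) := ⟨Rel, Rel.equivalence⟩

variable (a x) in
/-- The identity. -/
noncomputable def refl (W : (fam X S).Opens) (hW : IsBig X W) (h : W ≤ a ⁻¹ᵁ x.U) :
    IsoOnBig a x a x where
  W := W
  isBig := hW
  le₁ := h
  le₂ := h
  iso := Iso.refl _

/-- The inverse. -/
noncomputable def symm (φ : IsoOnBig a x b y) : IsoOnBig b y a x where
  W := φ.W
  isBig := φ.isBig
  le₁ := φ.le₂
  le₂ := φ.le₁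
  iso := φ.iso.symm

/-- The composition, defined on the intersection of the domains. -/
noncomputable def trans (φ : IsoOnBig a x b y) (ψ : IsoOnBig b y c z) : IsoOnBig a x c z where
  W := φ.W ⊓ ψ.W
  isBig := φ.isBig.inf ψ.isBig
  le₁ := inf_le_left.trans φ.le₁
  le₂ := inf_le_right.trans ψ.le₂
  iso := φ.res _ inf_le_left ≪≫ ψ.res _ inf_le_right

lemma trans_res (φ : IsoOnBig a x b y) (ψ : IsoOnBig b y c z) (W : (fam X S).Opens)
    (h : W ≤ φ.W) (h' : W ≤ ψ.W) :
    (φ.trans ψ).res W (le_inf h h') = φ.res W h ≪≫ ψ.res W h' := by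
  refine (pullIso_trans _ _ _ _ (b.resLE y.U W (h.trans φ.le₂)) _ _
    (Scheme.Hom.map_resLE _ _ _) _).trans ?_
  exact congrArg₂ _ (pullIso_res φ _ _ _ _) (pullIso_res ψ _ _ _ _)

lemma refl_res (W W' : (fam X S).Opens) (hW : IsBig X W) (h : W ≤ a ⁻¹ᵁ x.U) (hW' : W' ≤ W) :
    (refl a x W hW h).res W' hW' = Iso.refl _ :=
  pullIso_refl _ _ _

lemma symm_res (φ : IsoOnBig a x b y) (W : (fam X S).Opens) (h : W ≤ φ.W) :
    φ.symm.res W h = (φ.res W h).symm :=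
  (pullIso_symm φ.iso _ _ _ _ _).symm

/-- Base change along a morphism `g : S' ⟶ S`. -/
noncomputable def pull (φ : IsoOnBig a x b y) (g : S' ⟶ S) (a' : fam X S' ⟶ fam X T₁)
    (b' : fam X S' ⟶ fam X T₂) (ha : famMap X g ≫ a = a') (hb : famMap X g ≫ b = b') :
    IsoOnBig a' x b' y where
  W := famMap X g ⁻¹ᵁ φ.W
  isBig := φ.isBig.preimage g
  le₁ := by subst ha; exact (famMap X g).preimage_mono φ.le₁
  le₂ := by subst hb; exact (famMap X g).preimage_mono φ.le₂
  iso := pullIso φ.iso ((famMap X g).resLE φ.W _ le_rfl) _ _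
    (by subst ha; exact Scheme.Hom.resLE_comp_resLE _ _ _ _)
    (by subst hb; exact Scheme.Hom.resLE_comp_resLE _ _ _ _)

lemma pull_res (φ : IsoOnBig a x b y) (g : S' ⟶ S) (a' : fam X S' ⟶ fam X T₁)
    (b' : fam X S' ⟶ fam X T₂) (ha : famMap X g ≫ a = a') (hb : famMap X g ≫ b = b')
    (W : (fam X S).Opens) (hW : W ≤ φ.W) (W' : (fam X S').Opens) (hW' : W' ≤ famMap X g ⁻¹ᵁ W)
    (h : W' ≤ (φ.pull g a' b' ha hb).W) :
    (φ.pull g a' b' ha hb).res W' h =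
      pullIso (φ.res W hW) ((famMap X g).resLE W W' hW') _ _
        (by subst ha; exact Scheme.Hom.resLE_comp_resLE _ _ _ _)
        (by subst hb; exact Scheme.Hom.resLE_comp_resLE _ _ _ _) := by
  subst ha hb
  refine (pullIso_pullIso _ _ _ _ _ _ _ _ _ _ _ _ rfl).trans
    (pullIso_pullIso _ _ _ _ _ _ _ _ _ _ _ _ ?_).symm
  exact (Scheme.Hom.resLE_map _ _ _).trans (Scheme.Hom.map_resLE _ _ _).symm

lemma pull_res_congr {φ ψ : IsoOnBig a x b y} (g : S' ⟶ S) (a' : fam X S' ⟶ fam X T₁)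
    (b' : fam X S' ⟶ fam X T₂) (ha : famMap X g ≫ a = a') (hb : famMap X g ≫ b = b')
    (W : (fam X S).Opens) (h : W ≤ φ.W) (h' : W ≤ ψ.W) (e : φ.res W h = ψ.res W h')
    (W' : (fam X S').Opens) (hW' : W' ≤ famMap X g ⁻¹ᵁ W) (k : W' ≤ (φ.pull g a' b' ha hb).W)
    (k' : W' ≤ (ψ.pull g a' b' ha hb).W) :
    (φ.pull g a' b' ha hb).res W' k = (ψ.pull g a' b' ha hb).res W' k' := by
  rw [pull_res φ g a' b' ha hb W h W' hW', pull_res ψ g a' b' ha hb W h' W' hW', e]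

lemma pull_refl_res (g : S' ⟶ S) (a' : fam X S' ⟶ fam X T₁) (ha : famMap X g ≫ a = a')
    (W₀ : (fam X S).Opens) (hW₀ : IsBig X W₀) (h₀ : W₀ ≤ a ⁻¹ᵁ x.U)
    (W : (fam X S').Opens) (hW : W ≤ famMap X g ⁻¹ᵁ W₀)
    (h : W ≤ ((refl a x W₀ hW₀ h₀).pull g a' a' ha ha).W) :
    ((refl a x W₀ hW₀ h₀).pull g a' a' ha ha).res W h = Iso.refl _ := by
  rw [pull_res (refl a x W₀ hW₀ h₀) g a' a' ha ha W₀ le_rfl W hW, refl_res W₀ W₀ hW₀ h₀ le_rfl,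
    pullIso_refl]

lemma pull_trans_res (φ : IsoOnBig a x b y) (ψ : IsoOnBig b y c z) (g : S' ⟶ S)
    (a' : fam X S' ⟶ fam X T₁) (b' : fam X S' ⟶ fam X T₂) (c' : fam X S' ⟶ fam X T₃)
    (ha : famMap X g ≫ a = a') (hb : famMap X g ≫ b = b') (hc : famMap X g ≫ c = c')
    (W₀ : (fam X S).Opens) (h₁ : W₀ ≤ φ.W) (h₂ : W₀ ≤ ψ.W)
    (W : (fam X S').Opens) (hW : W ≤ famMap X g ⁻¹ᵁ W₀)
    (h : W ≤ ((φ.trans ψ).pull g a' c' ha hc).W)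
    (h' : W ≤ (φ.pull g a' b' ha hb).W) (h'' : W ≤ (ψ.pull g b' c' hb hc).W) :
    ((φ.trans ψ).pull g a' c' ha hc).res W h =
      ((φ.pull g a' b' ha hb).trans (ψ.pull g b' c' hb hc)).res W (le_inf h' h'') := by
  rw [pull_res (φ.trans ψ) g a' c' ha hc W₀ (le_inf h₁ h₂) W hW,
    trans_res φ ψ W₀ h₁ h₂, trans_res _ _ W h' h'', pull_res φ g a' b' ha hb W₀ h₁ W hW,
    pull_res ψ g b' c' hb hc W₀ h₂ W hW, pullIso_trans]

lemma resLE_famMap_comp {g : S' ⟶ S} {g' : S'' ⟶ S'} {e : S'' ⟶ S} (he : g' ≫ g = e)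
    {W : (fam X S).Opens} {W' : (fam X S').Opens} {W'' : (fam X S'').Opens}
    (h : W' ≤ famMap X g ⁻¹ᵁ W) (h' : W'' ≤ famMap X g' ⁻¹ᵁ W') (h'' : W'' ≤ famMap X e ⁻¹ᵁ W) :
    (famMap X g').resLE W' W'' h' ≫ (famMap X g).resLE W W' h =
      (famMap X e).resLE W W'' h'' := by
  rw [Scheme.Hom.resLE_comp_resLE]
  congr 1
  rw [famMap_comp, he]

lemma pull_pull_res (φ : IsoOnBig a x b y) (g : S' ⟶ S) (a' : fam X S' ⟶ fam X T₁)
    (b' : fam X S' ⟶ fam X T₂) (ha : famMap X g ≫ a = a') (hb : famMap X g ≫ b = b')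
    (g' : S'' ⟶ S') (a'' : fam X S'' ⟶ fam X T₁) (b'' : fam X S'' ⟶ fam X T₂)
    (ha' : famMap X g' ≫ a' = a'') (hb' : famMap X g' ≫ b' = b'')
    (e : S'' ⟶ S) (he : g' ≫ g = e) (ha'' : famMap X e ≫ a = a'') (hb'' : famMap X e ≫ b = b'')
    (W₀ : (fam X S).Opens) (h₀ : W₀ ≤ φ.W) (W₁ : (fam X S').Opens) (h₁ : W₁ ≤ famMap X g ⁻¹ᵁ W₀)
    (W₂ : (fam X S'').Opens) (h₂ : W₂ ≤ famMap X g' ⁻¹ᵁ W₁) (h₂' : W₂ ≤ famMap X e ⁻¹ᵁ W₀)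
    (k₁ : W₁ ≤ (φ.pull g a' b' ha hb).W)
    (k₂ : W₂ ≤ ((φ.pull g a' b' ha hb).pull g' a'' b'' ha' hb').W)
    (k₃ : W₂ ≤ (φ.pull e a'' b'' ha'' hb'').W) :
    ((φ.pull g a' b' ha hb).pull g' a'' b'' ha' hb').res W₂ k₂ =
      (φ.pull e a'' b'' ha'' hb'').res W₂ k₃ := by
  rw [pull_res (φ.pull g a' b' ha hb) g' a'' b'' ha' hb' W₁ k₁ W₂ h₂,
    pull_res φ g a' b' ha hb W₀ h₀ W₁ h₁, pull_res φ e a'' b'' ha'' hb'' W₀ h₀ W₂ h₂']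
  exact pullIso_pullIso _ _ _ _ _ _ _ _ _ _ _ _ (resLE_famMap_comp he _ _ _)

end IsoOnBig

open IsoOnBig

variable (a x b y) in
/-- Germs of isomorphisms `a^* x ≅ b^* y` along the open subsets of `X_S` with complement in
`Φ(S)`. -/
def Germ : Type u := Quotient (setoid a x b y)

namespace Germ

variable (a x) in
/-- The germ of the identity. -/
noncomputable def refl (h : IsBig X (a ⁻¹ᵁ x.U)) : Germ a x a x :=
  Quotient.mk _ (IsoOnBig.refl a x _ h le_rfl)

/-- The inverse germ. -/
noncomputable def symm : Germ a x b y → Germ b y a x :=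
  Quotient.map IsoOnBig.symm fun φ ψ ⟨W, hW, h, h', e⟩ =>
    ⟨W, hW, h, h', by rw [symm_res, symm_res, e]⟩

/-- The composition of germs. -/
noncomputable def trans : Germ a x b y → Germ b y c z → Germ a x c z :=
  Quotient.map₂ IsoOnBig.trans fun φ φ' ⟨W, hW, h, h', e⟩ ψ ψ' ⟨V, hV, i, i', f⟩ =>
    ⟨W ⊓ V, hW.inf hV, le_inf (inf_le_left.trans h) (inf_le_right.trans i),
      le_inf (inf_le_left.trans h') (inf_le_right.trans i'), by
      rw [trans_res _ _ _ (inf_le_left.trans h) (inf_le_right.trans i),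
        trans_res _ _ _ (inf_le_left.trans h') (inf_le_right.trans i'),
        res_eq_of_le e inf_le_left, res_eq_of_le f inf_le_right]⟩

/-- Base change of germs along a morphism `g : S' ⟶ S`. -/
noncomputable def pull (g : S' ⟶ S) (a' : fam X S' ⟶ fam X T₁)
    (b' : fam X S' ⟶ fam X T₂) (ha : famMap X g ≫ a = a') (hb : famMap X g ≫ b = b') :
    Germ a x b y → Germ a' x b' y :=
  Quotient.map (fun φ => φ.pull g a' b' ha hb) fun _ _ ⟨W, hW, h, h', e⟩ =>
    ⟨famMap X g ⁻¹ᵁ W, hW.preimage g, (famMap X g).preimage_mono h,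
      (famMap X g).preimage_mono h',
      pull_res_congr g a' b' ha hb W h h' e _ le_rfl _ _⟩

lemma trans_assoc (φ : Germ a x b y) (ψ : Germ b y c z) (χ : Germ c z d t) :
    (φ.trans ψ).trans χ = φ.trans (ψ.trans χ) := by
  induction φ using Quotient.inductionOn with | _ φ
  induction ψ using Quotient.inductionOn with | _ ψ
  induction χ using Quotient.inductionOn with | _ χ
  have h1 : φ.W ⊓ ψ.W ⊓ χ.W ≤ φ.W := inf_le_left.trans inf_le_left
  have h2 : φ.W ⊓ ψ.W ⊓ χ.W ≤ ψ.W := inf_le_left.trans inf_le_right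
  have h3 : φ.W ⊓ ψ.W ⊓ χ.W ≤ χ.W := inf_le_right
  refine Quotient.sound ⟨φ.W ⊓ ψ.W ⊓ χ.W, (φ.isBig.inf ψ.isBig).inf χ.isBig,
    le_inf (le_inf h1 h2) h3, le_inf h1 (le_inf h2 h3), ?_⟩
  rw [trans_res _ _ _ (le_inf h1 h2) h3, trans_res _ _ _ h1 h2, trans_res _ _ _ h1 (le_inf h2 h3),
    trans_res _ _ _ h2 h3, Iso.trans_assoc]

lemma refl_trans (h : IsBig X (a ⁻¹ᵁ x.U)) (φ : Germ a x b y) : (refl a x h).trans φ = φ := by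
  induction φ using Quotient.inductionOn with | _ φ
  refine Quotient.sound ⟨φ.W, φ.isBig, le_inf φ.le₁ le_rfl, le_rfl, ?_⟩
  rw [trans_res _ _ _ φ.le₁ le_rfl, refl_res, Iso.refl_trans]

lemma trans_refl (h : IsBig X (b ⁻¹ᵁ y.U)) (φ : Germ a x b y) : φ.trans (refl b y h) = φ := by
  induction φ using Quotient.inductionOn with | _ φ
  refine Quotient.sound ⟨φ.W, φ.isBig, le_inf le_rfl φ.le₂, le_rfl, ?_⟩
  rw [trans_res _ _ _ le_rfl φ.le₂, refl_res, Iso.trans_refl]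

lemma trans_symm (h : IsBig X (a ⁻¹ᵁ x.U)) (φ : Germ a x b y) : φ.trans φ.symm = refl a x h := by
  induction φ using Quotient.inductionOn with | _ φ
  refine Quotient.sound ⟨φ.W, φ.isBig, le_inf le_rfl le_rfl, φ.le₁, ?_⟩
  refine (trans_res φ φ.symm φ.W le_rfl le_rfl).trans ?_
  rw [refl_res, symm_res, Iso.self_symm_id]

lemma symm_trans (h : IsBig X (b ⁻¹ᵁ y.U)) (φ : Germ a x b y) : φ.symm.trans φ = refl b y h := by
  induction φ using Quotient.inductionOn with | _ φ
  refine Quotient.sound ⟨φ.W, φ.isBig, le_inf le_rfl le_rfl, φ.le₂, ?_⟩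
  refine (trans_res φ.symm φ φ.W le_rfl le_rfl).trans ?_
  rw [refl_res, symm_res, Iso.symm_self_id]

section Pull

variable (g : S' ⟶ S) (a' : fam X S' ⟶ fam X T₁)
    (b' : fam X S' ⟶ fam X T₂) (c' : fam X S' ⟶ fam X T₃)
    (ha : famMap X g ≫ a = a') (hb : famMap X g ≫ b = b') (hc : famMap X g ≫ c = c')

lemma pull_refl (h : IsBig X (a ⁻¹ᵁ x.U)) (h' : IsBig X (a' ⁻¹ᵁ x.U)) :
    (refl a x h).pull g a' a' ha ha = refl a' x h' := by
  have hle : a' ⁻¹ᵁ x.U ≤ famMap X g ⁻¹ᵁ a ⁻¹ᵁ x.U := by rw [← ha]; exact le_rfl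
  exact Quotient.sound ⟨a' ⁻¹ᵁ x.U, h', hle, le_rfl,
    (pull_refl_res g a' ha _ h le_rfl _ hle _).trans (refl_res _ _ _ _ _).symm⟩

lemma pull_trans (φ : Germ a x b y) (ψ : Germ b y c z) :
    (φ.trans ψ).pull g a' c' ha hc = (φ.pull g a' b' ha hb).trans (ψ.pull g b' c' hb hc) := by
  induction φ using Quotient.inductionOn with | _ φ
  induction ψ using Quotient.inductionOn with | _ ψ
  exact Quotient.sound ⟨famMap X g ⁻¹ᵁ (φ.W ⊓ ψ.W), (φ.isBig.inf ψ.isBig).preimage g, le_rfl,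
    le_rfl, pull_trans_res φ ψ g a' b' c' ha hb hc (φ.W ⊓ ψ.W) inf_le_left inf_le_right
      _ le_rfl _ ((famMap X g).preimage_mono inf_le_left)
      ((famMap X g).preimage_mono inf_le_right)⟩

lemma pull_pull (g' : S'' ⟶ S') (a'' : fam X S'' ⟶ fam X T₁)
    (b'' : fam X S'' ⟶ fam X T₂) (ha' : famMap X g' ≫ a' = a'') (hb' : famMap X g' ≫ b' = b'')
    (e : S'' ⟶ S) (he : g' ≫ g = e) (ha'' : famMap X e ≫ a = a'') (hb'' : famMap X e ≫ b = b'')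
    (φ : Germ a x b y) :
    (φ.pull g a' b' ha hb).pull g' a'' b'' ha' hb' = φ.pull e a'' b'' ha'' hb'' := by
  induction φ using Quotient.inductionOn with | _ φ
  have hW : famMap X g' ⁻¹ᵁ famMap X g ⁻¹ᵁ φ.W ≤ famMap X e ⁻¹ᵁ φ.W := by
    rw [← he, ← famMap_comp]; exact le_rfl
  exact Quotient.sound ⟨famMap X g' ⁻¹ᵁ famMap X g ⁻¹ᵁ φ.W, (φ.isBig.preimage g).preimage g',
    le_rfl, hW, pull_pull_res φ g a' b' ha hb g' a'' b'' ha' hb' e he ha'' hb'' φ.W le_rfl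
      (famMap X g ⁻¹ᵁ φ.W) le_rfl _ le_rfl hW le_rfl _ _⟩

lemma pull_id (e : S ⟶ S) (he : e = 𝟙 S) (ha : famMap X e ≫ a = a) (hb : famMap X e ≫ b = b)
    (φ : Germ a x b y) : φ.pull e a b ha hb = φ := by
  induction φ using Quotient.inductionOn with | _ φ
  have h1 : famMap X e = 𝟙 _ := by rw [he, famMap_id]
  have hW : φ.W ≤ famMap X e ⁻¹ᵁ φ.W := by rw [h1]; exact le_rfl
  refine Quotient.sound ⟨_, φ.isBig, hW, le_rfl, ?_⟩
  refine (pull_res φ e a b ha hb _ le_rfl _ hW _).trans ?_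
  refine pullIso_id _ _ ?_ _ _
  have : ∀ (f : fam X S ⟶ fam X S) (hf : f = 𝟙 _) (h : φ.W ≤ f ⁻¹ᵁ φ.W),
    f.resLE φ.W φ.W h = 𝟙 _ := by
    rintro _ rfl h
    exact (Scheme.Hom.resLE_id _).trans (Scheme.homOfLE_rfl _ _)
  exact this _ h1 _

end Pull

end Germ

/-- The groupoid `F(T)`. A morphism `(E₁, U₁) ⟶ (E₂, U₂)` is given by an isomorphism
`E₁|_W ≅ E₂|_W` on an open subset `W ⊆ U₁ ∩ U₂` of `X_T` whose complement belongs to `Φ(T)`; two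
such isomorphisms are identified if they agree on a smaller open subset of this kind. -/
noncomputable instance (T : Over B) : Groupoid (PartialBundle X r T) where
  Hom x y := Germ (𝟙 (fam X T)) x (𝟙 (fam X T)) y
  id x := Germ.refl _ x x.isBig
  comp φ ψ := φ.trans ψ
  id_comp φ := Germ.refl_trans _ φ
  comp_id φ := Germ.trans_refl _ φ
  assoc φ ψ χ := Germ.trans_assoc φ ψ χ
  inv φ := φ.symm
  inv_comp φ := Germ.symm_trans _ φ
  comp_inv φ := Germ.trans_symm _ φ

namespace PartialBundle

/-- The pullback of an object of `F(T)` along `g : S ⟶ T`, as an object of `F(S)`. -/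
noncomputable def baseChange {S T : Over B} (g : S ⟶ T) (x : PartialBundle X r T) :
    PartialBundle X r S where
  U := famMap X g ⁻¹ᵁ x.U
  isBig := x.isBig.preimage g
  E := (Scheme.Modules.pullback (famMap X g ∣_ x.U)).obj x.E
  isVectorBundle := x.isVectorBundle.pullback _

/-- The canonical identification of the object `baseChange g x` with the pullback of `x`. -/
noncomputable def baseChangeGerm {S T : Over B} (g : S ⟶ T) (x : PartialBundle X r T) :
    Germ (𝟙 (fam X S)) (x.baseChange g) (famMap X g) x :=
  Quotient.mk _
    { W := famMap X g ⁻¹ᵁ x.U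
      isBig := x.isBig.preimage g
      le₁ := le_rfl
      le₂ := le_rfl
      iso := (Scheme.Modules.pullbackComp _ _).app x.E ≪≫
        (Scheme.Modules.pullbackCongr (by
          rw [← Scheme.Hom.resLE_eq_morphismRestrict]
          exact (Scheme.Hom.resLE_comp_resLE _ _ _ _).trans (by simp))).app x.E }

/-- The isomorphism between the objects `x.baseChange g` and `y.baseChange h` of `F(S)` given by a
germ of isomorphisms `g^* x ≅ h^* y`. -/
noncomputable def homOfGerm {S T₁ T₂ : Over B} (g : S ⟶ T₁) (x : PartialBundle X r T₁)
    (h : S ⟶ T₂) (y : PartialBundle X r T₂) (φ : Germ (famMap X g) x (famMap X h) y) :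
    Germ (𝟙 (fam X S)) (x.baseChange g) (𝟙 (fam X S)) (y.baseChange h) :=
  (x.baseChangeGerm g).trans (φ.trans (y.baseChangeGerm h).symm)

/-- The inverse of `homOfGerm`. -/
noncomputable def germOfHom {S T₁ T₂ : Over B} (g : S ⟶ T₁) (x : PartialBundle X r T₁)
    (h : S ⟶ T₂) (y : PartialBundle X r T₂)
    (ψ : Germ (𝟙 (fam X S)) (x.baseChange g) (𝟙 (fam X S)) (y.baseChange h)) :
    Germ (famMap X g) x (famMap X h) y :=
  (x.baseChangeGerm g).symm.trans (ψ.trans (y.baseChangeGerm h))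

lemma germOfHom_homOfGerm {S T₁ T₂ : Over B} (g : S ⟶ T₁) (x : PartialBundle X r T₁)
    (h : S ⟶ T₂) (y : PartialBundle X r T₂) (φ : Germ (famMap X g) x (famMap X h) y) :
    germOfHom g x h y (homOfGerm g x h y φ) = φ := by
  unfold germOfHom homOfGerm
  rw [Germ.trans_assoc, Germ.trans_assoc, Germ.symm_trans (y.isBig.preimage h),
    Germ.trans_refl, ← Germ.trans_assoc, Germ.symm_trans (x.isBig.preimage g), Germ.refl_trans]

lemma isBig_id_preimage {S : Over B} (x : PartialBundle X r S) :
    IsBig X ((𝟙 (fam X S) : fam X S ⟶ fam X S) ⁻¹ᵁ x.U) :=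
  x.isBig

lemma baseChangeGerm_trans_symm {S T : Over B} (g : S ⟶ T) (x : PartialBundle X r T) :
    (x.baseChangeGerm g).trans (x.baseChangeGerm g).symm =
      Germ.refl (𝟙 (fam X S)) (x.baseChange g) (isBig_id_preimage _) :=
  Germ.trans_symm _ _

lemma homOfGerm_germOfHom {S T₁ T₂ : Over B} (g : S ⟶ T₁) (x : PartialBundle X r T₁)
    (h : S ⟶ T₂) (y : PartialBundle X r T₂)
    (ψ : Germ (𝟙 (fam X S)) (x.baseChange g) (𝟙 (fam X S)) (y.baseChange h)) :
    homOfGerm g x h y (germOfHom g x h y ψ) = ψ := by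
  unfold germOfHom homOfGerm
  rw [Germ.trans_assoc, Germ.trans_assoc, baseChangeGerm_trans_symm, Germ.trans_refl,
    ← Germ.trans_assoc, baseChangeGerm_trans_symm, Germ.refl_trans]

lemma homOfGerm_refl {S T : Over B} (g : S ⟶ T) (x : PartialBundle X r T)
    (h : IsBig X (famMap X g ⁻¹ᵁ x.U)) :
    homOfGerm g x g x (Germ.refl _ x h) =
      Germ.refl (𝟙 (fam X S)) (x.baseChange g) (isBig_id_preimage _) := by
  unfold homOfGerm
  rw [Germ.refl_trans, baseChangeGerm_trans_symm]

lemma homOfGerm_trans {S T₁ T₂ T₃ : Over B} (g : S ⟶ T₁) (x : PartialBundle X r T₁)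
    (h : S ⟶ T₂) (y : PartialBundle X r T₂) (k : S ⟶ T₃) (z : PartialBundle X r T₃)
    (φ : Germ (famMap X g) x (famMap X h) y) (ψ : Germ (famMap X h) y (famMap X k) z) :
    homOfGerm g x k z (φ.trans ψ) = (homOfGerm g x h y φ).trans (homOfGerm h y k z ψ) := by
  unfold homOfGerm
  rw [Germ.trans_assoc, Germ.trans_assoc, Germ.trans_assoc,
    ← Germ.trans_assoc (y.baseChangeGerm h).symm,
    Germ.symm_trans (y.isBig.preimage h), Germ.refl_trans]

/-- Germs of isomorphisms between the pullbacks of `x` and `y` to `S` are the same thing as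
morphisms of `F(S)` between these pullbacks. -/
noncomputable def homEquiv {S T₁ T₂ : Over B} (g : S ⟶ T₁) (x : PartialBundle X r T₁)
    (h : S ⟶ T₂) (y : PartialBundle X r T₂) :
    Germ (famMap X g) x (famMap X h) y ≃ (x.baseChange g ⟶ y.baseChange h) where
  toFun := homOfGerm g x h y
  invFun := germOfHom g x h y
  left_inv := germOfHom_homOfGerm g x h y
  right_inv := homOfGerm_germOfHom g x h y

variable (X r) in
/-- The pullback functor `g^* : F(T) ⥤ F(S)`. -/
noncomputable def pullbackFunctor {S T : Over B} (g : S ⟶ T) :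
    PartialBundle X r T ⥤ PartialBundle X r S where
  obj x := x.baseChange g
  map {x y} φ := homEquiv g x g y (Germ.pull g _ _ (Category.comp_id _) (Category.comp_id _) φ)
  map_id x := (congrArg _ (Germ.pull_refl g _ _ _ (x.isBig.preimage g))).trans
    (homOfGerm_refl g x _)
  map_comp φ ψ := (congrArg _ (Germ.pull_trans g _ _ _ _ _ _ φ ψ)).trans
    (homOfGerm_trans g _ g _ g _ _ _)

end PartialBundle

end Germs

/-! ### The filtered colimit of the groupoids `F(R_α)` -/

section Colimit

open Opposite

variable {B : Scheme.{u}} (X : Over B) (r : ℕ) {J : Type u} [SmallCategory J]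
  (T : Jᵒᵖ ⥤ Over B)

/-- An object of the colimit of the categories `F(T_j)`: an index `j` and an object of `F(T_j)`. -/
structure ColimObj where
  /-- The index. -/
  idx : J
  /-- The object of `F(T_j)`. -/
  obj : PartialBundle X r (T.obj (op idx))

variable {X r T}

/-- A representative of a morphism `(i, x) ⟶ (j, y)` in the colimit: an index `l` with maps `i ⟶ l`,
`j ⟶ l`, and an isomorphism between the pullbacks of `x` and `y` in `F(T_l)`. -/
structure ColimRep (x y : ColimObj X r T) where
  /-- The index over which the morphism is defined. -/
  l : J
  /-- The first transition map. -/
  f : x.idx ⟶ l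
  /-- The second transition map. -/
  g : y.idx ⟶ l
  /-- The isomorphism between the pullbacks. -/
  germ : Germ (famMap X (T.map f.op)) x.obj (famMap X (T.map g.op)) y.obj

/-- Transition of a germ along `u : l ⟶ m`. -/
noncomputable def push {i j l m : J} {x : PartialBundle X r (T.obj (op i))}
    {y : PartialBundle X r (T.obj (op j))} {f : i ⟶ l} {g : j ⟶ l}
    (φ : Germ (famMap X (T.map f.op)) x (famMap X (T.map g.op)) y) (u : l ⟶ m)
    (f' : i ⟶ m) (g' : j ⟶ m) (hf : f ≫ u = f') (hg : g ≫ u = g') :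
    Germ (famMap X (T.map f'.op)) x (famMap X (T.map g'.op)) y :=
  φ.pull (T.map u.op) _ _ (by rw [famMap_comp, ← T.map_comp, ← op_comp, hf])
    (by rw [famMap_comp, ← T.map_comp, ← op_comp, hg])

section Push

variable {i j k l m n : J} {x : PartialBundle X r (T.obj (op i))}
    {y : PartialBundle X r (T.obj (op j))} {z : PartialBundle X r (T.obj (op k))}
    {f : i ⟶ l} {g : j ⟶ l} {h : k ⟶ l}

lemma push_push (φ : Germ (famMap X (T.map f.op)) x (famMap X (T.map g.op)) y) (u : l ⟶ m)
    (f' : i ⟶ m) (g' : j ⟶ m) (hf : f ≫ u = f') (hg : g ≫ u = g') (v : m ⟶ n)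
    (f'' : i ⟶ n) (g'' : j ⟶ n) (hf' : f' ≫ v = f'') (hg' : g' ≫ v = g'')
    (w : l ⟶ n) (hw : u ≫ v = w) :
    push (push φ u f' g' hf hg) v f'' g'' hf' hg' =
      push φ w f'' g'' (by rw [← hw, ← Category.assoc, hf, hf'])
        (by rw [← hw, ← Category.assoc, hg, hg']) :=
  Germ.pull_pull _ _ _ _ _ _ _ _ _ _ _ (by rw [← T.map_comp, ← op_comp, hw]) _ _ φ

lemma push_id (φ : Germ (famMap X (T.map f.op)) x (famMap X (T.map g.op)) y) :
    push φ (𝟙 l) f g (Category.comp_id f) (Category.comp_id g) = φ :=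
  Germ.pull_id _ (by simp) _ _ φ

lemma push_trans (φ : Germ (famMap X (T.map f.op)) x (famMap X (T.map g.op)) y)
    (ψ : Germ (famMap X (T.map g.op)) y (famMap X (T.map h.op)) z) (u : l ⟶ m)
    (f' : i ⟶ m) (g' : j ⟶ m) (h' : k ⟶ m) (hf : f ≫ u = f') (hg : g ≫ u = g')
    (hh : h ≫ u = h') :
    push (φ.trans ψ) u f' h' hf hh = (push φ u f' g' hf hg).trans (push ψ u g' h' hg hh) :=
  Germ.pull_trans _ _ _ _ _ _ _ φ ψ

lemma push_refl (hx : IsBig X (famMap X (T.map f.op) ⁻¹ᵁ x.U)) (u : l ⟶ m) (f' : i ⟶ m)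
    (hf : f ≫ u = f') (hx' : IsBig X (famMap X (T.map f'.op) ⁻¹ᵁ x.U)) :
    push (Germ.refl (famMap X (T.map f.op)) x hx) u f' f' hf hf = Germ.refl _ x hx' :=
  Germ.pull_refl _ _ _ _ _

end Push

namespace ColimRep

variable {x y z w : ColimObj X r T}

/-- Two representatives define the same morphism if they become equal over some index. -/
def Rel (φ ψ : ColimRep x y) : Prop :=
  ∃ (m : J) (u : φ.l ⟶ m) (v : ψ.l ⟶ m) (f : x.idx ⟶ m) (g : y.idx ⟶ m) (hf : φ.f ≫ u = f)
    (hg : φ.g ≫ u = g) (hf' : ψ.f ≫ v = f) (hg' : ψ.g ≫ v = g),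
    push φ.germ u f g hf hg = push ψ.germ v f g hf' hg'

lemma Rel.equivalence [IsFiltered J] : Equivalence (Rel (x := x) (y := y)) where
  refl φ := ⟨φ.l, 𝟙 _, 𝟙 _, φ.f, φ.g, by simp, by simp, by simp, by simp, rfl⟩
  symm := fun ⟨m, u, v, f, g, hf, hg, hf', hg', e⟩ => ⟨m, v, u, f, g, hf', hg', hf, hg, e.symm⟩
  trans := by
    rintro φ ψ χ ⟨m, u, v, f, g, hf, hg, hf', hg', e⟩ ⟨m', u', v', f', g', kf, kg, kf', kg', e'⟩
    obtain ⟨n, s, s', hs⟩ := IsFiltered.span v u'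
    have h1 : f ≫ s = f' ≫ s' := by rw [← hf', ← kf, Category.assoc, Category.assoc, hs]
    have h2 : g ≫ s = g' ≫ s' := by rw [← hg', ← kg, Category.assoc, Category.assoc, hs]
    refine ⟨n, u ≫ s, v' ≫ s', f ≫ s, g ≫ s, by rw [← hf, Category.assoc],
      by rw [← hg, Category.assoc], by rw [h1, ← kf', Category.assoc],
      by rw [h2, ← kg', Category.assoc], ?_⟩
    rw [← push_push φ.germ u f g hf hg s _ _ rfl rfl _ rfl, e,
      push_push ψ.germ v f g hf' hg' s _ _ rfl rfl _ rfl,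
      ← push_push χ.germ v' f' g' kf' kg' s' _ _ h1.symm h2.symm _ rfl, ← e',
      push_push ψ.germ u' f' g' kf kg s' _ _ h1.symm h2.symm _ hs.symm]

variable (x y) in
/-- The equivalence relation of defining the same morphism. -/
@[reducible] def setoid [IsFiltered J] : Setoid (ColimRep x y) := ⟨Rel, Rel.equivalence⟩

/-- The composition, formed over an index `m` dominating the two given ones. -/
noncomputable def compAt (φ : ColimRep x y) (ψ : ColimRep y z) {m : J} (u : φ.l ⟶ m) (v : ψ.l ⟶ m)
    (f : x.idx ⟶ m) (g : y.idx ⟶ m) (h : z.idx ⟶ m) (hf : φ.f ≫ u = f) (hg : φ.g ≫ u = g)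
    (hg' : ψ.f ≫ v = g) (hh : ψ.g ≫ v = h) : ColimRep x z :=
  ⟨m, f, h, (push φ.germ u f g hf hg).trans (push ψ.germ v g h hg' hh)⟩

lemma compAt_rel_push (φ : ColimRep x y) (ψ : ColimRep y z) {m n : J} (u : φ.l ⟶ m) (v : ψ.l ⟶ m)
    (f : x.idx ⟶ m) (g : y.idx ⟶ m) (h : z.idx ⟶ m) (hf : φ.f ≫ u = f) (hg : φ.g ≫ u = g)
    (hg' : ψ.f ≫ v = g) (hh : ψ.g ≫ v = h)
    (s : m ⟶ n) (u' : φ.l ⟶ n) (v' : ψ.l ⟶ n) (hu : u ≫ s = u') (hv : v ≫ s = v')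
    (f' : x.idx ⟶ n) (g' : y.idx ⟶ n) (h' : z.idx ⟶ n) (kf : φ.f ≫ u' = f') (kg : φ.g ≫ u' = g')
    (kg' : ψ.f ≫ v' = g') (kh : ψ.g ≫ v' = h') :
    Rel (compAt φ ψ u v f g h hf hg hg' hh) (compAt φ ψ u' v' f' g' h' kf kg kg' kh) := by
  have e1 : f ≫ s = f' := by rw [← hf, ← kf, ← hu, Category.assoc]
  have e2 : g ≫ s = g' := by rw [← hg, ← kg, ← hu, Category.assoc]
  have e3 : h ≫ s = h' := by rw [← hh, ← kh, ← hv, Category.assoc]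
  refine ⟨n, s, 𝟙 n, f', h', e1, e3, Category.comp_id _, Category.comp_id _, ?_⟩
  refine Eq.trans ?_ (push_id _).symm
  refine (push_trans _ _ s f' g' h' e1 e2 e3).trans ?_
  exact congrArg₂ Germ.trans (push_push φ.germ u f g hf hg s f' g' e1 e2 u' hu)
    (push_push ψ.germ v g h hg' hh s g' h' e2 e3 v' hv)

variable [IsFiltered J]

lemma compAt_rel_compAt (φ : ColimRep x y) (ψ : ColimRep y z) {m n : J} (u : φ.l ⟶ m)
    (v : ψ.l ⟶ m) (f : x.idx ⟶ m) (g : y.idx ⟶ m) (h : z.idx ⟶ m) (hf : φ.f ≫ u = f)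
    (hg : φ.g ≫ u = g) (hg' : ψ.f ≫ v = g) (hh : ψ.g ≫ v = h) (u' : φ.l ⟶ n) (v' : ψ.l ⟶ n)
    (f' : x.idx ⟶ n) (g' : y.idx ⟶ n) (h' : z.idx ⟶ n) (kf : φ.f ≫ u' = f') (kg : φ.g ≫ u' = g')
    (kg' : ψ.f ≫ v' = g') (kh : ψ.g ≫ v' = h') :
    Rel (compAt φ ψ u v f g h hf hg hg' hh) (compAt φ ψ u' v' f' g' h' kf kg kg' kh) := by
  obtain ⟨p, s, s', hu, hv⟩ := IsFiltered.bowtie u u' v v'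
  have k : φ.g ≫ u ≫ s = ψ.f ≫ v ≫ s := by
    rw [← Category.assoc, hg, ← hg', Category.assoc]
  exact Rel.equivalence.trans
    (compAt_rel_push φ ψ u v f g h hf hg hg' hh s _ _ rfl rfl _ _ _ rfl k rfl rfl)
    (Rel.equivalence.symm
      (compAt_rel_push φ ψ u' v' f' g' h' kf kg kg' kh s' _ _ hu.symm hv.symm _ _ _ rfl k rfl rfl))

lemma compAt_congr_left {φ φ' : ColimRep x y} (e : Rel φ φ') (ψ : ColimRep y z) {m n : J}
    (u : φ.l ⟶ m) (v : ψ.l ⟶ m) (f : x.idx ⟶ m) (g : y.idx ⟶ m) (h : z.idx ⟶ m) (hf : φ.f ≫ u = f)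
    (hg : φ.g ≫ u = g) (hg' : ψ.f ≫ v = g) (hh : ψ.g ≫ v = h) (u' : φ'.l ⟶ n) (v' : ψ.l ⟶ n)
    (f' : x.idx ⟶ n) (g' : y.idx ⟶ n) (h' : z.idx ⟶ n) (kf : φ'.f ≫ u' = f')
    (kg : φ'.g ≫ u' = g') (kg' : ψ.f ≫ v' = g') (kh : ψ.g ≫ v' = h') :
    Rel (compAt φ ψ u v f g h hf hg hg' hh) (compAt φ' ψ u' v' f' g' h' kf kg kg' kh) := by
  obtain ⟨p, s, s', a, b, hs₁, hs₂, hs₁', hs₂', e⟩ := e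
  obtain ⟨q, t, t', ht⟩ := IsFiltered.span b ψ.f
  have a1 : φ.f ≫ s ≫ t = a ≫ t := by rw [← Category.assoc, hs₁]
  have a2 : φ'.f ≫ s' ≫ t = a ≫ t := by rw [← Category.assoc, hs₁']
  have a3 : φ.g ≫ s ≫ t = b ≫ t := by rw [← Category.assoc, hs₂]
  have a4 : φ'.g ≫ s' ≫ t = b ≫ t := by rw [← Category.assoc, hs₂']
  have key : push φ.germ (s ≫ t) (a ≫ t) (b ≫ t) a1 a3 =
      push φ'.germ (s' ≫ t) (a ≫ t) (b ≫ t) a2 a4 := by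
    rw [← push_push φ.germ s a b hs₁ hs₂ t _ _ rfl rfl _ rfl, e,
      push_push φ'.germ s' a b hs₁' hs₂' t _ _ rfl rfl _ rfl]
  have h1 := compAt_rel_compAt φ ψ u v f g h hf hg hg' hh (s ≫ t) t' _ _ _ a1 a3 ht.symm rfl
  have h2 := compAt_rel_compAt φ' ψ u' v' f' g' h' kf kg kg' kh (s' ≫ t) t' _ _ _ a2 a4 ht.symm rfl
  unfold compAt at h1 h2 ⊢
  rw [key] at h1
  exact Rel.equivalence.trans h1 (Rel.equivalence.symm h2)

lemma compAt_congr_right (φ : ColimRep x y) {ψ ψ' : ColimRep y z} (e : Rel ψ ψ') {m n : J}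
    (u : φ.l ⟶ m) (v : ψ.l ⟶ m) (f : x.idx ⟶ m) (g : y.idx ⟶ m) (h : z.idx ⟶ m) (hf : φ.f ≫ u = f)
    (hg : φ.g ≫ u = g) (hg' : ψ.f ≫ v = g) (hh : ψ.g ≫ v = h) (u' : φ.l ⟶ n) (v' : ψ'.l ⟶ n)
    (f' : x.idx ⟶ n) (g' : y.idx ⟶ n) (h' : z.idx ⟶ n) (kf : φ.f ≫ u' = f')
    (kg : φ.g ≫ u' = g') (kg' : ψ'.f ≫ v' = g') (kh : ψ'.g ≫ v' = h') :
    Rel (compAt φ ψ u v f g h hf hg hg' hh) (compAt φ ψ' u' v' f' g' h' kf kg kg' kh) := by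
  obtain ⟨p, s, s', a, b, hs₁, hs₂, hs₁', hs₂', e⟩ := e
  obtain ⟨q, t', t, ht⟩ := IsFiltered.span φ.g a
  have a1 : ψ.f ≫ s ≫ t = a ≫ t := by rw [← Category.assoc, hs₁]
  have a2 : ψ'.f ≫ s' ≫ t = a ≫ t := by rw [← Category.assoc, hs₁']
  have a3 : ψ.g ≫ s ≫ t = b ≫ t := by rw [← Category.assoc, hs₂]
  have a4 : ψ'.g ≫ s' ≫ t = b ≫ t := by rw [← Category.assoc, hs₂']
  have key : push ψ.germ (s ≫ t) (a ≫ t) (b ≫ t) a1 a3 =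
      push ψ'.germ (s' ≫ t) (a ≫ t) (b ≫ t) a2 a4 := by
    rw [← push_push ψ.germ s a b hs₁ hs₂ t _ _ rfl rfl _ rfl, e,
      push_push ψ'.germ s' a b hs₁' hs₂' t _ _ rfl rfl _ rfl]
  have h1 := compAt_rel_compAt φ ψ u v f g h hf hg hg' hh t' (s ≫ t) _ _ _ rfl ht a1 a3
  have h2 := compAt_rel_compAt φ ψ' u' v' f' g' h' kf kg kg' kh t' (s' ≫ t) _ _ _ rfl ht a2 a4
  unfold compAt at h1 h2 ⊢
  rw [key] at h1
  exact Rel.equivalence.trans h1 (Rel.equivalence.symm h2)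

/-- The composition of representatives (over some index dominating the two given ones). -/
noncomputable def comp (φ : ColimRep x y) (ψ : ColimRep y z) : ColimRep x z :=
  compAt φ ψ (m := (IsFiltered.span φ.g ψ.f).choose)
    (IsFiltered.span φ.g ψ.f).choose_spec.choose
    (IsFiltered.span φ.g ψ.f).choose_spec.choose_spec.choose _ _ _ rfl rfl
    (IsFiltered.span φ.g ψ.f).choose_spec.choose_spec.choose_spec.symm rfl

lemma comp_rel_compAt (φ : ColimRep x y) (ψ : ColimRep y z) {m : J} (u : φ.l ⟶ m) (v : ψ.l ⟶ m)
    (f : x.idx ⟶ m) (g : y.idx ⟶ m) (h : z.idx ⟶ m) (hf : φ.f ≫ u = f) (hg : φ.g ≫ u = g)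
    (hg' : ψ.f ≫ v = g) (hh : ψ.g ≫ v = h) :
    Rel (comp φ ψ) (compAt φ ψ u v f g h hf hg hg' hh) :=
  compAt_rel_compAt ..

lemma comp_congr {φ φ' : ColimRep x y} (e : Rel φ φ') {ψ ψ' : ColimRep y z} (e' : Rel ψ ψ') :
    Rel (comp φ ψ) (comp φ' ψ') := by
  obtain ⟨m, u, v, h⟩ := IsFiltered.span φ'.g ψ.f
  exact Rel.equivalence.trans
    (compAt_congr_left e ψ _ _ _ _ _ _ _ _ _ u v _ _ _ rfl h rfl rfl)
    (compAt_congr_right φ' e' u v _ _ _ rfl h rfl rfl _ _ _ _ _ _ _ _ _)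

variable (x) in
/-- The identity. -/
noncomputable def id : ColimRep x x :=
  ⟨x.idx, 𝟙 _, 𝟙 _, Germ.refl _ x.obj (x.obj.isBig.preimage _)⟩

lemma id_comp (φ : ColimRep x y) : Rel (comp (id x) φ) φ := by
  refine Rel.equivalence.trans (comp_rel_compAt (id x) φ φ.f (𝟙 _) φ.f φ.f φ.g
    (Category.id_comp _) (Category.id_comp _) (Category.comp_id _) (Category.comp_id _)) ?_
  have : compAt (id x) φ φ.f (𝟙 _) φ.f φ.f φ.g
    (Category.id_comp _) (Category.id_comp _) (Category.comp_id _) (Category.comp_id _) = φ := by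
    unfold compAt
    rw [push_id]
    have h := push_refl (T := T) (x := x.obj) (f := 𝟙 x.idx) (x.obj.isBig.preimage _) φ.f φ.f
      (Category.id_comp _) (x.obj.isBig.preimage _)
    exact congrArg (ColimRep.mk φ.l φ.f φ.g)
      ((congrArg (fun a => Germ.trans a φ.germ) h).trans (Germ.refl_trans _ _))
  rw [this]
  exact Rel.equivalence.refl φ

lemma comp_id (φ : ColimRep x y) : Rel (comp φ (id y)) φ := by
  refine Rel.equivalence.trans (comp_rel_compAt φ (id y) (𝟙 _) φ.g φ.f φ.g φ.g
    (Category.comp_id _) (Category.comp_id _) (Category.id_comp _) (Category.id_comp _)) ?_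
  have : compAt φ (id y) (𝟙 _) φ.g φ.f φ.g φ.g
    (Category.comp_id _) (Category.comp_id _) (Category.id_comp _) (Category.id_comp _) = φ := by
    unfold compAt
    rw [push_id]
    have h := push_refl (T := T) (x := y.obj) (f := 𝟙 y.idx) (y.obj.isBig.preimage _) φ.g φ.g
      (Category.id_comp _) (y.obj.isBig.preimage _)
    exact congrArg (ColimRep.mk φ.l φ.f φ.g)
      ((congrArg (fun a => Germ.trans φ.germ a) h).trans (Germ.trans_refl _ _))
  rw [this]
  exact Rel.equivalence.refl φ

lemma assoc (φ : ColimRep x y) (ψ : ColimRep y z) (χ : ColimRep z w) :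
    Rel (comp (comp φ ψ) χ) (comp φ (comp ψ χ)) := by
  obtain ⟨m, u, v, h⟩ := IsFiltered.span φ.g ψ.f
  obtain ⟨n, s, t, k⟩ := IsFiltered.span (ψ.g ≫ v) χ.f
  obtain ⟨p, hp⟩ : ∃ p, p = φ.f ≫ u ≫ s := ⟨_, rfl⟩
  obtain ⟨q, hq⟩ : ∃ q, q = φ.g ≫ u ≫ s := ⟨_, rfl⟩
  obtain ⟨q₁, hq₁⟩ : ∃ q₁, q₁ = χ.f ≫ t := ⟨_, rfl⟩
  obtain ⟨q₂, hq₂⟩ : ∃ q₂, q₂ = χ.g ≫ t := ⟨_, rfl⟩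
  have e0 : ψ.f ≫ v ≫ s = q := by rw [hq, ← Category.assoc, ← h, Category.assoc]
  have e1 : ψ.g ≫ v ≫ s = q₁ := by rw [hq₁, ← Category.assoc, k]
  have h1 := comp_rel_compAt φ ψ (u ≫ s) (v ≫ s) p q q₁ hp.symm hq.symm e0 e1
  have h2 := comp_rel_compAt ψ χ (v ≫ s) t q q₁ q₂ e0 e1 hq₁.symm hq₂.symm
  have h3 := Rel.equivalence.trans (comp_congr h1 (Rel.equivalence.refl χ))
    (comp_rel_compAt (compAt φ ψ (u ≫ s) (v ≫ s) p q q₁ hp.symm hq.symm e0 e1) χ (𝟙 n) t p q₁ q₂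
      (Category.comp_id _) (Category.comp_id _) hq₁.symm hq₂.symm)
  have h4 := Rel.equivalence.trans (comp_congr (Rel.equivalence.refl φ) h2)
    (comp_rel_compAt φ (compAt ψ χ (v ≫ s) t q q₁ q₂ e0 e1 hq₁.symm hq₂.symm) (u ≫ s) (𝟙 n) p q q₂
      hp.symm hq.symm (Category.comp_id _) (Category.comp_id _))
  refine Rel.equivalence.trans h3 (Rel.equivalence.trans ?_ (Rel.equivalence.symm h4))
  have key : compAt (compAt φ ψ (u ≫ s) (v ≫ s) p q q₁ hp.symm hq.symm e0 e1) χ (𝟙 n) t p q₁ q₂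
      (Category.comp_id _) (Category.comp_id _) hq₁.symm hq₂.symm =
      compAt φ (compAt ψ χ (v ≫ s) t q q₁ q₂ e0 e1 hq₁.symm hq₂.symm) (u ≫ s) (𝟙 n) p q q₂
      hp.symm hq.symm (Category.comp_id _) (Category.comp_id _) := by
    refine congrArg (ColimRep.mk n p q₂) ?_
    refine (congrArg (fun a => Germ.trans a _) (push_id _)).trans ?_
    exact (Germ.trans_assoc _ _ _).trans (congrArg (Germ.trans _) (push_id _).symm)
  rw [key]
  exact Rel.equivalence.refl _

end ColimRep

/-- The restriction to `S` of the germ representing a morphism of the colimit, for `S` a scheme over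
all the `T_j`. -/
noncomputable def ColimRep.eval (s : Cone T) {x y : ColimObj X r T} (φ : ColimRep x y) :
    Germ (famMap X (s.π.app (op x.idx))) x.obj (famMap X (s.π.app (op y.idx))) y.obj :=
  φ.germ.pull (s.π.app (op φ.l)) _ _ (by rw [famMap_comp, s.w]) (by rw [famMap_comp, s.w])

lemma ColimRep.push_pull (s : Cone T) {i j l m : J} {x : PartialBundle X r (T.obj (op i))}
    {y : PartialBundle X r (T.obj (op j))} {f : i ⟶ l} {g : j ⟶ l}
    (φ : Germ (famMap X (T.map f.op)) x (famMap X (T.map g.op)) y) (u : l ⟶ m)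
    (f' : i ⟶ m) (g' : j ⟶ m) (hf : f ≫ u = f') (hg : g ≫ u = g') :
    (push φ u f' g' hf hg).pull (s.π.app (op m)) (famMap X (s.π.app (op i)))
        (famMap X (s.π.app (op j))) (by rw [famMap_comp, s.w]) (by rw [famMap_comp, s.w]) =
      φ.pull (s.π.app (op l)) (famMap X (s.π.app (op i))) (famMap X (s.π.app (op j)))
        (by rw [famMap_comp, s.w]) (by rw [famMap_comp, s.w]) :=
  Germ.pull_pull _ _ _ _ _ _ _ _ _ _ _ (s.w u.op) _ _ φ

lemma ColimRep.eval_congr (s : Cone T) {x y : ColimObj X r T} {φ ψ : ColimRep x y}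
    (e : Rel φ ψ) : φ.eval s = ψ.eval s := by
  obtain ⟨m, u, v, f, g, hf, hg, hf', hg', e⟩ := e
  unfold ColimRep.eval
  rw [← ColimRep.push_pull s φ.germ u f g hf hg, ← ColimRep.push_pull s ψ.germ v f g hf' hg', e]

lemma ColimRep.eval_id (s : Cone T) (x : ColimObj X r T) :
    (ColimRep.id x).eval s = Germ.refl _ x.obj (x.obj.isBig.preimage _) :=
  Germ.pull_refl _ _ _ _ _

variable [IsFiltered J]

open ColimRep

/-- The colimit of the groupoids `F(T_j)`, for `T` a cofiltered system of `B`-schemes `T_j`. The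
morphisms `(i, x) ⟶ (j, y)` form the filtered colimit, over the indices `l` with maps `i ⟶ l` and
`j ⟶ l`, of the sets of morphisms in `F(T_l)` between the pullbacks of `x` and `y`. -/
noncomputable instance : Category (ColimObj X r T) where
  Hom x y := Quotient (ColimRep.setoid x y)
  id x := Quotient.mk _ (ColimRep.id x)
  comp := Quotient.map₂ ColimRep.comp fun _ _ e _ _ e' => comp_congr e e'
  id_comp φ := by
    induction φ using Quotient.inductionOn with | _ φ
    exact Quotient.sound (ColimRep.id_comp φ)
  comp_id φ := by
    induction φ using Quotient.inductionOn with | _ φ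
    exact Quotient.sound (ColimRep.comp_id φ)
  assoc φ ψ χ := by
    induction φ using Quotient.inductionOn with | _ φ
    induction ψ using Quotient.inductionOn with | _ ψ
    induction χ using Quotient.inductionOn with | _ χ
    exact Quotient.sound (ColimRep.assoc φ ψ χ)

lemma ColimRep.eval_comp (s : Cone T) {x y z : ColimObj X r T} (φ : ColimRep x y)
    (ψ : ColimRep y z) : (φ.comp ψ).eval s = (φ.eval s).trans (ψ.eval s) := by
  obtain ⟨m, u, v, h⟩ := IsFiltered.span φ.g ψ.f
  rw [ColimRep.eval_congr s (comp_rel_compAt φ ψ u v _ _ _ rfl h rfl rfl)]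
  refine (Germ.pull_trans _ _ (famMap X (s.π.app (op y.idx))) _ _
    ((famMap_comp X _ _).trans (congrArg (famMap X) (s.w (ψ.f ≫ v).op))) _ _ _).trans ?_
  exact congrArg₂ Germ.trans (ColimRep.push_pull s φ.germ _ _ _ _ _)
    (ColimRep.push_pull s ψ.germ _ _ _ _ _)

variable (X r T) in
/-- The canonical functor from the colimit of the groupoids `F(T_j)` to `F(S)`, for `S` a scheme
over all the `T_j`: on objects, it sends `(j, x)` to the pullback of `x` to `S`, and on morphisms,
it is also given by pullback. -/
noncomputable def colimComparison (s : Cone T) : ColimObj X r T ⥤ PartialBundle X r s.pt where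
  obj x := x.obj.baseChange (s.π.app (op x.idx))
  map {x y} := Quotient.lift (fun φ => PartialBundle.homEquiv _ _ _ _ (φ.eval s))
    fun _ _ e => congrArg _ (ColimRep.eval_congr s e)
  map_id x := (congrArg (PartialBundle.homOfGerm _ _ _ _) (ColimRep.eval_id s x)).trans
    (PartialBundle.homOfGerm_refl _ _ _)
  map_comp φ ψ := by
    induction φ using Quotient.inductionOn with | _ φ
    induction ψ using Quotient.inductionOn with | _ ψ
    exact (congrArg (PartialBundle.homOfGerm _ _ _ _) (ColimRep.eval_comp s φ ψ)).trans
      (PartialBundle.homOfGerm_trans _ _ _ _ _ _ _ _)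

end Colimit

end GenericBundles

/-! ### Heights of primes in polynomial rings over a field. -/

section

/-! The scheme `X_R` is the inverse limit of the `X_{R_α}` along affine transition maps, and all
these schemes are noetherian since `X_k` is of finite type. Open subsets of `X_R`, functions on them
and equations between such functions therefore come from some stage. Once finitely many local frames
are chosen, a vector bundle is a finite collection of transition matrices satisfying finitely many
equations, and a morphism of bundles is a finite collection of matrices compatible with them. Hence
bundles, isomorphisms and equalities of isomorphisms over a fixed open subset descend to a stage:
`exists_isVectorBundle_resLE`, `exists_pullIso_resLE`, `exists_pullIso_resLE_eq`.

What remains is that the codimension condition descends: if the preimage in `X_R` of an open `U ⊆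
X_{R_α}` is big, then so is its preimage over some later `R_β`. This is `exists_isBig_preimage`, the
heart of the proof. Cover `X_k` by finitely many affine charts `Spec A`. Irreducibility makes the
nilradical of `A` prime. Take a Noether normalization `k[y_1, …, y_d] → A`. For a field `K` over
`k`, the ring `A ⊗ K` is integral over `K[y]`, and going down shows that a prime and its contraction
to `K[y]` have the same height (`height_under_eq_of_isPushout`). In `K[y]`, a prime has height at
most `2` exactly when some `d - 2` of the variables are algebraically independent modulo it
(`MvPolynomial.height_le_two_iff`). So a prime `P` of `A ⊗ R` violates the codimension condition
exactly when, for one of finitely many subsets of the variables, every polynomial relation modulo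
`P` over `R` has its coefficients in `P` (`three_le_ringKrullDim_iff`).

This is a family of conditions `a ∈ P → b ∈ P`, compatible with the maps `A ⊗ R_α → A ⊗ R_β`. If
each later stage had a violating prime outside the preimage of `U`, such primes would form an
inverse system of nonempty compact Hausdorff spaces, and a point of its limit would be a violating
prime over `R` (`exists_prime_of_isColimit`).

With these descent statements collected in `IsGoodLimit`, faithfulness, fullness and essential
surjectivity follow by passing to germs. -/

lemma MvPolynomial.height_eq_natCard_of_isMaximal {F : Type*} [Field F] {σ : Type*} [Finite σ]
    (P : Ideal (MvPolynomial σ F)) [hP : P.IsMaximal] : P.height = Nat.card σ := by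
  induction σ using Finite.induction_empty_option with
  | of_equiv e H =>
    have := H ((P.comap (MvPolynomial.renameEquiv F e).toRingEquiv))
      (hP := Ideal.comap_isMaximal_of_equiv (MvPolynomial.renameEquiv F e).toRingEquiv)
    rw [RingEquiv.height_comap] at this
    rw [this, Nat.card_congr e]
  | h_empty =>
    simp only [Nat.card_eq_fintype_card, Fintype.card_pempty, CharP.cast_eq_zero]
    have : ringKrullDim (MvPolynomial PEmpty F) = 0 := by simp
    have h := Ideal.height_le_ringKrullDim_of_ne_top (hP.ne_top)
    rw [this] at h
    simpa using h
  | @h_option α _ IH =>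
    let e := (MvPolynomial.optionEquivLeft F α).toRingEquiv
    have h1 : (P.comap e.symm).IsMaximal := Ideal.comap_isMaximal_of_equiv e.symm
    -- Nullstellensatz: over a Jacobson ring, a maximal ideal of the one-variable polynomial ring
    -- contracts to a maximal ideal, and the contraction has height one less.
    have h2 : ((P.comap e.symm).comap Polynomial.C).IsMaximal :=
      Polynomial.isMaximal_comap_C_of_isJacobsonRing _
    have : (P.comap e.symm).LiesOver ((P.comap e.symm).comap Polynomial.C) := ⟨rfl⟩
    have h3 := Polynomial.height_eq_height_add_one ((P.comap e.symm).comap Polynomial.C)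
      (P.comap e.symm)
    rw [RingEquiv.height_comap, IH] at h3
    rw [h3]
    simp

section
variable {S : Type*} [CommRing S] [IsDomain S] {τ : Type*} [Finite τ]
  (P : Ideal (MvPolynomial τ S)) [P.IsPrime] (hP : P.comap MvPolynomial.C = ⊥)

include hP

omit [Finite τ] [P.IsPrime] in
lemma disjoint_map_C_of_comap_eq_bot :
    Disjoint ((nonZeroDivisors S).map (MvPolynomial.C (σ := τ)) : Set (MvPolynomial τ S)) P := by
  refine Set.disjoint_left.mpr ?_
  rintro _ ⟨b, hb, rfl⟩ h
  have : b ∈ P.comap MvPolynomial.C := h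
  rw [hP] at this
  exact nonZeroDivisors.ne_zero hb this

attribute [local instance] MvPolynomial.algebraMvPolynomial MvPolynomial.isLocalization

/-- Inverting the nonzero elements of `S`, which avoid `P`, does not change the height, and the
localization is a polynomial ring over a field, whose dimension is the number of variables. -/
lemma MvPolynomial.height_le_of_comap_C_eq_bot (F : Type*) [Field F] [Algebra S F]
    [IsFractionRing S F] : P.height ≤ Nat.card τ := by
  have hd := disjoint_map_C_of_comap_eq_bot P hP
  rw [← IsLocalization.height_map_of_disjoint (S := MvPolynomial τ F) _ P hd]
  have := IsLocalization.isPrime_of_isPrime_disjoint _ (MvPolynomial τ F) P ‹_› hd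
  have h := Ideal.height_le_ringKrullDim_of_ne_top this.ne_top
  rw [MvPolynomial.ringKrullDim_of_isNoetherianRing, ringKrullDim_eq_zero_of_field, zero_add] at h
  exact_mod_cast h

omit [Finite τ] in
-- The quotient is a domain generated over `F` by the classes of the variables, which `halg` makes
-- algebraic; a domain integral over a field is a field.
lemma MvPolynomial.isMaximal_map_of_comap_C_eq_bot (F : Type*) [Field F] [Algebra S F]
    [IsFractionRing S F]
    (halg : ∀ i : τ, ∃ q : Polynomial S, q ≠ 0 ∧ Polynomial.aeval (X i : MvPolynomial τ S) q ∈ P) :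
    (P.map (algebraMap (MvPolynomial τ S) (MvPolynomial τ F))).IsMaximal := by
  have hd := disjoint_map_C_of_comap_eq_bot P hP
  set P' := P.map (algebraMap (MvPolynomial τ S) (MvPolynomial τ F))
  have hP' : P'.IsPrime :=
    IsLocalization.isPrime_of_isPrime_disjoint _ (MvPolynomial τ F) P ‹_› hd
  have : Algebra.IsIntegral F (MvPolynomial τ F ⧸ P') := by
    constructor
    intro x
    obtain ⟨x, rfl⟩ := Ideal.Quotient.mk_surjective x
    induction x using MvPolynomial.induction_on with
    | C a => exact isIntegral_algebraMap (R := F) (x := a)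
    | add p q hp hq => rw [map_add]; exact hp.add hq
    | mul_X p i hp =>
      rw [map_mul]
      refine hp.mul ?_
      obtain ⟨q, hq, hqP⟩ := halg i
      rw [← isAlgebraic_iff_isIntegral]
      refine ⟨q.map (algebraMap S F), ?_, ?_⟩
      · rwa [Polynomial.map_ne_zero_iff (IsFractionRing.injective S F)]
      · have h1 := Ideal.mem_map_of_mem
          (algebraMap (MvPolynomial τ S) (MvPolynomial τ F)) hqP
        have h2 : algebraMap (MvPolynomial τ S) (MvPolynomial τ F)
            (Polynomial.aeval (X i : MvPolynomial τ S) q) =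
            Polynomial.aeval (X i : MvPolynomial τ F)
              (q.map (algebraMap S F)) := by
          rw [Polynomial.aeval_map_algebraMap, ← Polynomial.aeval_algebraMap_apply]
          simp
        rw [h2] at h1
        have h3 := Ideal.Quotient.eq_zero_iff_mem.mpr h1
        rw [← Ideal.Quotient.mkₐ_eq_mk F, ← Polynomial.aeval_algHom_apply] at h3
        exact h3
  exact (Ideal.Quotient.maximal_ideal_iff_isField_quotient _).mpr
    (isField_of_isIntegral_of_isField' (Field.toIsField F))

lemma MvPolynomial.height_eq_of_comap_C_eq_bot (F : Type*) [Field F] [Algebra S F]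
    [IsFractionRing S F]
    (halg : ∀ i : τ, ∃ q : Polynomial S, q ≠ 0 ∧ Polynomial.aeval (X i : MvPolynomial τ S) q ∈ P) :
    P.height = Nat.card τ := by
  have hd := disjoint_map_C_of_comap_eq_bot P hP
  rw [← IsLocalization.height_map_of_disjoint (S := MvPolynomial τ F) _ P hd]
  have := MvPolynomial.isMaximal_map_of_comap_C_eq_bot P hP F halg
  exact MvPolynomial.height_eq_natCard_of_isMaximal _
end

/-- The elements `y i` for `i ∈ s` are algebraically independent over the base modulo `P`: each
polynomial relation among them modulo `P` has all its coefficients in `P`. -/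
def IsIndepMod (R : Type*) {B σ : Type*} [CommRing R] [CommRing B] [Algebra R B] (y : σ → B)
    (s : Set σ) (P : Ideal B) : Prop :=
  ∀ f : MvPolynomial s R, MvPolynomial.aeval (fun i : s => y i) f ∈ P →
    ∀ m, algebraMap R B (f.coeff m) ∈ P

section
variable {L B σ : Type*} [Field L] [CommRing B] [Algebra L B]

/-- Over a field, a coefficient in a proper ideal is zero, so `IsIndepMod` is ordinary algebraic
independence. The formulation with coefficients in `P` also makes sense over a base ring, where the
prime of the base below `P` need not be zero. -/
lemma isIndepMod_iff_of_field {y : σ → B} {s : Set σ} {P : Ideal B} (hP : P ≠ ⊤) :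
    IsIndepMod L y s P ↔
      ∀ f : MvPolynomial s L, MvPolynomial.aeval (fun i : s => y i) f ∈ P → f = 0 := by
  refine forall₂_congr fun f hf => ⟨fun h => ?_, fun h => by simp [h]⟩
  ext m
  by_contra hm
  exact hP (Ideal.eq_top_of_isUnit_mem _ (h m) ((IsUnit.mk0 _ hm).map _))

lemma IsIndepMod.mono {R : Type*} [CommRing R] [Algebra R B] {y : σ → B} {s t : Set σ}
    {P : Ideal B} (h : IsIndepMod R y t P) (hst : s ⊆ t) : IsIndepMod R y s P := by
  intro f hf m
  have h1 := h (MvPolynomial.rename (Set.inclusion hst) f)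
    (by rw [MvPolynomial.aeval_rename]; exact hf) (m.mapDomain (Set.inclusion hst))
  rwa [MvPolynomial.coeff_rename_mapDomain _ (Set.inclusion_injective hst)] at h1

open Classical in
/-- Polynomials in the variables `σ` are polynomials in the variables outside `s` with coefficients
polynomials in the variables in `s`. -/
noncomputable def mvPolynomialSplit (L : Type*) [Field L] {σ : Type*} (s : Set σ) :
    MvPolynomial σ L ≃ₐ[L] MvPolynomial (sᶜ : Set σ) (MvPolynomial s L) :=
  (MvPolynomial.renameEquiv L ((Equiv.Set.sumCompl s).symm.trans (Equiv.sumComm _ _))).trans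
    (MvPolynomial.sumAlgEquiv L _ _)

lemma mvPolynomialSplit_symm_C (s : Set σ) (f : MvPolynomial s L) :
    (mvPolynomialSplit L s).symm (MvPolynomial.C f) = MvPolynomial.rename (↑) f := by
  rw [AlgEquiv.symm_apply_eq]
  induction f using MvPolynomial.induction_on with
  | C a =>
    rw [MvPolynomial.rename_C]
    exact ((mvPolynomialSplit L s).commutes a).symm
  | add p q hp hq => rw [map_add, map_add, map_add, hp, hq]
  | mul_X p i hp =>
    rw [map_mul, map_mul, map_mul, hp]
    simp [mvPolynomialSplit, Equiv.Set.sumCompl_symm_apply]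

lemma mvPolynomialSplit_symm_X (s : Set σ) (i : (sᶜ : Set σ)) :
    (mvPolynomialSplit L s).symm (MvPolynomial.X i) = MvPolynomial.X (i : σ) := by
  rw [AlgEquiv.symm_apply_eq]
  simp [mvPolynomialSplit, Equiv.Set.sumCompl_symm_apply_compl]

variable [Finite σ] (P : Ideal (MvPolynomial σ L)) [hP : P.IsPrime] {s : Set σ}

omit [Finite σ] in
lemma comap_split_comap_C (hs : IsIndepMod L MvPolynomial.X s P) :
    (P.comap (mvPolynomialSplit L s).symm.toRingEquiv).comap MvPolynomial.C = ⊥ := by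
  rw [eq_bot_iff]
  intro f hf
  have h1 : (mvPolynomialSplit L s).symm (MvPolynomial.C f) ∈ P := hf
  rw [mvPolynomialSplit_symm_C, MvPolynomial.rename_eq_aeval] at h1
  exact (isIndepMod_iff_of_field hP.ne_top).mp hs f h1

/-- Independence says that `P` meets `L[s]` in zero, so `P` can be measured in the polynomial ring
over the fraction field of `L[s]` in the variables outside `s`. -/
lemma IsIndepMod.height_le (hs : IsIndepMod L MvPolynomial.X s P) :
    P.height ≤ Nat.card (sᶜ : Set σ) := by
  have h := MvPolynomial.height_le_of_comap_C_eq_bot _ (comap_split_comap_C P hs)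
    (FractionRing (MvPolynomial s L))
  rwa [RingEquiv.height_comap] at h

/-- For a maximal independent set, every other variable is algebraic over `L[s]` modulo `P`; hence
`P` becomes maximal over the fraction field of `L[s]`. -/
lemma IsIndepMod.height_eq (hs : IsIndepMod L MvPolynomial.X s P)
    (hmax : ∀ i, i ∉ s → ¬ IsIndepMod L MvPolynomial.X (insert i s) P) :
    P.height = Nat.card (sᶜ : Set σ) := by
  have h := MvPolynomial.height_eq_of_comap_C_eq_bot _ (comap_split_comap_C P hs)
    (FractionRing (MvPolynomial s L)) ?_
  · rwa [RingEquiv.height_comap] at h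
  · rintro ⟨i, hi⟩
    have h1 := hmax i hi
    rw [isIndepMod_iff_of_field hP.ne_top] at h1
    push Not at h1
    obtain ⟨f, hf, hf0⟩ := h1
    classical
    -- The relation among the variables in `insert i s` is read as a one-variable polynomial in `X
    -- i` with coefficients in `L[s]`.
    let e : (insert i s : Set σ) ≃ Option s := Equiv.Set.insert hi |>.trans
      (Equiv.optionEquivSumPUnit _).symm
    refine ⟨MvPolynomial.optionEquivLeft L s (MvPolynomial.rename e f), ?_, ?_⟩
    · rw [Ne, EmbeddingLike.map_eq_zero_iff]
      rwa [map_eq_zero_iff _ (MvPolynomial.rename_injective _ e.injective)]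
    · have : ∀ g : MvPolynomial (insert i s : Set σ) L, (mvPolynomialSplit L s).symm
          (Polynomial.aeval (MvPolynomial.X ⟨i, hi⟩)
            (MvPolynomial.optionEquivLeft L s (MvPolynomial.rename e g))) =
          MvPolynomial.aeval (fun i : (insert i s : Set σ) => MvPolynomial.X (i : σ)) g := by
        intro g
        induction g using MvPolynomial.induction_on with
        | C a =>
          simp only [MvPolynomial.rename_C, MvPolynomial.optionEquivLeft_C, Polynomial.aeval_C,
            MvPolynomial.algebraMap_eq, MvPolynomial.aeval_C]
          rw [mvPolynomialSplit_symm_C, MvPolynomial.rename_C]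
        | add p q hp hq => simp only [map_add, hp, hq]
        | mul_X p j hp =>
          simp only [map_mul, hp]
          congr 1
          rcases j with ⟨j, rfl | hj⟩
          · have : e ⟨j, .inl rfl⟩ = none := by
              simp [e]
            simp [this, mvPolynomialSplit_symm_X]
          · have : e ⟨j, .inr hj⟩ = some ⟨j, hj⟩ := by
              rw [Equiv.trans_apply, Equiv.Set.insert_apply_right hi ⟨j, hj⟩]
              rfl
            simp [this, mvPolynomialSplit_symm_C]
      show (mvPolynomialSplit L s).symm _ ∈ P
      rw [this]
      exact hf

/-- A prime ideal of a polynomial ring over a field has height at most two if and only if some set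
of all but two of the variables is algebraically independent modulo it. -/
lemma MvPolynomial.height_le_two_iff : P.height ≤ 2 ↔
    ∃ s : Set σ, Nat.card s = Nat.card σ - 2 ∧ IsIndepMod L MvPolynomial.X s P := by
  classical
  have := Fintype.ofFinite σ
  have hcard (s : Set σ) : Nat.card s + Nat.card (sᶜ : Set σ) = Nat.card σ := by
    rw [← Nat.card_sum]
    exact Nat.card_congr (Equiv.Set.sumCompl s)
  refine ⟨fun h => ?_, fun ⟨s, hs, hs'⟩ => (hs'.height_le).trans ?_⟩
  · have hempty : IsIndepMod L MvPolynomial.X (∅ : Set σ) P := by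
      intro f hf m
      rw [MvPolynomial.eq_C_of_isEmpty f, MvPolynomial.aeval_C] at hf
      rwa [Subsingleton.elim m 0]
    obtain ⟨s, hs, hmax⟩ := (Set.toFinite {s : Set σ | IsIndepMod L MvPolynomial.X s P}).exists_maximal
      ⟨∅, hempty⟩
    have h1 := IsIndepMod.height_eq P hs fun i hi h' => hi (hmax h' (Set.subset_insert i s) (.inl rfl))
    rw [h1] at h
    have h2 : Nat.card (sᶜ : Set σ) ≤ 2 := by exact_mod_cast h
    -- A maximal independent set may be larger than needed, and subsets of it stay independent. The
    -- subtraction is truncated: with at most two variables the empty set is taken, consistently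
    -- with all heights being at most two.
    obtain ⟨t, hts, ht⟩ := Set.exists_subset_card_eq (s := s) (n := Nat.card σ - 2) (by
      have := hcard s
      rw [Nat.card_coe_set_eq] at this
      omega)
    exact ⟨t, by rw [Nat.card_coe_set_eq, ht], IsIndepMod.mono hs hts⟩
  · have := hcard s
    have h3 : Nat.card (sᶜ : Set σ) ≤ 2 := by omega
    exact_mod_cast h3
end

end

/-! ### Heights under base change of a Noether normalization. -/

section

open scoped TensorProduct

/-- `T ⊗ A` embeds in `T ⊗ Frac A` because `T` is flat. The field `Frac A` is flat over `S`, being a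
vector space over `Frac S`, so `f` stays regular on `T ⊗ Frac A`. -/
lemma isSMulRegular_tensorProduct {S T A : Type*} [CommRing S] [IsDomain S] [CommRing T]
    [Algebra S T] [Module.Flat S T] [CommRing A] [IsDomain A] [Algebra S A] [FaithfulSMul S A]
    {f : T} (hf : IsRegular f) : IsSMulRegular (T ⊗[S] A) f := by
  let K := FractionRing A
  let F := FractionRing S
  have hK : Function.Injective (algebraMap S K) := by
    rw [IsScalarTower.algebraMap_eq S A K]
    exact (IsFractionRing.injective A K).comp (FaithfulSMul.algebraMap_injective S A)
  let _ : Algebra F K := (IsFractionRing.lift hK).toAlgebra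
  have : IsScalarTower S F K := .of_algebraMap_eq fun x =>
    (IsFractionRing.lift_algebraMap hK x).symm
  have : Module.Flat S F := IsLocalization.flat F (nonZeroDivisors S)
  have : Module.Flat S K := Module.Flat.trans S F K
  have h1 : IsSMulRegular (T ⊗[S] K) f := Module.Flat.isSMulRegular_of_isRegular hf
  have h2 := Module.Flat.lTensor_preserves_injective_linearMap (M := T)
    (IsScalarTower.toAlgHom S A K).toLinearMap (IsFractionRing.injective A K)
  intro a b hab
  refine h2 (h1 ?_)
  have h3 : ∀ c : T ⊗[S] A, (IsScalarTower.toAlgHom S A K).toLinearMap.lTensor T (f • c) =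
      f • (IsScalarTower.toAlgHom S A K).toLinearMap.lTensor T c := fun c =>
    (TensorProduct.AlgebraTensorModule.lTensor T T
      (IsScalarTower.toAlgHom S A K).toLinearMap).map_smul f c
  exact (h3 a).symm.trans ((congrArg _ hab).trans (h3 b))

section
variable (S T A B : Type*) [CommRing S] [IsDomain S] [CommRing T] [IsDomain T] [CommRing A]
  [CommRing B] [Algebra S T] [Module.Flat S T] [Algebra S A] [Algebra S B] [Algebra T B]
  [Algebra A B] [IsScalarTower S T B] [IsScalarTower S A B] [Algebra.IsPushout S T A B]
  [FaithfulSMul S A]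

include S in
-- An element of a minimal prime over an ideal is a zero divisor modulo that ideal. Modulo the
-- extended nilradical, `B` is `T ⊗ (A ⧸ nilradical A)`, on which the nonzero elements of `T` are
-- regular.
lemma under_eq_bot_of_mem_minimalPrimes (hA : (nilradical A).IsPrime) (Q₀ : Ideal B)
    (hQ₀ : Q₀ ∈ ((nilradical A).map (algebraMap A B)).minimalPrimes) : Q₀.under T = ⊥ := by
  rw [eq_bot_iff]
  intro f hf
  by_contra hf0
  obtain ⟨b, hb, hfb⟩ := Ideal.exists_mul_mem_of_mem_minimalPrimes hQ₀ (show algebraMap T B f ∈ Q₀ from hf)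
  let e := Algebra.IsPushout.equiv S T A B
  -- The map to the reduction stays injective because the domain `S` has no nilpotents.
  have hfaith : FaithfulSMul S (A ⧸ nilradical A) := by
    rw [faithfulSMul_iff_algebraMap_injective, injective_iff_map_eq_zero]
    intro s hs
    rw [IsScalarTower.algebraMap_apply S A (A ⧸ nilradical A)] at hs
    have h1 : IsNilpotent (algebraMap S A s) := Ideal.Quotient.eq_zero_iff_mem.mp hs
    rw [IsNilpotent.map_iff (FaithfulSMul.algebraMap_injective S A)] at h1
    exact h1.eq_zero
  let g : A →ₐ[S] (A ⧸ nilradical A) := Ideal.Quotient.mkₐ S (nilradical A)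
  have hg : Function.Surjective g := Ideal.Quotient.mkₐ_surjective S _
  have hker := Algebra.TensorProduct.lTensor_ker (A := T) g hg
  have hkerg : RingHom.ker g = nilradical A := Ideal.Quotient.mkₐ_ker S _
  -- The extended nilradical is the kernel of `T ⊗ A → T ⊗ (A ⧸ nilradical A)`, transported along `B
  -- ≃ T ⊗ A`.
  have key : ∀ c : B, c ∈ (nilradical A).map (algebraMap A B) ↔
      Algebra.TensorProduct.map (AlgHom.id T T) g (e.symm c) = 0 := by
    intro c
    have : Algebra.TensorProduct.map (AlgHom.id T T) g (e.symm c) = 0 ↔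
      e.symm c ∈ RingHom.ker (Algebra.TensorProduct.map (AlgHom.id S T) g) := Iff.rfl
    rw [this, hker, hkerg]
    have h2 : (nilradical A).map (algebraMap A B) = ((nilradical A).map
        (Algebra.TensorProduct.includeRight : A →ₐ[S] T ⊗[S] A)).map e.toRingEquiv := by
      change _ = ((nilradical A).map
        (Algebra.TensorProduct.includeRight : A →ₐ[S] T ⊗[S] A).toRingHom).map
          e.toRingEquiv.toRingHom
      rw [Ideal.map_map]
      congr 1
      ext a
      exact ((Algebra.IsPushout.equiv_tmul S T A B 1 a).trans (by simp)).symm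
    rw [h2, ← Ideal.comap_symm]
    rfl
  refine hb ((key b).mpr (isSMulRegular_tensorProduct (IsRegular.of_ne_zero hf0) ?_))
  have h3 := (key _).mp hfb
  rw [← Algebra.smul_def, map_smul, map_smul] at h3
  exact h3.trans (smul_zero f).symm

include S in
/-- In the base change of a finite injective extension of domains (up to nilpotents), along a flat
morphism to a normal domain, prime ideals have the same height as their contractions. -/
lemma height_under_eq_of_isPushout [IsIntegrallyClosed T] [IsNoetherianRing T]
    [IsNoetherianRing B] [Algebra.IsIntegral S A]
    (hA : (nilradical A).IsPrime) (Q : Ideal B) [hQ : Q.IsPrime] :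
    (Q.under T).height = Q.height := by
  have hint : Algebra.IsIntegral T B := (Algebra.IsPushout.equiv S T A B).isIntegral_iff.mp inferInstance
  apply le_antisymm
  · have hle : (nilradical A).map (algebraMap A B) ≤ Q := by
      rw [Ideal.map_le_iff_le_comap]
      exact nilradical_le_prime _
    obtain ⟨Q₀, hQ₀, hle'⟩ := Ideal.exists_minimalPrimes_le hle
    have := hQ₀.1.1
    have hbot := under_eq_bot_of_mem_minimalPrimes S T A B hA Q₀ hQ₀
    have hfaith : FaithfulSMul T (B ⧸ Q₀) := by
      rw [faithfulSMul_iff_algebraMap_injective, injective_iff_map_eq_zero]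
      intro s hs
      rw [IsScalarTower.algebraMap_apply T B (B ⧸ Q₀)] at hs
      have h1 : s ∈ Q₀.under T := (Ideal.Quotient.eq_zero_iff_mem (I := Q₀)).mp hs
      rwa [hbot] at h1
    have : Algebra.IsIntegral T (B ⧸ Q₀) := inferInstance
    have : (Q.map (Ideal.Quotient.mk Q₀)).IsPrime :=
      Ideal.map_isPrime_of_surjective Ideal.Quotient.mk_surjective (by rwa [Ideal.mk_ker])
    have hcomap : (Q.map (Ideal.Quotient.mk Q₀)).comap (Ideal.Quotient.mk Q₀) = Q := by
      rw [Ideal.comap_map_of_surjective _ Ideal.Quotient.mk_surjective, ← RingHom.ker_eq_comap_bot,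
        Ideal.mk_ker, sup_eq_left.mpr hle']
    -- Going down for the integral extension of domains `T ⊆ B ⧸ Q₀`, available because `T` is
    -- integrally closed and `Q₀` lies over zero.
    have h1 : (Q.under T).height ≤ (Q.map (Ideal.Quotient.mk Q₀)).height := by
      have : (Q.map (Ideal.Quotient.mk Q₀)).LiesOver (Q.under T) := by
        constructor
        conv_lhs => rw [← hcomap]
        rfl
      rw [Ideal.height_eq_height_add_of_liesOver_of_hasGoingDown (Q.under T)
        (Q.map (Ideal.Quotient.mk Q₀))]
      exact le_self_add
    refine h1.trans ?_
    let f : PrimeSpectrum (B ⧸ Q₀) → PrimeSpectrum B := PrimeSpectrum.comap (Ideal.Quotient.mk Q₀)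
    have hf : StrictMono f := fun p q hpq => by
      refine lt_of_le_of_ne (Ideal.comap_mono hpq.le) fun h => hpq.ne ?_
      exact PrimeSpectrum.comap_injective_of_surjective _ Ideal.Quotient.mk_surjective h
    have h2 := Order.height_le_height_apply_of_strictMono f hf ⟨Q.map (Ideal.Quotient.mk Q₀), this⟩
    rw [← PrimeSpectrum.height_eq_orderHeight, ← PrimeSpectrum.height_eq_orderHeight] at h2
    change _ ≤ ((Q.map (Ideal.Quotient.mk Q₀)).comap (Ideal.Quotient.mk Q₀)).height at h2
    rwa [hcomap] at h2
  -- Incomparability: contraction along an integral map sends strict chains of primes to strict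
  -- chains.
  · let f : PrimeSpectrum B → PrimeSpectrum T := PrimeSpectrum.comap (algebraMap T B)
    have hf : StrictMono f := fun p q hpq =>
      Ideal.IsIntegral.comap_lt_comap (R := T) (I := p.asIdeal) (J := q.asIdeal) hpq
    have h2 := Order.height_le_height_apply_of_strictMono f hf ⟨Q, hQ⟩
    rwa [← PrimeSpectrum.height_eq_orderHeight, ← PrimeSpectrum.height_eq_orderHeight] at h2
end

section
variable {k L A B σ : Type*} [Field k] [Field L] [CommRing A] [CommRing B] [Algebra k L]
  [Algebra k A] [Algebra k B] [Algebra L B] [Algebra A B] [IsScalarTower k L B]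
  [IsScalarTower k A B] [Algebra.IsPushout k L A B] [Algebra.FiniteType k A] [Finite σ]
  (hA : (nilradical A).IsPrime) (g : MvPolynomial σ k →ₐ[k] A) (hg : Function.Injective g)
  (hg' : g.IsIntegral)

include hA hg hg'

attribute [local instance] MvPolynomial.algebraMvPolynomial in
/-- Let `A` be a finitely generated `k`-algebra with irreducible spectrum and let `y` be a Noether
normalization of `A`. A prime of the base change of `A` to a field extension has height at most two
if and only if some subfamily of all but two of the `y i` is algebraically independent modulo it. -/
lemma height_le_two_iff_exists_isIndepMod (Q : Ideal B) [hQ : Q.IsPrime] :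
    Q.height ≤ 2 ↔ ∃ s : Set σ, Nat.card s = Nat.card σ - 2 ∧
      IsIndepMod L (fun i => algebraMap A B (g (MvPolynomial.X i))) s Q := by
  let y : σ → B := fun i => algebraMap A B (g (MvPolynomial.X i))
  let _ : Algebra (MvPolynomial σ k) A := g.toRingHom.toAlgebra
  let _ : Algebra (MvPolynomial σ L) B := (MvPolynomial.aeval y).toRingHom.toAlgebra
  let _ : Algebra (MvPolynomial σ k) B := ((algebraMap A B).comp g.toRingHom).toAlgebra
  have t1 : IsScalarTower k (MvPolynomial σ k) A := .of_algebraMap_eq fun x => (g.commutes x).symm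
  have t2 : IsScalarTower L (MvPolynomial σ L) B :=
    .of_algebraMap_eq fun x => ((MvPolynomial.aeval y).commutes x).symm
  have t3 : IsScalarTower (MvPolynomial σ k) A B := .of_algebraMap_eq fun x => rfl
  have t4 : IsScalarTower (MvPolynomial σ k) (MvPolynomial σ L) B := by
    refine .of_algebraMap_eq fun x => ?_
    change algebraMap A B (g x) = MvPolynomial.aeval y (MvPolynomial.map (algebraMap k L) x)
    induction x using MvPolynomial.induction_on with
    | C a =>
      rw [MvPolynomial.map_C, MvPolynomial.aeval_C, ← MvPolynomial.algebraMap_eq, g.commutes,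
        ← IsScalarTower.algebraMap_apply, ← IsScalarTower.algebraMap_apply]
    | add p q hp hq => simp only [map_add, hp, hq]
    | mul_X p i hp => simp only [map_mul, hp, MvPolynomial.map_X, MvPolynomial.aeval_X, y]
  have t5 : IsScalarTower k (MvPolynomial σ L) B := .of_algebraMap_eq fun x => by
    rw [IsScalarTower.algebraMap_apply k L B, IsScalarTower.algebraMap_apply k L (MvPolynomial σ L),
      ← IsScalarTower.algebraMap_apply L (MvPolynomial σ L) B]
  -- Cancelling pushout squares: since `L[σ]` is the base change of `k[σ]` and `B` that of `A`, also
  -- `B` is `L[σ] ⊗ A` over `k[σ]`. This places the height comparison over `k[σ] → L[σ]`.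
  have hpush : Algebra.IsPushout (MvPolynomial σ k) A (MvPolynomial σ L) B :=
    (Algebra.IsPushout.comp_iff k (MvPolynomial σ k) L (MvPolynomial σ L)).mp
      (Algebra.IsPushout.symm inferInstance)
  have := hpush.symm
  have : FaithfulSMul (MvPolynomial σ k) A := (faithfulSMul_iff_algebraMap_injective _ _).mpr hg
  have : Algebra.IsIntegral (MvPolynomial σ k) A := ⟨hg'⟩
  have : Module.Flat (MvPolynomial σ k) (MvPolynomial σ L) :=
    Module.Flat.isBaseChange k (MvPolynomial σ k) L (MvPolynomial σ L)
      (Algebra.IsPushout.out (R := k) (S := MvPolynomial σ k) (R' := L) (S' := MvPolynomial σ L))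
  have : Algebra.FiniteType L B :=
    Algebra.FiniteType.equiv inferInstance (Algebra.IsPushout.equiv k L A B)
  have : IsNoetherianRing B := Algebra.FiniteType.isNoetherianRing L B
  have h := height_under_eq_of_isPushout (MvPolynomial σ k) (MvPolynomial σ L) A B hA Q
  rw [← h, MvPolynomial.height_le_two_iff]
  refine exists_congr fun s => and_congr_right fun _ => ?_
  refine forall_congr' fun f => imp_congr ?_ (forall_congr' fun m => ?_)
  · change MvPolynomial.aeval y _ ∈ Q ↔ _
    rw [← AlgHom.comp_apply, MvPolynomial.comp_aeval]
    simp [y]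
  · change algebraMap (MvPolynomial σ L) B (algebraMap L (MvPolynomial σ L) _) ∈ Q ↔ _
    rw [← IsScalarTower.algebraMap_apply]
end

end

/-! ### A compactness principle for primes, and independence in fibres. -/

section

open scoped TensorProduct

/-- In a filtered colimit of rings, primes satisfying compatible families of conditions of the form
`a ∈ P → b ∈ P` exist as soon as they exist at all stages. -/
lemma exists_prime_of_isColimit {J : Type u} [SmallCategory J] [IsFiltered J]
    (C : J ⥤ CommRingCat.{u}) (c : Cocone C) (hc : IsColimit c) (E : ∀ j, Set (C.obj j × C.obj j))
    (hE : ∀ ⦃i j : J⦄ (h : i ⟶ j) (p : C.obj i × C.obj i), p ∈ E i →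
      ((C.map h).hom p.1, (C.map h).hom p.2) ∈ E j)
    (hne : ∀ j, ∃ P : Ideal (C.obj j), P.IsPrime ∧ ∀ p ∈ E j, p.1 ∈ P → p.2 ∈ P) :
    ∃ P : Ideal c.pt, P.IsPrime ∧ ∀ j, ∀ p ∈ E j,
      (c.ι.app j).hom p.1 ∈ P → (c.ι.app j).hom p.2 ∈ P := by
  classical
  -- A prime is encoded by its characteristic function. Each condition involves only finitely many
  -- values, so the admissible primes form a closed subset of a compact Hausdorff product of
  -- two-point spaces.
  let G : ∀ j, Set (C.obj j → Bool) := fun j =>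
    {χ | χ 0 = true ∧ χ 1 = false ∧ (∀ a b, χ a = true → χ b = true → χ (a + b) = true) ∧
      (∀ a b, χ (a * b) = true ↔ χ a = true ∨ χ b = true) ∧
      ∀ p ∈ E j, χ p.1 = true → χ p.2 = true}
  have hG : ∀ j, IsClosed (G j) := by
    intro j
    have hcl : ∀ (a : C.obj j) (v : Bool), IsClopen {χ : C.obj j → Bool | χ a = v} := fun a v =>
      (isClopen_discrete {v}).preimage (continuous_apply a)
    have himp : ∀ {S T : Set (C.obj j → Bool)}, IsClopen S → IsClopen T →
      IsClopen {χ | χ ∈ S → χ ∈ T} := fun {S T} hS hT => by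
        have : {χ | χ ∈ S → χ ∈ T} = Sᶜ ∪ T := by ext; simp [imp_iff_not_or]
        rw [this]; exact hS.compl.union hT
    have hiff : ∀ {S T : Set (C.obj j → Bool)}, IsClopen S → IsClopen T →
      IsClopen {χ | χ ∈ S ↔ χ ∈ T} := fun {S T} hS hT => by
        have : {χ | χ ∈ S ↔ χ ∈ T} = {χ | χ ∈ S → χ ∈ T} ∩ {χ | χ ∈ T → χ ∈ S} := by
          ext; simp [iff_def]
        rw [this]; exact (himp hS hT).inter (himp hT hS)
    have hall : ∀ {ι : Type u} {p : ι → (C.obj j → Bool) → Prop},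
        (∀ a, IsClosed {χ | p a χ}) → IsClosed {χ | ∀ a, p a χ} := fun {ι p} h => by
      have : {χ | ∀ a, p a χ} = ⋂ a, {χ | p a χ} := by ext; simp
      rw [this]
      exact isClosed_iInter h
    refine (hcl 0 true).isClosed.inter ((hcl 1 false).isClosed.inter (IsClosed.inter
      (hall (p := fun a χ => ∀ b, χ a = true → χ b = true → χ (a + b) = true) fun a =>
        hall fun b => ?_) (IsClosed.inter
      (hall (p := fun a χ => ∀ b, χ (a * b) = true ↔ χ a = true ∨ χ b = true) fun a =>
        hall fun b => ?_) ?_)))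
    · exact (himp (hcl a true) (himp (hcl b true) (hcl (a + b) true))).isClosed
    · exact (hiff (hcl (a * b) true) ((hcl a true).union (hcl b true))).isClosed
    · have := hall (p := fun (q : E j) χ => χ q.1.1 = true → χ q.1.2 = true) fun q =>
        (himp (hcl q.1.1 true) (hcl q.1.2 true)).isClosed
      simpa using! this
  -- Contraction of primes makes these spaces an inverse system; `hE` ensures that it preserves the
  -- conditions.
  let F : Jᵒᵖ ⥤ TopCat.{u} :=
    { obj j := TopCat.of (G j.unop)
      map {j i} h := TopCat.ofHom
        ⟨fun χ => ⟨fun a => χ.1 ((C.map h.unop).hom a), by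
            obtain ⟨χ, h0, h1, ha, hm, he⟩ := χ
            refine ⟨by simpa using h0, by simpa using h1, fun a b => ?_, fun a b => ?_,
              fun p hp => he _ (hE h.unop p hp)⟩
            · simpa using ha _ _
            · simpa using hm _ _⟩, by
          refine Continuous.subtype_mk (continuous_pi fun a => ?_) _
          exact (continuous_apply _).comp continuous_subtype_val⟩
      map_id j := by
        ext χ a; simp
      map_comp f g := by
        ext χ a; simp }
  have i1 : ∀ j, Nonempty (F.obj j) := by
    intro j
    obtain ⟨P, hP, h⟩ := hne j.unop
    refine ⟨⟨fun a => decide (a ∈ P), ?_⟩⟩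
    refine ⟨by simp, by simpa using (Ideal.ne_top_iff_one P).mp hP.ne_top, ?_, ?_, ?_⟩
    · intro a b; simpa using P.add_mem
    · intro a b; simpa using hP.mul_mem_iff_mem_or_mem
    · intro p hp; simpa using h p hp
  have i2 : ∀ j, CompactSpace (F.obj j) := fun j =>
    isCompact_iff_compactSpace.mp (hG j.unop).isCompact
  have i3 : ∀ j, T2Space (F.obj j) := fun j => inferInstanceAs (T2Space (G j.unop))
  obtain ⟨⟨χ, hχ⟩⟩ := TopCat.nonempty_limitCone_of_compact_t2_cofiltered_system.{u} F
  have hcomp : ∀ {i j : J} (h : i ⟶ j) (a : C.obj i),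
      (χ (.op j)).1 ((C.map h).hom a) = (χ (.op i)).1 a := by
    intro i j h a
    rw [← hχ h.op]; rfl
  -- The compatible family of characteristic functions descends to the colimit: elements with the
  -- same image there already agree at a later stage.
  have key : ∀ {i j : J} (a : C.obj i) (b : C.obj j), (c.ι.app i).hom a = (c.ι.app j).hom b →
      (χ (.op i)).1 a = (χ (.op j)).1 b := by
    intro i j a b hab
    obtain ⟨l, f, g, h⟩ := Concrete.isColimit_exists_of_rep_eq C hc a b hab
    have h' : (C.map f).hom a = (C.map g).hom b := h
    rw [← hcomp f, ← hcomp g, h']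
  have rep : ∀ x : c.pt, ∃ (i : J) (a : C.obj i), (c.ι.app i).hom a = x := fun x =>
    Concrete.isColimit_exists_rep C hc x
  have rep2 : ∀ x y : c.pt, ∃ (i : J) (a b : C.obj i), (c.ι.app i).hom a = x ∧
      (c.ι.app i).hom b = y := by
    intro x y
    obtain ⟨i, a, rfl⟩ := rep x
    obtain ⟨j, b, rfl⟩ := rep y
    have e : ∀ {p q : J} (f : p ⟶ q) (a : C.obj p), (c.ι.app q).hom ((C.map f).hom a) =
      (c.ι.app p).hom a := fun f a => by rw [← c.w f]; rfl
    exact ⟨_, _, _, e (IsFiltered.leftToMax i j) a, e (IsFiltered.rightToMax i j) b⟩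
  have j₀ : J := IsFiltered.nonempty.some
  have hspec : ∀ i, (χ (.op i)).1 ∈ G i := fun i => (χ (.op i)).2
  let S : Set c.pt := {x | ∃ (i : J) (a : C.obj i), (c.ι.app i).hom a = x ∧ (χ (.op i)).1 a = true}
  have hS : ∀ {i : J} (a : C.obj i), (c.ι.app i).hom a ∈ S ↔ (χ (.op i)).1 a = true := by
    intro i a
    constructor
    · rintro ⟨j, b, h, h'⟩
      exact (key b a h).symm.trans h'
    · exact fun h => ⟨i, a, rfl, h⟩
  let P : Ideal c.pt :=
    { carrier := S
      zero_mem' := by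
        have := (hS (i := j₀) 0).mpr (hspec j₀).1
        rwa [map_zero] at this
      add_mem' := by
        intro x y hx hy
        obtain ⟨i, a, b, rfl, rfl⟩ := rep2 x y
        rw [← map_add, hS]
        exact (hspec i).2.2.1 _ _ ((hS a).mp hx) ((hS b).mp hy)
      smul_mem' := by
        intro x y hy
        obtain ⟨i, a, b, rfl, rfl⟩ := rep2 x y
        rw [smul_eq_mul, ← map_mul, hS, (hspec i).2.2.2.1]
        exact Or.inr ((hS b).mp hy) }
  refine ⟨P, ⟨?_, ?_⟩, ?_⟩
  · rw [Ideal.ne_top_iff_one]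
    intro h
    have h' : (1 : c.pt) ∈ S := h
    rw [← map_one (c.ι.app j₀).hom, hS, (hspec j₀).2.1] at h'
    simp at h'
  · intro x y hxy
    obtain ⟨i, a, b, rfl, rfl⟩ := rep2 x y
    change _ ∈ S ∨ _ ∈ S
    rw [hS, hS, ← (hspec i).2.2.2.1, ← hS, map_mul]
    exact hxy
  · intro j p hp h
    exact (hS _).mpr ((hspec j).2.2.2.2 p hp ((hS _).mp h))

/-- Clearing denominators; `hφ` says that every element of `K` is a fraction of elements coming from
`R`. -/
lemma MvPolynomial.exists_map_eq_C_mul {R K s : Type*} [CommRing R] [Field K] (φ : R →+* K)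
    (hφ : ∀ x : K, ∃ a b, φ b ≠ 0 ∧ x * φ b = φ a) (f : MvPolynomial s K) :
    ∃ (r : R) (f₀ : MvPolynomial s R), φ r ≠ 0 ∧ MvPolynomial.map φ f₀ = C (φ r) * f := by
  induction f using MvPolynomial.induction_on with
  | C x =>
    obtain ⟨a, b, hb, h⟩ := hφ x
    exact ⟨b, C a, hb, by rw [map_C, ← h, mul_comm, C_mul]⟩
  | add p q hp hq =>
    obtain ⟨r, f, hr, hf⟩ := hp
    obtain ⟨r', f', hr', hf'⟩ := hq
    refine ⟨r * r', C r' * f + C r * f', by simp [hr, hr'], ?_⟩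
    simp only [map_add, map_mul, map_C, hf, hf']
    ring
  | mul_X p i hp =>
    obtain ⟨r, f, hr, hf⟩ := hp
    exact ⟨r, f * X i, hr, by rw [map_mul, map_X, hf, mul_assoc]⟩

/-- Passing to the fibre does not change independence. -/
lemma isIndepMod_comap_iff {R K C B σ : Type*} [CommRing R] [Field K] [CommRing C] [CommRing B]
    [Algebra R K] [Algebra R C] [Algebra R B] [Algebra K B] [Algebra C B] [IsScalarTower R K B]
    [IsScalarTower R C B] (hφ : ∀ x : K, ∃ a b : R, algebraMap R K b ≠ 0 ∧
      x * algebraMap R K b = algebraMap R K a) (y : σ → C) (s : Set σ) (Q : Ideal B)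
    [hQ : Q.IsPrime] :
    IsIndepMod K (fun i => algebraMap C B (y i)) s Q ↔
      IsIndepMod R y s (Q.comap (algebraMap C B)) := by
  have e : ∀ f : MvPolynomial s R, algebraMap C B (MvPolynomial.aeval (fun i : s => y i) f) =
      MvPolynomial.aeval (fun i : s => algebraMap C B (y i)) (f.map (algebraMap R K)) := by
    intro f
    rw [MvPolynomial.aeval_map_algebraMap]
    exact (MvPolynomial.comp_aeval_apply _ (IsScalarTower.toAlgHom R C B) f)
  have e2 : ∀ r : R, algebraMap C B (algebraMap R C r) = algebraMap K B (algebraMap R K r) := by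
    intro r
    rw [← IsScalarTower.algebraMap_apply, ← IsScalarTower.algebraMap_apply]
  have hunit : ∀ r : R, algebraMap R K r ≠ 0 → algebraMap K B (algebraMap R K r) ∉ Q := by
    intro r hr hr'
    exact hQ.ne_top (Ideal.eq_top_of_isUnit_mem _ hr' ((IsUnit.mk0 _ hr).map _))
  constructor
  · intro h f hf m
    have := h (f.map (algebraMap R K)) (by rw [← e]; exact hf) m
    rw [Ideal.mem_comap, e2]
    rwa [MvPolynomial.coeff_map] at this
  · intro h f hf m
    -- The common denominator `r` is a unit of `K`, hence not in `Q`, and can be cancelled from the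
    -- coefficients because `Q` is prime.
    obtain ⟨r, f₀, hr, h₀⟩ := MvPolynomial.exists_map_eq_C_mul (algebraMap R K) hφ f
    have h1 := h f₀ (by
      rw [Ideal.mem_comap, e, h₀, map_mul]
      exact Q.mul_mem_left _ hf) m
    rw [Ideal.mem_comap, e2, ← MvPolynomial.coeff_map, h₀, MvPolynomial.coeff_C_mul, map_mul] at h1
    exact (hQ.mem_or_mem h1).resolve_left (hunit r hr)

/-- Let `A` be a finitely generated `k`-algebra with irreducible spectrum and let `g` be a Noether
normalization of `A`. A prime `P` of `A ⊗ R` has height at most two in its fibre over `Spec R` if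
and only if some subfamily of all but two of the variables is independent modulo `P`. -/
lemma height_le_two_iff_exists_isIndepMod_comap {k R K A C B σ : Type*} [Field k] [CommRing R]
    [Field K] [CommRing A]
    [CommRing C] [CommRing B] [Algebra k R] [Algebra k K] [Algebra k A] [Algebra k C] [Algebra k B]
    [Algebra R K] [Algebra R C] [Algebra A C] [Algebra R B] [Algebra A B] [Algebra K B]
    [Algebra C B] [IsScalarTower k R K] [IsScalarTower k R C] [IsScalarTower k A C]
    [IsScalarTower R K B] [IsScalarTower R C B] [IsScalarTower A C B] [IsScalarTower k K B]
    [IsScalarTower k A B] [Algebra.IsPushout k R A C] [Algebra.IsPushout R K C B]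
    [Algebra.FiniteType k A] [Finite σ]
    (hA : (nilradical A).IsPrime) (g : MvPolynomial σ k →ₐ[k] A) (hg : Function.Injective g)
    (hg' : g.IsIntegral)
    (hφ : ∀ x : K, ∃ a b : R, algebraMap R K b ≠ 0 ∧ x * algebraMap R K b = algebraMap R K a)
    (Q : Ideal B) [hQ : Q.IsPrime] :
    Q.height ≤ 2 ↔ ∃ s : Set σ, Nat.card s = Nat.card σ - 2 ∧
      IsIndepMod R (fun i => algebraMap A C (g (MvPolynomial.X i))) s
        (Q.comap (algebraMap C B)) := by
  -- Pasting `C = A ⊗ R` with `B = K ⊗ C` exhibits `B` as `A ⊗ K`, to which the criterion over a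
  -- field applies.
  have : Algebra.IsPushout k K A B :=
    have : IsScalarTower k C B := .of_algebraMap_eq fun x => by
      rw [IsScalarTower.algebraMap_apply k A C, ← IsScalarTower.algebraMap_apply A C B,
        ← IsScalarTower.algebraMap_apply]
    (Algebra.IsPushout.comp_iff k R A C).mpr inferInstance
  rw [height_le_two_iff_exists_isIndepMod (L := K) hA g hg hg' Q]
  refine exists_congr fun s => and_congr_right fun _ => ?_
  rw [← isIndepMod_comap_iff hφ]
  simp only [← IsScalarTower.algebraMap_apply]

end

/-! ### Codimension in fibres, read on affine charts. -/

section

open scoped TensorProduct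
namespace GenericBundles

lemma ringKrullDim_stalk_Spec (R : Type u) [CommRing R] (x : PrimeSpectrum R) :
    ringKrullDim ((Spec (CommRingCat.of R)).presheaf.stalk x) = x.asIdeal.height :=
  letI : Algebra R ((Spec (CommRingCat.of R)).presheaf.stalk x) :=
    StructureSheaf.stalkAlgebra R x
  haveI : IsLocalization.AtPrime ((Spec (CommRingCat.of R)).presheaf.stalk x) x.asIdeal :=
    StructureSheaf.IsLocalization.to_stalk R x
  IsLocalization.AtPrime.ringKrullDim_eq_height x.asIdeal _

lemma ringKrullDim_stalk_of_isOpenImmersion {Y Z : Scheme.{u}} (f : Y ⟶ Z) [IsOpenImmersion f]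
    (y : Y) : ringKrullDim (Z.presheaf.stalk (f y)) = ringKrullDim (Y.presheaf.stalk y) :=
  ringKrullDim_eq_of_ringEquiv (asIso (f.stalkMap y)).commRingCatIsoToRingEquiv

section Chart
variable {k : Type u} [Field k] (X : Over (Spec (CommRingCat.of k)))
variable {A : Type u} [CommRing A] [Algebra k A] (a : Spec (CommRingCat.of A) ⟶ X.left)
  (ha : a ≫ X.hom = Spec.map (CommRingCat.ofHom (algebraMap k A)))

/-- The spectrum of a `k`-algebra as a `k`-scheme. -/
noncomputable abbrev specOver (k : Type u) [Field k] (R : Type u) [CommRing R] [Algebra k R] :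
    Over (Spec (CommRingCat.of k)) :=
  Over.mk (Spec.map (CommRingCat.ofHom (algebraMap k R)))

variable (R : Type u) [CommRing R] [Algebra k R]

lemma isPushout_tensorProduct : IsPushout (CommRingCat.ofHom (algebraMap k A))
    (CommRingCat.ofHom (algebraMap k R))
    (CommRingCat.ofHom (Algebra.TensorProduct.includeLeftRingHom : A →+* A ⊗[k] R))
    (CommRingCat.ofHom (Algebra.TensorProduct.includeRight : R →ₐ[k] A ⊗[k] R).toRingHom) :=
  CommRingCat.isPushout_tensorProduct k A R

/-- The base change to `R` of a chart `Spec A ⟶ X`. -/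
noncomputable def chart : Spec (CommRingCat.of (A ⊗[k] R)) ⟶ fam X (specOver k R) :=
  pullback.lift (Spec.map (CommRingCat.ofHom Algebra.TensorProduct.includeLeftRingHom) ≫ a)
    (Spec.map (CommRingCat.ofHom
      (Algebra.TensorProduct.includeRight : R →ₐ[k] A ⊗[k] R).toRingHom)) (by
    rw [Category.assoc, ha]
    exact (isPullback_SpecMap_of_isPushout _ _ _ _ (isPushout_tensorProduct R)).w)

@[simp]
lemma chart_fst : chart X a ha R ≫ pullback.fst _ _ =
    Spec.map (CommRingCat.ofHom Algebra.TensorProduct.includeLeftRingHom) ≫ a :=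
  pullback.lift_fst _ _ _

lemma chart_snd : chart X a ha R ≫ famProj X (specOver k R) =
    Spec.map (CommRingCat.ofHom
      (Algebra.TensorProduct.includeRight : R →ₐ[k] A ⊗[k] R).toRingHom) :=
  pullback.lift_snd _ _ _

lemma chart_isPullback : IsPullback
    (Spec.map (CommRingCat.ofHom (Algebra.TensorProduct.includeLeftRingHom : A →+* A ⊗[k] R)))
    (chart X a ha R) a (pullback.fst X.hom (specOver k R).hom) := by
  refine IsPullback.of_bot (h₃₁ := (specOver k R).hom) (v₂₁ := famProj X (specOver k R))
    (h₂₁ := pullback.fst _ _) (v₂₂ := X.hom) ?_ (chart_fst X a ha R).symm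
    (IsPullback.of_hasPullback _ _)
  rw [chart_snd, ha]
  exact isPullback_SpecMap_of_isPushout _ _ _ _ (isPushout_tensorProduct R)

instance [IsOpenImmersion a] : IsOpenImmersion (chart X a ha R) :=
  MorphismProperty.of_isPullback (chart_isPullback X a ha R) inferInstance

variable {R} in
lemma chart_map {R' : Type u} [CommRing R'] [Algebra k R'] (f : R →ₐ[k] R')
    (g : specOver k R' ⟶ specOver k R) (hg : g.left = Spec.map (CommRingCat.ofHom f.toRingHom)) :
    chart X a ha R' ≫ famMap X g =
      Spec.map (CommRingCat.ofHom (Algebra.TensorProduct.map (AlgHom.id k A) f).toRingHom) ≫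
        chart X a ha R := by
  apply pullback.hom_ext
  · rw [Category.assoc, famMap_fst, chart_fst, Category.assoc, chart_fst, ← Category.assoc,
      ← Spec.map_comp, ← CommRingCat.ofHom_comp]
    congr 3
    ext x
    simp
  · have h1 := chart_snd X a ha R
    have h2 := chart_snd X a ha R'
    rw [Category.assoc, famMap_snd, reassoc_of% h2, Category.assoc]
    refine Eq.trans ?_ (congrArg (_ ≫ ·) h1).symm
    rw [hg, ← Spec.map_comp, ← Spec.map_comp, ← CommRingCat.ofHom_comp, ← CommRingCat.ofHom_comp]
    congr 2

lemma exists_chart_eq (z : fam X (specOver k R)) (x : Spec (CommRingCat.of A))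
    (hx : a x = pullback.fst X.hom (specOver k R).hom z) :
    ∃ P, chart X a ha R P = z := by
  obtain ⟨P, -, hP⟩ := Scheme.Pullback.exists_preimage_pullback x z hx
  let e := (chart_isPullback X a ha R).isoPullback
  refine ⟨e.inv P, ?_⟩
  rw [← hP, ← Scheme.Hom.comp_apply]
  exact congrArg (fun f : _ ⟶ fam X (specOver k R) => f P)
    (chart_isPullback X a ha R).isoPullback_inv_snd

/-- The scheme-theoretic residue field is the fraction field of `R ⧸ t`. This provides the fractions
required by `height_le_two_iff_exists_isIndepMod_comap`. -/
lemma exists_mul_eq_residueField (t : PrimeSpectrum R)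
    (x : (Spec (CommRingCat.of R)).residueField t) :
    ∃ b c : R, (Spec.preimage ((Spec (CommRingCat.of R)).fromSpecResidueField t)).hom c ≠ 0 ∧
      x * (Spec.preimage ((Spec (CommRingCat.of R)).fromSpecResidueField t)).hom c =
        (Spec.preimage ((Spec (CommRingCat.of R)).fromSpecResidueField t)).hom b := by
  have h : Spec.preimage ((Spec (CommRingCat.of R)).fromSpecResidueField t) =
      CommRingCat.ofHom (algebraMap R t.asIdeal.ResidueField) ≫
        (Scheme.Spec.residueFieldIso (.of R) t).inv := by
    apply Spec.map_injective
    rw [Spec.map_preimage, Spec.map_comp]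
    exact (Scheme.Spec.map_residueFieldIso_inv_eq_fromSpecResidueField (.of R) t).symm
  let e : (Spec (CommRingCat.of R)).residueField t ≃+* t.asIdeal.ResidueField :=
    (Scheme.Spec.residueFieldIso (.of R) t).commRingCatIsoToRingEquiv
  obtain ⟨b, c, hc⟩ := IsFractionRing.div_surjective (A := R ⧸ t.asIdeal) (e x)
  obtain ⟨b, rfl⟩ := Ideal.Quotient.mk_surjective b
  obtain ⟨c, rfl⟩ := Ideal.Quotient.mk_surjective c
  have hq : ∀ y : R, (Spec.preimage ((Spec (CommRingCat.of R)).fromSpecResidueField t)).hom y =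
    e.symm (algebraMap (R ⧸ t.asIdeal) t.asIdeal.ResidueField (Ideal.Quotient.mk _ y)) := fun y => by
      rw [h]; rfl
  have h0 : algebraMap (R ⧸ t.asIdeal) t.asIdeal.ResidueField (Ideal.Quotient.mk _ c) ≠ 0 :=
    IsFractionRing.to_map_ne_zero_of_mem_nonZeroDivisors hc.1
  refine ⟨b, c, ?_, ?_⟩
  · rw [hq]
    exact fun h' => h0 ((map_eq_zero_iff e.symm e.symm.injective).mp h')
  · rw [hq, hq]
    refine e.injective ((map_mul e _ _).trans ?_)
    refine (congrArg (e x * ·) (e.apply_symm_apply _)).trans (Eq.trans ?_ (e.apply_symm_apply _).symm)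
    rw [← hc.2]
    exact div_mul_cancel₀ _ h0

attribute [local instance] Algebra.TensorProduct.rightAlgebra in
/-- A point of the fibre of `X_R` over `t` has codimension at least three if and only if no
subfamily of all but two of the variables of a Noether normalization is independent modulo it. -/
lemma three_le_ringKrullDim_iff [IsOpenImmersion a] [Algebra.FiniteType k A] {σ : Type*} [Finite σ]
    (hA : (nilradical A).IsPrime) (g : MvPolynomial σ k →ₐ[k] A) (hg : Function.Injective g)
    (hg' : g.IsIntegral) (t : (specOver k R).left) (z : (famProj X (specOver k R)).fiber t)
    (P : PrimeSpectrum (A ⊗[k] R))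
    (hP : (famProj X (specOver k R)).fiberι t z = chart X a ha R P) :
    3 ≤ ringKrullDim (((famProj X (specOver k R)).fiber t).presheaf.stalk z) ↔
      ∀ s : Set σ, Nat.card s = Nat.card σ - 2 →
        ¬ IsIndepMod R (fun i => g (MvPolynomial.X i) ⊗ₜ[k] (1 : R)) s P.asIdeal := by
  let K : Type u := (Spec (CommRingCat.of R)).residueField t
  -- The `R`-algebra structure on `K` is read off from the morphism that defines the fibre, so that
  -- `Spec` of the structure map is that morphism.
  let φ : CommRingCat.of R ⟶ CommRingCat.of K :=
    Spec.preimage ((Spec (CommRingCat.of R)).fromSpecResidueField t)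
  have hK := exists_mul_eq_residueField R t
  let _ : Field K := inferInstanceAs (Field ((Spec (CommRingCat.of R)).residueField t))
  let _ : Algebra R K := φ.hom.toAlgebra
  let _ : Algebra k K := ((algebraMap R K).comp (algebraMap k R)).toAlgebra
  have : IsScalarTower k R K := .of_algebraMap_eq fun _ => rfl
  let C := A ⊗[k] R
  let B := K ⊗[R] C
  let _ : Algebra A B := ((algebraMap C B).comp (algebraMap A C)).toAlgebra
  have : IsScalarTower A C B := .of_algebraMap_eq fun _ => rfl
  have : IsScalarTower k A B := .of_algebraMap_eq fun x => by
    rw [IsScalarTower.algebraMap_apply A C B, ← IsScalarTower.algebraMap_apply k A C,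
      IsScalarTower.algebraMap_apply k R C, ← IsScalarTower.algebraMap_apply R C B,
      IsScalarTower.algebraMap_apply R K B, ← IsScalarTower.algebraMap_apply k R K,
      ← IsScalarTower.algebraMap_apply k K B]
  have hBC : IsPullback (Spec.map (CommRingCat.ofHom (algebraMap K B)))
      (Spec.map (CommRingCat.ofHom (algebraMap C B)))
      ((Spec (CommRingCat.of R)).fromSpecResidueField t)
      (Spec.map (CommRingCat.ofHom (algebraMap R C))) := by
    have h := isPullback_SpecMap_of_isPushout _ _ _ _
      (CommRingCat.isPushout_of_isPushout R K C B)
    rwa [show Spec.map (CommRingCat.ofHom (algebraMap R K)) =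
      (Spec (CommRingCat.of R)).fromSpecResidueField t from Spec.map_preimage _] at h
  have hfib : IsPullback ((famProj X (specOver k R)).fiberToSpecResidueField t)
      ((famProj X (specOver k R)).fiberι t) ((Spec (CommRingCat.of R)).fromSpecResidueField t)
      (famProj X (specOver k R)) := (IsPullback.of_hasPullback _ _).flip
  have hc : chart X a ha R ≫ famProj X (specOver k R) =
    Spec.map (CommRingCat.ofHom (algebraMap R C)) := chart_snd X a ha R
  -- Spec of `B = K ⊗ C` is the part of the fibre lying in the chart, by cancellation of pullback
  -- squares; hence `j` is an open immersion, and the local ring at `z` can be computed in `B`.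
  have hsq := IsPullback.of_right' (hc ▸ hBC) hfib
  set j := hfib.lift (Spec.map (CommRingCat.ofHom (algebraMap K B)))
    (Spec.map (CommRingCat.ofHom (algebraMap C B)) ≫ chart X a ha R)
    (by rw [Category.assoc, hc]; exact hBC.w)
  have : IsOpenImmersion j := MorphismProperty.of_isPullback hsq.flip inferInstance
  -- A point of `Spec B` over both `z` and `P` exists because these have the same image in `X_R`.
  obtain ⟨Q₀, hQ₁, hQ₂⟩ := Scheme.Pullback.exists_preimage_pullback
    (f := (famProj X (specOver k R)).fiberι t) (g := chart X a ha R) z P hP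
  let Q : PrimeSpectrum B := hsq.isoPullback.inv Q₀
  have hjQ : j Q = z := by
    rw [← hQ₁]
    exact congrArg (fun f : _ ⟶ (famProj X (specOver k R)).fiber t => f Q₀)
      hsq.isoPullback_inv_fst
  have hCQ : Q.asIdeal.comap (algebraMap C B) = P.asIdeal := by
    rw [← hQ₂]
    exact congrArg (fun f : _ ⟶ Spec (CommRingCat.of C) => (f Q₀).asIdeal)
      hsq.isoPullback_inv_snd
  have h1 := height_le_two_iff_exists_isIndepMod_comap (R := R) (C := C) hA g hg hg' hK Q.asIdeal
  have hd : ringKrullDim (((famProj X (specOver k R)).fiber t).presheaf.stalk z) =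
      Q.asIdeal.height := by
    rw [← hjQ]
    exact (ringKrullDim_stalk_of_isOpenImmersion j Q).trans (ringKrullDim_stalk_Spec B Q)
  rw [hd, ← hCQ]
  have h2 : (3 : WithBot ℕ∞) ≤ Q.asIdeal.height ↔ ¬ Q.asIdeal.height ≤ 2 := by
    rw [not_le, show (3 : WithBot ℕ∞) = ((3 : ℕ∞) : WithBot ℕ∞) from rfl, WithBot.coe_le_coe,
      show (3 : ℕ∞) = 2 + 1 from rfl, ENat.add_one_le_iff (by simp)]
  rw [h2, h1]
  push Not
  rfl

end Chart
end GenericBundles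

end

/-! ### Bigness descends to a finite stage. -/

section

open scoped TensorProduct
namespace GenericBundles

section Chart
variable {k : Type u} [Field k] (X : Over (Spec (CommRingCat.of k)))

/-- An affine open subscheme with irreducible underlying space and a Noether normalization. -/
structure NormalizedChart where
  /-- The coordinate ring. -/
  A : Type u
  [commRing : CommRing A]
  [algebra : Algebra k A]
  [finiteType : Algebra.FiniteType k A]
  /-- The chart. -/
  a : Spec (CommRingCat.of A) ⟶ X.left
  [isOpenImmersion : IsOpenImmersion a]
  ha : a ≫ X.hom = Spec.map (CommRingCat.ofHom (algebraMap k A))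
  isPrime : (nilradical A).IsPrime
  /-- The dimension. -/
  d : ℕ
  /-- The Noether normalization. -/
  g : MvPolynomial (Fin d) k →ₐ[k] A
  injective : Function.Injective g
  isIntegral : g.IsIntegral

attribute [instance] NormalizedChart.commRing NormalizedChart.algebra NormalizedChart.finiteType
  NormalizedChart.isOpenImmersion

/-- A nonempty open subset of an irreducible space is irreducible, so an affine neighbourhood of `x`
has prime nilradical; its coordinate ring is finitely generated, and Noether normalization applies.
-/
lemma exists_normalizedChart [LocallyOfFiniteType X.hom] [IrreducibleSpace X.left] (x : X.left) :
    ∃ (c : NormalizedChart X), x ∈ c.a.opensRange := by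
  obtain ⟨A, a, _, hx, -⟩ := Scheme.exists_affine_mem_range_and_range_subset
      (show x ∈ (⊤ : X.left.Opens) from trivial)
  let φ : CommRingCat.of k ⟶ A := Spec.preimage (a ≫ X.hom)
  let _ : Algebra k A := φ.hom.toAlgebra
  have ha : a ≫ X.hom = Spec.map (CommRingCat.ofHom (algebraMap k A)) :=
    (Spec.map_preimage _).symm
  have : Algebra.FiniteType k A := by
    have h : LocallyOfFiniteType (Spec.map (CommRingCat.ofHom (algebraMap k A))) := by
      rw [← ha]; infer_instance
    rwa [HasRingHomProperty.Spec_iff (P := @LocallyOfFiniteType)] at h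
  have : Nonempty (PrimeSpectrum A) := ⟨hx.choose⟩
  have h1 : IrreducibleSpace (PrimeSpectrum A) := by
    have hpre : PreirreducibleSpace (PrimeSpectrum A) :=
      .of_forall_nonempty_inter fun {V W} hV hW ⟨v, hv⟩ ⟨w, hw⟩ => by
        obtain ⟨_, ⟨v', hv', rfl⟩, ⟨w', hw', h⟩⟩ := nonempty_preirreducible_inter
          (a.isOpenEmbedding.isOpenMap _ hV) (a.isOpenEmbedding.isOpenMap _ hW)
          ⟨_, v, hv, rfl⟩ ⟨_, w, hw, rfl⟩
        obtain rfl := a.isOpenEmbedding.injective h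
        exact ⟨w', hv', hw'⟩
    exact ⟨‹_›⟩
  have : Nontrivial A := PrimeSpectrum.nonempty_iff_nontrivial.mp this
  obtain ⟨d, g, hg, hg'⟩ := exists_integral_inj_algHom_of_fg k A
  let c : NormalizedChart X :=
    { A := A
      a := a
      ha := ha
      isPrime := PrimeSpectrum.irreducibleSpace_iff_isPrime_nilradical.mp h1
      d := d
      g := g
      injective := hg
      isIntegral := hg' }
  exact ⟨c, hx⟩

variable {X}

/-- The independence condition for a prime `P` of `A ⊗ R`. -/
def NormalizedChart.IsIndep (c : NormalizedChart X) (s : Set (Fin c.d)) (R : Type u) [CommRing R]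
    [Algebra k R] (P : Ideal (c.A ⊗[k] R)) : Prop :=
  letI : Algebra R (c.A ⊗[k] R) := Algebra.TensorProduct.rightAlgebra
  IsIndepMod R (fun i => c.g (MvPolynomial.X i) ⊗ₜ[k] (1 : R)) s P

/-- Eliminates the fibres: bigness becomes a condition on primes of the rings `A ⊗ R`, as `S` covers
`X` and every point of `X_R` lies in the fibre over its image. In this form it can be followed
through the colimit. -/
lemma isBig_iff (S : Set (NormalizedChart X)) (hS : ∀ x : X.left, ∃ c ∈ S, x ∈ c.a.opensRange)
    (R : Type u) [CommRing R] [Algebra k R] (U : (fam X (specOver k R)).Opens) :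
    IsBig X U ↔ ∀ c ∈ S, ∀ s : Set (Fin c.d), Nat.card s = c.d - 2 →
      ∀ P : PrimeSpectrum (c.A ⊗[k] R), chart X c.a c.ha R P ∉ U → ¬ c.IsIndep s R P.asIdeal := by
  constructor
  · intro hU c _ s hs P hP
    have h := hU.2 _ ((famProj X (specOver k R)).asFiber (chart X c.a c.ha R P)) (by
      rw [Scheme.Hom.fiberι_asFiber]; exact hP)
    exact (three_le_ringKrullDim_iff X c.a c.ha R c.isPrime c.g c.injective c.isIntegral _ _ P
      (Scheme.Hom.fiberι_asFiber _ _)).mp h s (by simpa using hs)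
  · intro h
    refine ⟨U.isOpen.isClosed_compl, fun t z hz => ?_⟩
    obtain ⟨c, hc, x, hx⟩ := hS (pullback.fst X.hom (specOver k R).hom
      ((famProj X (specOver k R)).fiberι t z))
    obtain ⟨P, hP⟩ := exists_chart_eq X c.a c.ha R _ x hx
    rw [three_le_ringKrullDim_iff X c.a c.ha R c.isPrime c.g c.injective c.isIntegral _ _ P hP.symm]
    exact fun s hs => h c hc s (by simpa using hs) P (by rw [hP]; exact hz)

end Chart

section Colimit
variable {k : Type u} [Field k] {X : Over (Spec (CommRingCat.of k))}
  {J : Type u} [SmallCategory J] [IsFiltered J] (R : J ⥤ CommAlgCat.{u} k) (c : Cocone R)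
  (hc : IsColimit c)

/-- The functor `A ⊗ -` to commutative rings. -/
noncomputable def tensorFunctor (k : Type u) [Field k] (A : Type u) [CommRing A] [Algebra k A] :
    CommAlgCat.{u} k ⥤ CommRingCat.{u} where
  obj R := CommRingCat.of (A ⊗[k] R)
  map f := CommRingCat.ofHom (Algebra.TensorProduct.map (AlgHom.id k A) f.hom).toRingHom
  map_id R := congrArg (fun f : A ⊗[k] R →ₐ[k] A ⊗[k] R => CommRingCat.ofHom f.toRingHom)
    Algebra.TensorProduct.map_id
  map_comp {R _ T} f g := congrArg (fun f : A ⊗[k] R →ₐ[k] A ⊗[k] T =>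
    CommRingCat.ofHom f.toRingHom) (Algebra.TensorProduct.map_id_comp (A := A) g.hom f.hom)

/-- Naturality, in the ring being extended, of the comparison between the tensor product and the
chosen pushout; used for `tensorFunctorIso`. -/
lemma isoPushout_hom_naturality {C : Type*} [Category* C] [HasPushouts C] {Z A X Y P Q : C}
    {x : Z ⟶ X} {y : Z ⟶ Y} {a : Z ⟶ A} {i : X ⟶ P} {j : A ⟶ P} {i' : Y ⟶ Q} {j' : A ⟶ Q}
    (hP : IsPushout x a i j) (hQ : IsPushout y a i' j') (f : X ⟶ Y) (hf : x ≫ f = y) (F : P ⟶ Q)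
    (hi : i ≫ F = f ≫ i') (hj : j ≫ F = j') :
    F ≫ hQ.isoPushout.hom = hP.isoPushout.hom ≫
      pushout.desc (f ≫ pushout.inl y a) (pushout.inr y a)
        (by rw [reassoc_of% hf, pushout.condition]) := by
  apply hP.hom_ext
  · rw [reassoc_of% hi, hQ.inl_isoPushout_hom, hP.inl_isoPushout_hom_assoc, pushout.inl_desc]
  · rw [reassoc_of% hj, hQ.inr_isoPushout_hom, hP.inr_isoPushout_hom_assoc, pushout.inr_desc]

/-- The functor `A ⊗ -` is a pushout functor. -/
noncomputable def tensorFunctorIso (k : Type u) [Field k] (A : Type u) [CommRing A] [Algebra k A] :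
    tensorFunctor k A ≅ (commAlgCatEquivUnder (CommRingCat.of k)).functor ⋙
      Under.pushout (CommRingCat.ofHom (algebraMap k A)) ⋙ Under.forget _ :=
  NatIso.ofComponents (fun R => (isPushout_tensorProduct (k := k) (A := A) R).flip.isoPushout)
    (fun {R S} f => isoPushout_hom_naturality (isPushout_tensorProduct (k := k) (A := A) R).flip
      (isPushout_tensorProduct (k := k) (A := A) S).flip (CommRingCat.ofHom f.hom.toRingHom)
      (by ext x; exact f.hom.commutes x) _
      (by
        ext x
        exact (Algebra.TensorProduct.map_tmul _ _ _ _).trans (by rfl))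
      (by
        ext x
        exact (Algebra.TensorProduct.map_tmul _ _ _ _).trans
          (congrArg (x ⊗ₜ[k] ·) (map_one f.hom))))

/-- Pushout is a left adjoint, and forgetting the map from the base ring preserves connected
colimits, in particular filtered ones. -/
instance (A : Type u) [CommRing A] [Algebra k A] :
    PreservesColimitsOfShape J (tensorFunctor k A) :=
  preservesColimitsOfShape_of_natIso (tensorFunctorIso k A).symm

/-- The morphism of spectra induced by a homomorphism of `k`-algebras. -/
noncomputable abbrev specMap {R S : Type u} [CommRing R] [CommRing S] [Algebra k R] [Algebra k S]
    (f : R →ₐ[k] S) : specOver k S ⟶ specOver k R :=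
  Over.homMk (Spec.map (CommRingCat.ofHom f.toRingHom)) (by
    change Spec.map _ ≫ Spec.map _ = Spec.map _
    rw [← Spec.map_comp, ← CommRingCat.ofHom_comp]
    congr 2
    exact f.comp_algebraMap)

include hc in
-- Only finitely many coefficients have to be lifted. The stage is taken under `i` so that objects
-- given over `R_i` can be transported to it.
lemma exists_mvPolynomial_map_eq (i : J) {s : Type*} (f : MvPolynomial s c.pt) :
    ∃ (j : Under i) (f₀ : MvPolynomial s (R.obj j.right)),
      MvPolynomial.map (c.ι.app j.right).hom.toRingHom f₀ = f := by
  have hw : ∀ {p q : J} (h : p ⟶ q), (c.ι.app q).hom.toRingHom.comp (R.map h).hom.toRingHom =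
      (c.ι.app p).hom.toRingHom := fun h => by
    rw [← c.w h]; rfl
  have hjoint : ∀ p q : Under i, ∃ (l : Under i) (_ : p.right ⟶ l.right) (_ : q.right ⟶ l.right),
      True := fun p q =>
    ⟨IsFiltered.max p q, (IsFiltered.leftToMax p q).right, (IsFiltered.rightToMax p q).right,
      trivial⟩
  induction f using MvPolynomial.induction_on with
  | C x =>
    obtain ⟨j, y, hy⟩ := Concrete.isColimit_exists_rep _ (isColimitOfPreserves
      ((commAlgCatEquivUnder (CommRingCat.of k)).functor ⋙ Under.forget _) hc) x
    refine ⟨Under.mk (IsFiltered.leftToMax i j),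
      MvPolynomial.C ((R.map (IsFiltered.rightToMax i j)).hom y), ?_⟩
    rw [MvPolynomial.map_C, ← hy]
    exact congrArg MvPolynomial.C (RingHom.congr_fun (hw (IsFiltered.rightToMax i j)) y)
  | add f g hf hg =>
    obtain ⟨j, f₀, rfl⟩ := hf
    obtain ⟨j', g₀, rfl⟩ := hg
    obtain ⟨l, u, v, -⟩ := hjoint j j'
    refine ⟨l, f₀.map (R.map u).hom.toRingHom + g₀.map (R.map v).hom.toRingHom, ?_⟩
    rw [map_add, MvPolynomial.map_map, MvPolynomial.map_map, hw, hw]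
  | mul_X f n hf =>
    obtain ⟨j, f₀, rfl⟩ := hf
    exact ⟨j, f₀ * MvPolynomial.X n, by rw [map_mul, MvPolynomial.map_X]⟩

/-- The set of pairs expressing independence. -/
def NormalizedChart.indepPairs (ch : NormalizedChart X) (s : Set (Fin ch.d)) (R : Type u)
    [CommRing R] [Algebra k R] : Set ((ch.A ⊗[k] R) × (ch.A ⊗[k] R)) :=
  letI : Algebra R (ch.A ⊗[k] R) := Algebra.TensorProduct.rightAlgebra
  {p | ∃ (f : MvPolynomial s R) (m : _), p = (MvPolynomial.aeval
    (fun i : s => ch.g (MvPolynomial.X i) ⊗ₜ[k] (1 : R)) f, algebraMap R _ (f.coeff m))}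

/-- Brings independence into the shape `a ∈ P → b ∈ P` required by `exists_prime_of_isColimit`. -/
lemma NormalizedChart.isIndep_iff (ch : NormalizedChart X) (s : Set (Fin ch.d)) (R : Type u)
    [CommRing R] [Algebra k R] (P : Ideal (ch.A ⊗[k] R)) :
    ch.IsIndep s R P ↔ ∀ p ∈ ch.indepPairs s R, p.1 ∈ P → p.2 ∈ P := by
  constructor
  · rintro h _ ⟨f, m, rfl⟩ hp
    exact h f hp m
  · intro h f hf m
    exact h _ ⟨f, m, rfl⟩ hf

attribute [local instance] Algebra.TensorProduct.rightAlgebra in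
-- The elements attached to a polynomial over `R` are sent to those attached to its image over `R'`.
-- This is the compatibility of the conditions along the system.
lemma NormalizedChart.map_indepPairs (ch : NormalizedChart X) (s : Set (Fin ch.d)) {R R' : Type u}
    [CommRing R] [Algebra k R] [CommRing R'] [Algebra k R'] (φ : R →ₐ[k] R')
    (f : MvPolynomial s R) (m) :
    Algebra.TensorProduct.map (AlgHom.id k ch.A) φ (MvPolynomial.aeval
      (fun i : s => ch.g (MvPolynomial.X i) ⊗ₜ[k] (1 : R)) f) = MvPolynomial.aeval
      (fun i : s => ch.g (MvPolynomial.X i) ⊗ₜ[k] (1 : R')) (f.map φ.toRingHom) ∧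
    Algebra.TensorProduct.map (AlgHom.id k ch.A) φ (algebraMap R _ (f.coeff m)) =
      algebraMap R' _ ((f.map φ.toRingHom).coeff m) := by
  have h1 : ∀ r : R, Algebra.TensorProduct.map (AlgHom.id k ch.A) φ (algebraMap R _ r) =
      algebraMap R' (ch.A ⊗[k] R') (φ r) := fun r => by
    change Algebra.TensorProduct.map (AlgHom.id k ch.A) φ ((1 : ch.A) ⊗ₜ r) = (1 : ch.A) ⊗ₜ φ r
    simp
  constructor
  · induction f using MvPolynomial.induction_on with
    | C x => rw [MvPolynomial.map_C, MvPolynomial.aeval_C, MvPolynomial.aeval_C, h1]; rfl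
    | add f g hf hg => simp only [map_add, hf, hg]
    | mul_X f n hf =>
      simp only [map_mul, hf, MvPolynomial.aeval_X, MvPolynomial.map_X]
      simp
  · rw [h1, MvPolynomial.coeff_map]; rfl

include hc in
-- By contradiction and compactness: if every stage above `i` had a prime outside the preimage of
-- `U` modulo which the variables in `s` are independent, then so would the colimit.
lemma exists_forall_not_isIndep (ch : NormalizedChart X) (s : Set (Fin ch.d)) (i : J)
    (U : (fam X (specOver k (R.obj i))).Opens)
    (h : ∀ P : PrimeSpectrum (ch.A ⊗[k] c.pt),
      chart X ch.a ch.ha c.pt P ∉ famMap X (specMap (c.ι.app i).hom) ⁻¹ᵁ U →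
      ¬ ch.IsIndep s c.pt P.asIdeal) :
    ∃ (j : J) (f : i ⟶ j), ∀ P : PrimeSpectrum (ch.A ⊗[k] (R.obj j)),
      chart X ch.a ch.ha (R.obj j) P ∉ famMap X (specMap (R.map f).hom) ⁻¹ᵁ U →
      ¬ ch.IsIndep s (R.obj j) P.asIdeal := by
  by_contra! hcon
  obtain ⟨I, hI⟩ := (PrimeSpectrum.isClosed_iff_zeroLocus_ideal _).mp
    (chart X ch.a ch.ha (R.obj i) ⁻¹ᵁ U).isOpen.isClosed_compl
  -- Lying outside the preimage of `U` means containing the image of `I`, the ideal that cuts out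
  -- the complement of `U` in the chart over `R_i`.
  have key : ∀ {S : Type u} [CommRing S] [Algebra k S] (φ : R.obj i →ₐ[k] S)
      (P : PrimeSpectrum (ch.A ⊗[k] S)),
      chart X ch.a ch.ha S P ∉ famMap X (specMap φ) ⁻¹ᵁ U ↔
        ∀ x ∈ I, Algebra.TensorProduct.map (AlgHom.id k ch.A) φ x ∈ P.asIdeal := by
    intro S _ _ φ P
    have h1 := chart_map X ch.a ch.ha φ (specMap φ) rfl
    have h2 : famMap X (specMap φ) (chart X ch.a ch.ha S P) =
        chart X ch.a ch.ha (R.obj i) (PrimeSpectrum.comap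
          (Algebra.TensorProduct.map (AlgHom.id k ch.A) φ).toRingHom P) :=
      congrArg (fun q : _ ⟶ fam X (specOver k (R.obj i)) => q P) h1
    change famMap X (specMap φ) (chart X ch.a ch.ha S P) ∉ U ↔ _
    rw [h2]
    exact (Set.ext_iff.mp hI _)
  -- Since `U` lives over `R_i`, only the stages under `i` are used; they are cofinal and give the
  -- same colimit.
  let F : Under i ⥤ CommRingCat.{u} := Under.forget i ⋙ R ⋙ tensorFunctor k ch.A
  let cF : Cocone F := ((tensorFunctor k ch.A).mapCocone c).whisker (Under.forget i)
  have hcF : IsColimit cF := (Functor.Final.isColimitWhiskerEquiv (Under.forget i) _).symm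
    (isColimitOfPreserves (tensorFunctor k ch.A) hc)
  -- A pair `(0, x)` encodes the condition `x ∈ P`, so both requirements take the form of
  -- implications.
  let E : ∀ j, Set (F.obj j × F.obj j) := fun j =>
    {p | p ∈ ch.indepPairs s _ ∨
      ∃ x ∈ I, p = (0, Algebra.TensorProduct.map (AlgHom.id k ch.A) (R.map j.hom).hom x)}
  have hcomp : ∀ {S T : Type u} [CommRing S] [Algebra k S] [CommRing T] [Algebra k T]
      (φ : R.obj i →ₐ[k] S) (ψ : S →ₐ[k] T) (x : ch.A ⊗[k] R.obj i),
      Algebra.TensorProduct.map (AlgHom.id k ch.A) ψ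
        (Algebra.TensorProduct.map (AlgHom.id k ch.A) φ x) =
      Algebra.TensorProduct.map (AlgHom.id k ch.A) (ψ.comp φ) x := fun φ ψ x =>
    (AlgHom.congr_fun (Algebra.TensorProduct.map_id_comp (A := ch.A) ψ φ) x).symm
  have hE : ∀ ⦃j j' : Under i⦄ (h : j ⟶ j') (p : F.obj j × F.obj j), p ∈ E j →
      ((F.map h).hom p.1, (F.map h).hom p.2) ∈ E j' := by
    rintro j j' h _ (⟨f, m, rfl⟩ | ⟨x, hx, rfl⟩)
    · have e := ch.map_indepPairs s (R.map h.right).hom f m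
      exact Or.inl ⟨f.map (R.map h.right).hom.toRingHom, m, Prod.ext e.1 e.2⟩
    · have e : (R.map h.right).hom.comp (R.map j.hom).hom = (R.map j'.hom).hom := by
        rw [← CommAlgCat.hom_comp, ← R.map_comp, Under.w]
      exact Or.inr ⟨x, hx, Prod.ext (map_zero _) ((hcomp _ _ x).trans (congrArg (fun φ =>
        Algebra.TensorProduct.map (AlgHom.id k ch.A) φ x) e))⟩
  have hne : ∀ j, ∃ P : Ideal (F.obj j), P.IsPrime ∧ ∀ p ∈ E j, p.1 ∈ P → p.2 ∈ P := by
    intro j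
    obtain ⟨P, hP, hP'⟩ := hcon j.right j.hom
    refine ⟨P.asIdeal, P.2, ?_⟩
    rintro p (hp | ⟨x, hx, rfl⟩) h1
    · exact (ch.isIndep_iff _ _ _).mp hP' p hp h1
    · exact (key _ _).mp hP x hx
  obtain ⟨P, hP, hP'⟩ := exists_prime_of_isColimit F cF hcF E hE hne
  refine h ⟨P, hP⟩ ?_ ?_
  · refine (key (c.ι.app i).hom ⟨P, hP⟩).mpr fun x hx => ?_
    have h1 := hP' (Under.mk (𝟙 i)) _ (Or.inr ⟨x, hx, rfl⟩)
      ((map_zero (cF.ι.app (Under.mk (𝟙 i))).hom).symm ▸ P.zero_mem)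
    have h2 := hcomp (R.map (𝟙 i)).hom (c.ι.app i).hom x
    rw [show (c.ι.app i).hom.comp (R.map (𝟙 i)).hom = (c.ι.app i).hom by
      rw [← CommAlgCat.hom_comp, c.w]] at h2
    exact h2 ▸ h1
  · rw [ch.isIndep_iff]
    rintro _ ⟨f, m, rfl⟩ hp
    -- A relation over the colimit has coefficients in some stage, where it is one of the imposed
    -- conditions.
    obtain ⟨j, f₀, rfl⟩ := exists_mvPolynomial_map_eq R c hc i f
    have e := ch.map_indepPairs s (c.ι.app j.right).hom f₀ m
    have := hP' j _ (Or.inl ⟨f₀, m, rfl⟩)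
    exact e.2 ▸ this (e.1.symm ▸ hp)

lemma _root_.CategoryTheory.IsFiltered.exists_forall_of_finite {C : Type*} [Category* C]
    [IsFiltered C] {ι : Type*} [Finite ι] (Q : ι → C → Prop)
    (hQ : ∀ a {x y : C} (_ : x ⟶ y), Q a x → Q a y) (h : ∀ a, ∃ x, Q a x) : ∃ x, ∀ a, Q a x := by
  classical
  have := Fintype.ofFinite ι
  choose x hx using h
  obtain ⟨S, hS⟩ := IsFiltered.sup_objs_exists (Finset.univ.image x)
  exact ⟨S, fun a => hQ a (hS (Finset.mem_image_of_mem x (Finset.mem_univ a))).some (hx a)⟩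

/-- Contracting an offending prime over `T` gives an offending prime over `S`. Hence their absence
persists at later stages, which is needed to treat finitely many charts and subsets together. -/
lemma not_isIndep_of_comap (ch : NormalizedChart X) (s : Set (Fin ch.d)) {R S T : Type u}
    [CommRing R] [CommRing S] [CommRing T] [Algebra k R] [Algebra k S] [Algebra k T]
    (φ : R →ₐ[k] S) (ψ : S →ₐ[k] T) (U : (fam X (specOver k R)).Opens)
    (h : ∀ P : PrimeSpectrum (ch.A ⊗[k] S), chart X ch.a ch.ha S P ∉ famMap X (specMap φ) ⁻¹ᵁ U →
      ¬ ch.IsIndep s S P.asIdeal) (P : PrimeSpectrum (ch.A ⊗[k] T))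
    (hP : chart X ch.a ch.ha T P ∉ famMap X (specMap (ψ.comp φ)) ⁻¹ᵁ U) :
    ¬ ch.IsIndep s T P.asIdeal := by
  intro hi
  let P' : PrimeSpectrum (ch.A ⊗[k] S) := PrimeSpectrum.comap
    (Algebra.TensorProduct.map (AlgHom.id k ch.A) ψ).toRingHom P
  have e : famMap X (specMap ψ) (chart X ch.a ch.ha T P) = chart X ch.a ch.ha S P' :=
    congrArg (fun q : _ ⟶ fam X (specOver k S) => q P) (chart_map X ch.a ch.ha ψ (specMap ψ) rfl)
  have e2 : specMap (ψ.comp φ) = specMap ψ ≫ specMap φ := by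
    ext1
    change Spec.map _ = Spec.map _ ≫ Spec.map _
    rw [← Spec.map_comp]
    rfl
  refine h P' (fun hU => hP ?_) ?_
  · rw [e2, ← famMap_comp]
    change famMap X (specMap φ) (famMap X (specMap ψ) (chart X ch.a ch.ha T P)) ∈ U
    rw [e]
    exact hU
  · rw [ch.isIndep_iff] at hi ⊢
    rintro _ ⟨f, m, rfl⟩ hp
    have e := ch.map_indepPairs s ψ f m
    have h1 := hi _ ⟨f.map ψ.toRingHom, m, rfl⟩ (e.1 ▸ hp)
    exact (congrArg (· ∈ P.asIdeal) e.2).mpr h1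

include hc in
/-- An open subset of `X_{R_i}` whose preimage in `X_R` is big becomes big at a finite stage. -/
theorem exists_isBig_preimage [LocallyOfFiniteType X.hom] [CompactSpace X.left]
    [IrreducibleSpace X.left] (i : J) (U : (fam X (specOver k (R.obj i))).Opens)
    (h : IsBig X (famMap X (specMap (c.ι.app i).hom) ⁻¹ᵁ U)) :
    ∃ (j : J) (f : i ⟶ j), IsBig X (famMap X (specMap (R.map f).hom) ⁻¹ᵁ U) := by
  choose ch hch using fun x : X.left => exists_normalizedChart X x
  obtain ⟨t, ht⟩ := isCompact_univ.elim_finite_subcover (fun x => ((ch x).a.opensRange : Set X.left))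
    (fun x => (ch x).a.opensRange.isOpen) fun x _ => Set.mem_iUnion.mpr ⟨x, hch x⟩
  let S : Set (NormalizedChart X) := ch '' t
  have hS : ∀ x : X.left, ∃ c ∈ S, x ∈ c.a.opensRange := fun x => by
    obtain ⟨y, hy, hxy⟩ := Set.mem_iUnion₂.mp (ht (Set.mem_univ x))
    exact ⟨ch y, ⟨y, hy, rfl⟩, hxy⟩
  rw [isBig_iff S hS] at h
  -- There are finitely many conditions: one for each chart of a finite cover and each set of `d -
  -- 2` of its variables.
  let Q : (Σ x : t, {s : Set (Fin (ch x).d) // Nat.card s = (ch x).d - 2}) → Under i → Prop :=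
    fun a j => ∀ P : PrimeSpectrum ((ch a.1).A ⊗[k] (R.obj j.right)),
      chart X (ch a.1).a (ch a.1).ha (R.obj j.right) P ∉
        famMap X (specMap (R.map j.hom).hom) ⁻¹ᵁ U →
      ¬ (ch a.1).IsIndep a.2.1 (R.obj j.right) P.asIdeal
  have hQ : ∀ a {j j' : Under i} (_ : j ⟶ j'), Q a j → Q a j' := by
    intro a j j' u hQ P hP
    refine not_isIndep_of_comap (ch a.1) a.2.1 (R.map j.hom).hom (R.map u.right).hom U hQ P ?_
    rwa [← CommAlgCat.hom_comp, ← R.map_comp, Under.w]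
  have hex : ∀ a, ∃ j, Q a j := by
    rintro ⟨⟨x, hx⟩, ⟨s, hs⟩⟩
    obtain ⟨j, f, hj⟩ := exists_forall_not_isIndep R c hc (ch x) s i U (h _ ⟨x, hx, rfl⟩ s hs)
    exact ⟨Under.mk f, hj⟩
  obtain ⟨j, hj⟩ := IsFiltered.exists_forall_of_finite Q hQ hex
  refine ⟨j.right, j.hom, (isBig_iff S hS _ _).mpr ?_⟩
  rintro _ ⟨x, hx, rfl⟩ s hs
  exact hj ⟨⟨x, hx⟩, ⟨s, hs⟩⟩

include hc in
theorem exists_isBig_preimage_algSpec [LocallyOfFiniteType X.hom] [CompactSpace X.left]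
    [IrreducibleSpace X.left] (i : J)
    (U : (fam X ((R.op ⋙ algSpec (CommRingCat.of k)).obj (.op i))).Opens)
    (h : IsBig X (famMap X (((algSpec (CommRingCat.of k)).mapCone c.op).π.app (.op i)) ⁻¹ᵁ U)) :
    ∃ (j : J) (f : i ⟶ j),
      IsBig X (famMap X ((R.op ⋙ algSpec (CommRingCat.of k)).map f.op) ⁻¹ᵁ U) :=
  exists_isBig_preimage R c hc i U h

end Colimit
end GenericBundles

end

/-! ### Sections of modules, frames, and morphisms given on frames. -/

section

namespace AlgebraicGeometry.Scheme

variable {X Y : Scheme.{u}}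

/-- Restriction of functions to a smaller open subset. -/
noncomputable def resO (X : Scheme.{u}) {U V : X.Opens} (h : V ≤ U) : Γ(X, U) →+* Γ(X, V) :=
  (X.presheaf.map (homOfLE h).op).hom

lemma resO_resO {U V W : X.Opens} (h : V ≤ U) (h' : W ≤ V) (s : Γ(X, U)) :
    X.resO h' (X.resO h s) = X.resO (h'.trans h) s := by
  unfold resO
  rw [← CommRingCat.comp_apply, ← X.presheaf.map_comp]
  rfl

lemma resO_self {U : X.Opens} (h : U ≤ U) (s : Γ(X, U)) : X.resO h s = s := by
  have : (homOfLE h).op = 𝟙 (Opposite.op U) := rfl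
  unfold resO
  rw [this, X.presheaf.map_id]
  rfl

namespace Modules

variable {M N K : X.Modules}

/-- Restriction of sections to a smaller open subset. -/
noncomputable def res (M : X.Modules) {U V : X.Opens} (h : V ≤ U) : Γ(M, U) →+ Γ(M, V) :=
  (M.presheaf.map (homOfLE h).op).hom

lemma res_smul {U V : X.Opens} (h : V ≤ U) (c : Γ(X, U)) (s : Γ(M, U)) :
    M.res h (c • s) = X.resO h c • M.res h s :=
  map_smul M (homOfLE h) c s

lemma res_res {U V W : X.Opens} (h : V ≤ U) (h' : W ≤ V) (s : Γ(M, U)) :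
    M.res h' (M.res h s) = M.res (h'.trans h) s := by
  have := congrArg (fun f => f.hom s) (M.presheaf.map_comp (homOfLE h).op (homOfLE h').op)
  exact this.symm

lemma res_self {U : X.Opens} (h : U ≤ U) (s : Γ(M, U)) : M.res h s = s :=
  congrArg (fun f => f.hom s) (M.presheaf.map_id (Opposite.op U))

lemma res_sum_smul {ι : Type*} (t : Finset ι) {U V : X.Opens} (h : V ≤ U) (c : ι → Γ(X, U))
    (s : ι → Γ(M, U)) :
    M.res h (∑ p ∈ t, c p • s p) = ∑ p ∈ t, X.resO h (c p) • M.res h (s p) := by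
  rw [map_sum]
  exact Finset.sum_congr rfl fun p _ => res_smul h _ _

lemma res_bijective_of_eq {U V : X.Opens} (h : V ≤ U) (h' : U ≤ V) :
    Function.Bijective (M.res h) := by
  refine Function.bijective_iff_has_inverse.mpr ⟨M.res h', fun s => ?_, fun s => ?_⟩
  · exact (res_res _ _ _).trans (res_self _ _)
  · exact (res_res _ _ _).trans (res_self _ _)

/-- The action of a morphism on sections. -/
noncomputable def sec (φ : M ⟶ N) (U : X.Opens) : Γ(M, U) →ₗ[Γ(X, U)] Γ(N, U) where
  toFun s := φ.app U s
  map_add' s t := map_add (φ.app U).hom s t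
  map_smul' c s := Hom.app_smul φ c s

lemma sec_res (φ : M ⟶ N) {U V : X.Opens} (h : V ≤ U) (s : Γ(M, U)) :
    sec φ V (M.res h s) = N.res h (sec φ U s) :=
  congrArg (fun f => f.hom s) (φ.mapPresheaf.naturality (homOfLE h).op)

lemma sec_id (U : X.Opens) (s : Γ(M, U)) : sec (𝟙 M) U s = s := rfl

lemma sec_comp (φ : M ⟶ N) (ψ : N ⟶ K) (U : X.Opens) (s : Γ(M, U)) :
    sec (φ ≫ ψ) U s = sec ψ U (sec φ U s) := rfl

lemma ext_sec {φ ψ : M ⟶ N} (h : ∀ U s, sec φ U s = sec ψ U s) : φ = ψ :=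
  hom_ext _ _ fun U => AddCommGrpCat.hom_ext (AddMonoidHom.ext fun s => h U s)

lemma sec_bijective_of_isIso (φ : M ⟶ N) [IsIso φ] (U : X.Opens) :
    Function.Bijective (sec φ U) := by
  refine Function.bijective_iff_has_inverse.mpr ⟨sec (inv φ) U, fun s => ?_, fun s => ?_⟩
  · rw [← sec_comp, IsIso.hom_inv_id, sec_id]
  · rw [← sec_comp, IsIso.inv_hom_id, sec_id]

/-- A morphism of sheaves of modules from a compatible family of linear maps on sections. -/
noncomputable def homOfSec (F : ∀ U : X.Opens, Γ(M, U) →ₗ[Γ(X, U)] Γ(N, U))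
    (hF : ∀ (U V : X.Opens) (h : V ≤ U) (s : Γ(M, U)), F V (M.res h s) = N.res h (F U s)) :
    M ⟶ N :=
  fullyFaithfulToPresheafOfModules.preimage
    (PresheafOfModules.homMk (M₁ := M.val) (M₂ := N.val)
      { app := fun U => AddCommGrpCat.ofHom (F U.unop).toAddMonoidHom
        naturality := fun {U V} f => AddCommGrpCat.hom_ext (AddMonoidHom.ext fun s =>
          hF U.unop V.unop f.unop.le s) }
      fun U c s => (F U.unop).map_smul c s)

lemma existsUnique_res {ι : Type*} (V : ι → X.Opens) (U : X.Opens) (hV : ∀ a, V a ≤ U)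
    (hU : U ≤ ⨆ a, V a) (s : ∀ a, Γ(M, V a))
    (hs : ∀ a b, M.res (inf_le_left : V a ⊓ V b ≤ V a) (s a) =
      M.res (inf_le_right : V a ⊓ V b ≤ V b) (s b)) :
    ∃! t : Γ(M, U), ∀ a, M.res (hV a) t = s a :=
  TopCat.Sheaf.existsUnique_gluing' ⟨M.presheaf, M.isSheaf⟩ V U (fun a => homOfLE (hV a)) hU s hs

/-! ### Frames -/

/-- A family of sections over `V` is a frame if it is a basis of the sections over each open subset
of `V`. -/
def IsFrame {r : ℕ} (M : X.Modules) (V : X.Opens) (e : Fin r → Γ(M, V)) : Prop :=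
  ∀ (U : X.Opens) (h : U ≤ V),
    Function.Bijective fun c : Fin r → Γ(X, U) => ∑ p, c p • M.res h (e p)

namespace IsFrame

variable {r : ℕ} {V : X.Opens} {e : Fin r → Γ(M, V)}

lemma mono (he : IsFrame M V e) {W : X.Opens} (h : W ≤ V) :
    IsFrame M W fun p => M.res h (e p) := by
  intro U hU
  have : (fun c : Fin r → Γ(X, U) => ∑ p, c p • M.res hU (M.res h (e p))) =
      fun c : Fin r → Γ(X, U) => ∑ p, c p • M.res (hU.trans h) (e p) := by
    funext c
    exact Finset.sum_congr rfl fun p _ => by rw [res_res]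
  rw [this]
  exact he U (hU.trans h)

lemma ext (he : IsFrame M V e) {U : X.Opens} (h : U ≤ V) {c d : Fin r → Γ(X, U)}
    (hcd : ∑ p, c p • M.res h (e p) = ∑ p, d p • M.res h (e p)) : c = d :=
  (he U h).1 hcd

lemma exists_eq (he : IsFrame M V e) {U : X.Opens} (h : U ≤ V) (s : Γ(M, U)) :
    ∃ c : Fin r → Γ(X, U), s = ∑ p, c p • M.res h (e p) :=
  let ⟨c, hc⟩ := (he U h).2 s
  ⟨c, hc.symm⟩

/-- Only bijectivity over the open subsets of `V` is needed, so this also applies to morphisms that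
are isomorphisms merely over `V`. -/
lemma of_sec_bijective (φ : M ⟶ N) (hφ : ∀ U ≤ V, Function.Bijective (sec φ U))
    (e : Fin r → Γ(M, V)) : IsFrame M V e ↔ IsFrame N V fun p => sec φ V (e p) := by
  refine forall₂_congr fun U h => ?_
  have : (fun c : Fin r → Γ(X, U) => ∑ p, c p • N.res h (sec φ V (e p))) =
      sec φ U ∘ fun c : Fin r → Γ(X, U) => ∑ p, c p • M.res h (e p) := by
    funext c
    rw [Function.comp_apply, map_sum]
    exact Finset.sum_congr rfl fun p _ => by rw [_root_.map_smul, sec_res]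
  rw [this]
  exact ((hφ U h).of_comp_iff' _).symm

end IsFrame

/-- The sections of `N` over an open subset can be glued uniquely from sections over the
intersections with the members of the family `V`. -/
def IsGlued {ι : Type*} (N : X.Modules) (V : ι → X.Opens) : Prop :=
  ∀ (U : X.Opens) (t : ∀ a, Γ(N, U ⊓ V a)),
    (∀ a b, N.res (le_inf inf_le_left (inf_le_right.trans inf_le_left) :
        U ⊓ (V a ⊓ V b) ≤ U ⊓ V a) (t a) =
      N.res (le_inf inf_le_left (inf_le_right.trans inf_le_right) :
        U ⊓ (V a ⊓ V b) ≤ U ⊓ V b) (t b)) →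
    ∃! s : Γ(N, U), ∀ a, N.res inf_le_left s = t a

/-- A cover of `X` is one source of `IsGlued`. The other is a module extended from a single open
subset, as in `isGlued_const_iff`; the results on frames below serve both cases. -/
lemma isGlued_of_iSup_eq_top {ι : Type*} (N : X.Modules) (V : ι → X.Opens) (hV : ⨆ a, V a = ⊤) :
    IsGlued N V := by
  intro U t ht
  refine existsUnique_res (fun a => U ⊓ V a) U (fun a => inf_le_left) ?_ t fun a b => ?_
  · rw [← inf_iSup_eq, hV, inf_top_eq]
  · have h : U ⊓ V a ⊓ (U ⊓ V b) ≤ U ⊓ (V a ⊓ V b) :=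
      le_inf (inf_le_left.trans inf_le_left)
        (le_inf (inf_le_left.trans inf_le_right) (inf_le_right.trans inf_le_right))
    have := congrArg (N.res h) (ht a b)
    rwa [res_res, res_res] at this

lemma IsGlued.ext {ι : Type*} {N : X.Modules} {V : ι → X.Opens} (hN : IsGlued N V) {U : X.Opens}
    {s t : Γ(N, U)} (h : ∀ a, N.res (inf_le_left : U ⊓ V a ≤ U) s = N.res inf_le_left t) :
    s = t := by
  refine (hN U (fun a => N.res inf_le_left s) fun a b => ?_).unique (fun a => rfl)
    fun a => (h a).symm
  rw [res_res, res_res]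

section GlueHom

variable {ι : Type*} {r : ℕ} {V : ι → X.Opens}

lemma hom_ext_of_frames (hN : IsGlued N V) (e : ∀ a, Fin r → Γ(M, V a))
    (he : ∀ a, IsFrame M (V a) (e a)) {φ ψ : M ⟶ N}
    (h : ∀ a p, sec φ (V a) (e a p) = sec ψ (V a) (e a p)) : φ = ψ := by
  refine ext_sec fun U s => hN.ext fun a => ?_
  obtain ⟨c, hc⟩ := (he a).exists_eq (inf_le_right : U ⊓ V a ≤ V a) (M.res inf_le_left s)
  rw [← sec_res, ← sec_res, hc, map_sum, map_sum]
  exact Finset.sum_congr rfl fun p _ => by rw [_root_.map_smul, _root_.map_smul, sec_res, sec_res, h]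

/-- The sections `s` of `M` and `t` of `N` have the same coordinates. -/
def SameCoords {V : X.Opens} (e : Fin r → Γ(M, V)) (σ : Fin r → Γ(N, V)) (U : X.Opens)
    (s : Γ(M, U)) (t : Γ(N, U)) : Prop :=
  ∃ c : Fin r → Γ(X, U ⊓ V), M.res inf_le_left s = ∑ p, c p • M.res inf_le_right (e p) ∧
    N.res inf_le_left t = ∑ p, c p • N.res inf_le_right (σ p)

lemma SameCoords.add {V : X.Opens} {e : Fin r → Γ(M, V)} {σ : Fin r → Γ(N, V)} {U : X.Opens}
    {s s' : Γ(M, U)} {t t' : Γ(N, U)} (h : SameCoords e σ U s t) (h' : SameCoords e σ U s' t') :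
    SameCoords e σ U (s + s') (t + t') := by
  obtain ⟨c, h1, h2⟩ := h
  obtain ⟨d, h3, h4⟩ := h'
  refine ⟨c + d, ?_, ?_⟩
  · rw [map_add, h1, h3, ← Finset.sum_add_distrib]
    exact Finset.sum_congr rfl fun p _ => (add_smul _ _ _).symm
  · rw [map_add, h2, h4, ← Finset.sum_add_distrib]
    exact Finset.sum_congr rfl fun p _ => (add_smul _ _ _).symm

lemma SameCoords.smul {V : X.Opens} {e : Fin r → Γ(M, V)} {σ : Fin r → Γ(N, V)} {U : X.Opens}
    {s : Γ(M, U)} {t : Γ(N, U)} (h : SameCoords e σ U s t) (a : Γ(X, U)) :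
    SameCoords e σ U (a • s) (a • t) := by
  obtain ⟨c, h1, h2⟩ := h
  refine ⟨fun p => X.resO inf_le_left a * c p, ?_, ?_⟩
  · rw [res_smul, h1, Finset.smul_sum]
    exact Finset.sum_congr rfl fun p _ => (mul_smul _ _ _).symm
  · rw [res_smul, h2, Finset.smul_sum]
    exact Finset.sum_congr rfl fun p _ => (mul_smul _ _ _).symm

lemma SameCoords.res {V : X.Opens} {e : Fin r → Γ(M, V)} {σ : Fin r → Γ(N, V)} {U : X.Opens}
    {s : Γ(M, U)} {t : Γ(N, U)} (h : SameCoords e σ U s t) {W : X.Opens} (hW : W ≤ U) :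
    SameCoords e σ W (M.res hW s) (N.res hW t) := by
  obtain ⟨c, h1, h2⟩ := h
  have k : W ⊓ V ≤ U ⊓ V := inf_le_inf_right _ hW
  refine ⟨fun p => X.resO k (c p), ?_, ?_⟩
  · have := congrArg (M.res k) h1
    rw [res_sum_smul, res_res] at this
    rw [res_res, this]
    exact Finset.sum_congr rfl fun p _ => by rw [res_res]
  · have := congrArg (N.res k) h2
    rw [res_sum_smul, res_res] at this
    rw [res_res, this]
    exact Finset.sum_congr rfl fun p _ => by rw [res_res]

/-- The value on each `U ⊓ V a` is forced by the coordinates of `s`. The values agree on overlaps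
because the families `e` and `σ` transform by the same matrices. -/
lemma existsUnique_sameCoords (hN : IsGlued N V) (e : ∀ a, Fin r → Γ(M, V a))
    (he : ∀ a, IsFrame M (V a) (e a)) (σ : ∀ a, Fin r → Γ(N, V a))
    (h : ∀ a b, ∃ c : Fin r → Fin r → Γ(X, V a ⊓ V b),
      (∀ p, M.res inf_le_right (e b p) = ∑ q, c p q • M.res inf_le_left (e a q)) ∧
      ∀ p, N.res inf_le_right (σ b p) = ∑ q, c p q • N.res inf_le_left (σ a q))
    (U : X.Opens) (s : Γ(M, U)) : ∃! t : Γ(N, U), ∀ a, SameCoords (e a) (σ a) U s t := by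
  choose k hk using fun a => (he a).exists_eq (inf_le_right : U ⊓ V a ≤ V a) (M.res inf_le_left s)
  obtain ⟨t, ht, ht'⟩ := hN U (fun a => ∑ p, k a p • N.res inf_le_right (σ a p)) fun a b => by
    obtain ⟨c, h1, h2⟩ := h a b
    set W := U ⊓ (V a ⊓ V b)
    have ia : W ≤ U ⊓ V a := le_inf inf_le_left (inf_le_right.trans inf_le_left)
    have ib : W ≤ U ⊓ V b := le_inf inf_le_left (inf_le_right.trans inf_le_right)
    have iab : W ≤ V a ⊓ V b := inf_le_right
    -- Change of coordinates on the overlap, by uniqueness of coordinates in the frame `e a`.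
    have key : (fun q => X.resO ia (k a q)) =
        fun q => ∑ p, X.resO ib (k b p) * X.resO iab (c p q) := by
      refine (he a).ext (iab.trans inf_le_left) ?_
      have e1 := congrArg (M.res ia) (hk a)
      have e2 := congrArg (M.res ib) (hk b)
      rw [res_res, res_sum_smul] at e1 e2
      rw [show ∑ q, X.resO ia (k a q) • M.res (iab.trans inf_le_left) (e a q) =
        M.res (ia.trans inf_le_left) s by
          rw [e1]; exact Finset.sum_congr rfl fun p _ => by rw [res_res]]
      refine e2.trans ?_
      rw [Finset.sum_congr rfl fun q _ => Finset.sum_smul, Finset.sum_comm]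
      refine Finset.sum_congr rfl fun p _ => ?_
      have e3 := congrArg (M.res iab) (h1 p)
      rw [res_res, res_sum_smul] at e3
      rw [res_res, e3, Finset.smul_sum]
      exact Finset.sum_congr rfl fun q _ => by rw [res_res, mul_smul]
    have e1 : N.res ia (∑ p, k a p • N.res inf_le_right (σ a p)) =
        ∑ q, X.resO ia (k a q) • N.res (iab.trans inf_le_left) (σ a q) := by
      rw [res_sum_smul]; exact Finset.sum_congr rfl fun p _ => by rw [res_res]
    refine e1.trans ?_
    rw [Finset.sum_congr rfl fun q _ => by rw [congrFun key q, Finset.sum_smul], Finset.sum_comm,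
      res_sum_smul]
    refine Finset.sum_congr rfl fun p _ => ?_
    have e3 := congrArg (N.res iab) (h2 p)
    rw [res_res, res_sum_smul] at e3
    rw [res_res, e3, Finset.smul_sum]
    exact Finset.sum_congr rfl fun q _ => by rw [res_res, mul_smul]
  refine ⟨t, fun a => ⟨k a, hk a, ht a⟩, fun t' h' => ht' t' fun a => ?_⟩
  obtain ⟨c, h1, h2⟩ := h' a
  have : c = k a := (he a).ext (inf_le_right : U ⊓ V a ≤ V a) (h1.symm.trans (hk a))
  subst this
  exact h2

/-- A morphism is given by its values on frames, provided that these values are compatible. -/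
theorem exists_hom_of_frames (hN : IsGlued N V) (e : ∀ a, Fin r → Γ(M, V a))
    (he : ∀ a, IsFrame M (V a) (e a)) (σ : ∀ a, Fin r → Γ(N, V a))
    (h : ∀ a b, ∃ c : Fin r → Fin r → Γ(X, V a ⊓ V b),
      (∀ p, M.res inf_le_right (e b p) = ∑ q, c p q • M.res inf_le_left (e a q)) ∧
      ∀ p, N.res inf_le_right (σ b p) = ∑ q, c p q • N.res inf_le_left (σ a q)) :
    ∃ φ : M ⟶ N, ∀ a p, sec φ (V a) (e a p) = σ a p := by
  have H := existsUnique_sameCoords hN e he σ h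
  choose F hF hF' using H
  -- Additivity, linearity and compatibility with restriction all follow from the uniqueness of the
  -- section with given coordinates.
  refine ⟨homOfSec (fun U => ⟨⟨F U, fun s t => ?_⟩, fun c s => ?_⟩) fun U W hW s => ?_,
    fun a p => ?_⟩
  · exact (hF' U _ _ fun a => (hF U s a).add (hF U t a)).symm
  · exact (hF' U _ _ fun a => (hF U s a).smul c).symm
  · exact (hF' W _ _ fun a => (hF U s a).res hW).symm
  · refine (hF' (V a) _ (σ a p) fun b => ?_).symm
    obtain ⟨c, h1, h2⟩ := h b a
    have i : V a ⊓ V b ≤ V b ⊓ V a := le_inf inf_le_right inf_le_left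
    refine ⟨fun q => X.resO i (c p q), ?_, ?_⟩
    · have := congrArg (M.res i) (h1 p)
      rw [res_res, res_sum_smul] at this
      exact this.trans (Finset.sum_congr rfl fun q _ => by rw [res_res])
    · have := congrArg (N.res i) (h2 p)
      rw [res_res, res_sum_smul] at this
      exact this.trans (Finset.sum_congr rfl fun q _ => by rw [res_res])

end GlueHom

end Modules

end AlgebraicGeometry.Scheme

end

/-! ### The module glued from a cocycle of matrices. -/

section

namespace AlgebraicGeometry.Scheme

variable {X : Scheme.{u}}

lemma existsUnique_resO {ι : Type*} (V : ι → X.Opens) (U : X.Opens) (hV : ∀ a, V a ≤ U)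
    (hU : U ≤ ⨆ a, V a) (s : ∀ a, Γ(X, V a))
    (hs : ∀ a b, X.resO (inf_le_left : V a ⊓ V b ≤ V a) (s a) =
      X.resO (inf_le_right : V a ⊓ V b ≤ V b) (s b)) :
    ∃! t : Γ(X, U), ∀ a, X.resO (hV a) t = s a :=
  TopCat.Sheaf.existsUnique_gluing' X.sheaf V U (fun a => homOfLE (hV a)) hU s hs

lemma eq_of_resO_eq {ι : Type*} (V : ι → X.Opens) (U : X.Opens) (hV : ∀ a, V a ≤ U)
    (hU : U ≤ ⨆ a, V a) (s t : Γ(X, U)) (h : ∀ a, X.resO (hV a) s = X.resO (hV a) t) : s = t :=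
  TopCat.Sheaf.eq_of_locally_eq' X.sheaf V U (fun a => homOfLE (hV a)) hU s t h

lemma resO_bijective_of_le {U V : X.Opens} (h : V ≤ U) (h' : U ≤ V) :
    Function.Bijective (X.resO h) := by
  refine Function.bijective_iff_has_inverse.mpr ⟨X.resO h', fun s => ?_, fun s => ?_⟩
  · exact (resO_resO _ _ _).trans (resO_self _ _)
  · exact (resO_resO _ _ _).trans (resO_self _ _)

lemma resO_sum_mul {ι : Type*} (t : Finset ι) {U V : X.Opens} (h : V ≤ U) (c d : ι → Γ(X, U)) :
    X.resO h (∑ p ∈ t, c p * d p) = ∑ p ∈ t, X.resO h (c p) * X.resO h (d p) := by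
  rw [map_sum]
  exact Finset.sum_congr rfl fun p _ => map_mul _ _ _

namespace Modules

namespace Cocycle

variable {ι : Type u} {r : ℕ} {V : ι → X.Opens} (g : ∀ a b, Fin r → Fin r → Γ(X, V a ⊓ V b))

/-- The sections over `U` of the module glued from free modules on the `V a` along the transition
matrices `g`. -/
def sections (U : X.Opens) : AddSubgroup (∀ a, Fin r → Γ(X, U ⊓ V a)) where
  -- Coordinates are row vectors: on the overlap, `s b = s a * g a b`.
  carrier := {s | ∀ a b q,
    X.resO (le_inf inf_le_left (inf_le_right.trans inf_le_right) : U ⊓ (V a ⊓ V b) ≤ U ⊓ V b)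
      (s b q) =
    ∑ p, X.resO (le_inf inf_le_left (inf_le_right.trans inf_le_left) :
        U ⊓ (V a ⊓ V b) ≤ U ⊓ V a) (s a p) * X.resO inf_le_right (g a b p q)}
  zero_mem' a b q := by
    refine (map_zero _).trans (Finset.sum_eq_zero fun p _ => ?_).symm
    exact (congrArg (· * _) (map_zero _)).trans (zero_mul _)
  add_mem' {s t} hs ht a b q := by
    refine (map_add _ _ _).trans ?_
    rw [hs, ht, ← Finset.sum_add_distrib]
    refine Finset.sum_congr rfl fun p _ => ?_
    rw [← add_mul]
    exact congrArg (· * _) (map_add _ _ _).symm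
  neg_mem' {s} hs a b q := by
    refine (map_neg _ _).trans ?_
    rw [hs, ← Finset.sum_neg_distrib]
    refine Finset.sum_congr rfl fun p _ => ?_
    rw [← neg_mul]
    exact congrArg (· * _) (map_neg _ _).symm

variable {g}

lemma sections_ext {U : X.Opens} {s t : sections g U} (h : ∀ a p, s.1 a p = t.1 a p) : s = t :=
  Subtype.ext (funext fun a => funext fun p => h a p)

noncomputable instance (U : X.Opens) : SMul Γ(X, U) (sections g U) where
  smul c s := ⟨fun a p => X.resO inf_le_left c * s.1 a p, fun a b q => by
    rw [map_mul, s.2, Finset.mul_sum, resO_resO]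
    refine Finset.sum_congr rfl fun p _ => ?_
    rw [map_mul, resO_resO, mul_assoc]⟩

lemma smul_val {U : X.Opens} (c : Γ(X, U)) (s : sections g U) (a : ι) (p : Fin r) :
    (c • s).1 a p = X.resO inf_le_left c * s.1 a p := rfl

noncomputable instance (U : X.Opens) : Module Γ(X, U) (sections g U) where
  one_smul s := sections_ext fun a p => by rw [smul_val, map_one, one_mul]
  mul_smul c d s := sections_ext fun a p => by rw [smul_val, smul_val, smul_val, map_mul, mul_assoc]
  smul_zero c := sections_ext fun a p => mul_zero _
  zero_smul s := sections_ext fun a p => by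
    rw [smul_val, map_zero, zero_mul]; rfl
  smul_add c s t := sections_ext fun a p => mul_add _ _ _
  add_smul c d s := sections_ext fun a p => by
    rw [smul_val, map_add, add_mul]; rfl

variable (g) in
/-- Restriction of sections. -/
noncomputable def resSections {U W : X.Opens} (h : W ≤ U) : sections g U →+ sections g W where
  toFun s := ⟨fun a p => X.resO (inf_le_inf_right _ h) (s.1 a p), fun a b q => by
    have := congrArg (X.resO (inf_le_inf_right (V a ⊓ V b) h)) (s.2 a b q)
    rw [resO_resO, resO_sum_mul] at this
    rw [resO_resO, this]
    exact Finset.sum_congr rfl fun p _ => by rw [resO_resO, resO_resO, resO_resO]⟩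
  map_zero' := sections_ext fun a p => map_zero _
  map_add' s t := sections_ext fun a p => map_add _ _ _

lemma resSections_val {U W : X.Opens} (h : W ≤ U) (s : sections g U) (a : ι) (p : Fin r) :
    (resSections g h s).1 a p = X.resO (inf_le_inf_right _ h) (s.1 a p) := rfl

variable (g) in
/-- The presheaf of sections. -/
noncomputable def abPresheaf : TopCat.Presheaf Ab.{u} X where
  obj U := AddCommGrpCat.of (sections g U.unop)
  map f := AddCommGrpCat.ofHom (resSections g f.unop.le)
  map_id _ := AddCommGrpCat.hom_ext (AddMonoidHom.ext fun _ => sections_ext fun _ _ =>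
    resO_self _ _)
  map_comp _ _ := AddCommGrpCat.hom_ext (AddMonoidHom.ext fun _ => sections_ext fun _ _ =>
    (resO_resO _ _ _).symm)

/-- Sections are families of functions subject to local equations: functions glue component by
component, and the equations may be checked locally. The cocycle condition plays no role. -/
lemma isSheaf_abPresheaf : (abPresheaf g).IsSheaf := by
  rw [TopCat.Presheaf.isSheaf_iff_isSheafUniqueGluing]
  intro κ W (sf : ∀ i, sections g (W i)) hsf
  have hsf' : ∀ i j, resSections g (inf_le_left : W i ⊓ W j ≤ W i) (sf i) =
      resSections g (inf_le_right : W i ⊓ W j ≤ W j) (sf j) := hsf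
  have key : ∀ a p, ∃! t : Γ(X, iSup W ⊓ V a), ∀ i,
      X.resO (inf_le_inf_right _ (le_iSup W i)) t = (sf i).1 a p := fun a p => by
    refine existsUnique_resO (fun i => W i ⊓ V a) _ _ ?_ (fun i => (sf i).1 a p) fun i j => ?_
    · rw [← iSup_inf_eq]
    · have h1 := congrArg (fun s => s.1 a p) (hsf' i j)
      have h : W i ⊓ V a ⊓ (W j ⊓ V a) ≤ W i ⊓ W j ⊓ V a :=
        le_inf (inf_le_inf inf_le_left inf_le_left) (inf_le_left.trans inf_le_right)
      have := congrArg (X.resO h) h1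
      rw [resSections_val, resSections_val, resO_resO, resO_resO] at this
      exact this
  choose t ht ht' using key
  refine ⟨show sections g (iSup W) from ⟨t, fun a b q => ?_⟩, fun i => ?_, fun s hs => ?_⟩
  · refine eq_of_resO_eq (fun i => W i ⊓ (V a ⊓ V b)) _
      (fun i => inf_le_inf_right _ (le_iSup W i)) (by rw [← iSup_inf_eq]) _ _ fun i => ?_
    have h1 := (sf i).2 a b q
    rw [← ht b q i] at h1
    rw [resO_sum_mul, resO_resO]
    rw [resO_resO] at h1
    refine h1.trans (Finset.sum_congr rfl fun p _ => ?_)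
    rw [← ht a p i, resO_resO, resO_resO, resO_resO]
  · exact sections_ext fun a p => ht a p i
  · exact sections_ext fun a p => ht' a p _ fun i => congrArg (fun s => s.1 a p)
      (show resSections g (le_iSup W i) s = sf i from hs i)

end Cocycle

open Cocycle

variable {ι : Type u} {r : ℕ} {V : ι → X.Opens} (g : ∀ a b, Fin r → Fin r → Γ(X, V a ⊓ V b))

/-- The module glued from free modules on the `V a` along the transition matrices `g`. -/
noncomputable def ofCocycle : X.Modules where
  val :=
    letI : ∀ U, Module (X.ringCatSheaf.obj.obj U) ((abPresheaf g).obj U) := fun U =>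
      inferInstanceAs (Module Γ(X, U.unop) (sections g U.unop))
    PresheafOfModules.ofPresheaf (abPresheaf g) fun U W f c s => sections_ext fun a p =>
      by
        refine (map_mul _ _ _).trans ?_
        refine congrArg (· * _) ?_
        exact (resO_resO _ _ _).trans (resO_resO _ _ _).symm
  isSheaf := isSheaf_abPresheaf

/-- The sections of a glued module. -/
noncomputable def ofCocycleSec (U : X.Opens) : sections g U ≃ₗ[Γ(X, U)] Γ(ofCocycle g, U) :=
  LinearEquiv.refl _ _

lemma res_ofCocycleSec {U W : X.Opens} (h : W ≤ U) (s : sections g U) :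
    (ofCocycle g).res h (ofCocycleSec g U s) = ofCocycleSec g W (resSections g h s) := rfl

/-- A section is a family of functions on the sets `U ⊓ V a`, so only its restrictions to the `V a`
matter, even when these do not cover `X`. For a single index this produces modules extended from an
open subset. -/
lemma isGlued_ofCocycle : IsGlued (ofCocycle g) V := by
  intro U t ht
  obtain ⟨t, rfl⟩ : ∃ t' : ∀ a, sections g (U ⊓ V a), t = fun a => ofCocycleSec g _ (t' a) :=
    ⟨t, rfl⟩
  have ht' : ∀ a b, resSections g (le_inf inf_le_left (inf_le_right.trans inf_le_left) :
        U ⊓ (V a ⊓ V b) ≤ U ⊓ V a) (t a) =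
      resSections g (le_inf inf_le_left (inf_le_right.trans inf_le_right) :
        U ⊓ (V a ⊓ V b) ≤ U ⊓ V b) (t b) := ht
  have l1 : ∀ a, U ⊓ V a ≤ U ⊓ V a ⊓ V a := fun a => le_inf le_rfl inf_le_right
  -- The component of the glued section over `V a` is the component of index `a` of `t a`.
  let s : sections g U := ⟨fun a p => X.resO (l1 a) ((t a).1 a p), fun a b q => by
    have l2 : U ⊓ (V a ⊓ V b) ≤ U ⊓ (V a ⊓ V b) ⊓ V b :=
      le_inf le_rfl (inf_le_right.trans inf_le_right)
    have l3 : U ⊓ (V a ⊓ V b) ≤ U ⊓ V a ⊓ (V a ⊓ V b) :=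
      le_inf (inf_le_inf_left _ inf_le_left) inf_le_right
    have h1 := congrArg (X.resO l2) (congrArg (fun s => s.1 b q) (ht' a b))
    have h2 := congrArg (X.resO l3) ((t a).2 a b q)
    simp only [resSections_val] at h1
    rw [resO_resO, resO_resO] at h1
    rw [resO_resO, resO_sum_mul] at h2
    rw [resO_resO, ← h1, h2]
    refine Finset.sum_congr rfl fun p _ => ?_
    rw [resO_resO, resO_resO, resO_resO]⟩
  refine ⟨ofCocycleSec g U s, fun a => ?_, fun s' hs' => ?_⟩
  · refine (res_ofCocycleSec g _ _).trans (congrArg _ (sections_ext fun b q => ?_))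
    have l2 : U ⊓ V a ⊓ V b ≤ U ⊓ (V a ⊓ V b) ⊓ V b :=
      le_inf (le_inf (inf_le_left.trans inf_le_left)
        (le_inf (inf_le_left.trans inf_le_right) inf_le_right)) inf_le_right
    have h1 := congrArg (X.resO l2) (congrArg (fun s => s.1 b q) (ht' a b))
    simp only [resSections_val] at h1
    rw [resO_resO, resO_resO] at h1
    refine (resO_resO _ _ _).trans (h1.symm.trans (resO_self _ _))
  · obtain ⟨s', rfl⟩ := (ofCocycleSec g U).surjective s'
    refine congrArg _ (sections_ext fun a p => ?_)
    have h1 : resSections g inf_le_left s' = t a := hs' a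
    have h2 := congrArg (X.resO (l1 a)) (congrArg (fun s => s.1 a p) h1)
    refine Eq.trans ?_ h2
    exact ((resO_resO _ _ _).trans (resO_self _ _)).symm

section Frames

variable (hg : ∀ a b c p q,
  X.resO (inf_le_inf_left _ inf_le_right : V a ⊓ (V b ⊓ V c) ≤ V a ⊓ V c) (g a c p q) =
    ∑ t, X.resO (inf_le_inf_left _ inf_le_left : V a ⊓ (V b ⊓ V c) ≤ V a ⊓ V b) (g a b p t) *
      X.resO inf_le_right (g b c t q))

/-- The canonical frames of a glued module. -/
noncomputable def ofCocycleFrame (a : ι) (p : Fin r) : Γ(ofCocycle g, V a) :=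
  ofCocycleSec g _ ⟨fun b q => g a b p q, fun b c q => hg a b c p q⟩

/-- The frame element has the rows `g a c p` as components, so on the component `c` this is the
cocycle relation. -/
lemma res_ofCocycleFrame (a b : ι) (p : Fin r) :
    (ofCocycle g).res inf_le_left (ofCocycleFrame g hg a p) =
      ∑ q, g a b p q • (ofCocycle g).res inf_le_right (ofCocycleFrame g hg b q) := by
  unfold ofCocycleFrame
  simp only [res_ofCocycleSec]
  rw [← Finset.sum_congr rfl fun q _ => (ofCocycleSec g _).map_smul _ _, ← map_sum]
  refine congrArg _ (sections_ext fun c q => ?_)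
  have l : V a ⊓ V b ⊓ V c ≤ V a ⊓ (V b ⊓ V c) := (inf_assoc _ _ _).le
  have := congrArg (X.resO l) (hg a b c p q)
  rw [resO_sum_mul, resO_resO] at this
  rw [AddSubgroup.val_finsetSum, Finset.sum_apply, Finset.sum_apply]
  refine this.trans (Finset.sum_congr rfl fun t _ => ?_)
  rw [smul_val, resSections_val, resO_resO, resO_resO]

/-- Over an open subset of `V a`, a section is determined by its component of index `a`, and `g a a
= 1` makes that component the vector of coordinates. -/
lemma isFrame_ofCocycleFrame (hg' : ∀ a p q, g a a p q = if p = q then 1 else 0) (a : ι) :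
    IsFrame (ofCocycle g) (V a) (ofCocycleFrame g hg a) := by
  intro U hU
  have key : ∀ (c : Fin r → Γ(X, U)) (b : ι) (q : Fin r),
      ((ofCocycleSec g U).symm
        (∑ p, c p • (ofCocycle g).res hU (ofCocycleFrame g hg a p))).1 b q =
      ∑ p, X.resO inf_le_left (c p) * X.resO (inf_le_inf_right _ hU) (g a b p q) := by
    intro c b q
    rw [map_sum, AddSubgroup.val_finsetSum, Finset.sum_apply, Finset.sum_apply]
    exact Finset.sum_congr rfl fun p _ => rfl
  have key' : ∀ (c : Fin r → Γ(X, U)) (q : Fin r),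
      ((ofCocycleSec g U).symm
        (∑ p, c p • (ofCocycle g).res hU (ofCocycleFrame g hg a p))).1 a q =
      X.resO inf_le_left (c q) := by
    intro c q
    rw [key, Finset.sum_eq_single q]
    · rw [hg', if_pos rfl, map_one, mul_one]
    · intro p _ hp
      rw [hg', if_neg hp, map_zero, mul_zero]
    · exact fun h => absurd (Finset.mem_univ q) h
  have bij := resO_bijective_of_le (inf_le_left : U ⊓ V a ≤ U) (le_inf le_rfl hU)
  constructor
  · intro c d hcd
    funext q
    apply bij.1
    rw [← key' c q, ← key' d q]
    exact congrArg (fun s => ((ofCocycleSec g U).symm s).1 a q) hcd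
  · intro s
    obtain ⟨s, rfl⟩ := (ofCocycleSec g U).surjective s
    choose c hc using fun q => bij.2 (s.1 a q)
    refine ⟨c, (ofCocycleSec g U).symm.injective (sections_ext fun b q => ?_)⟩
    rw [LinearEquiv.symm_apply_apply]
    refine (key c b q).trans ?_
    have l : U ⊓ V b ≤ U ⊓ (V a ⊓ V b) := le_inf inf_le_left (inf_le_inf_right _ hU)
    have := congrArg (X.resO l) (s.2 a b q)
    rw [resO_resO, resO_sum_mul, resO_self] at this
    rw [this]
    refine Finset.sum_congr rfl fun p _ => ?_
    rw [← hc, resO_resO, resO_resO, resO_resO]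

end Frames

end Modules

end AlgebraicGeometry.Scheme

end

/-! ### Frames by a universal property; pullback of frames; vector bundles. -/

section

namespace AlgebraicGeometry.Scheme.Modules

variable {X Y : Scheme.{u}} {M N : X.Modules} {r : ℕ}

/-- For a single open subset, gluing means that sections over `U` are the same as sections over `U ⊓
V`: the module is extended from `V`. -/
lemma isGlued_const_iff {N : X.Modules} {V : X.Opens} :
    IsGlued N (fun _ : PUnit.{u + 1} => V) ↔
      ∀ U : X.Opens, Function.Bijective (N.res (inf_le_left : U ⊓ V ≤ U)) := by
  refine ⟨fun h U => ⟨fun s t hst => h.ext fun _ => hst, fun t => ?_⟩, fun h U t _ => ?_⟩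
  · obtain ⟨s, hs, -⟩ := h U (fun _ => t) fun _ _ => rfl
    exact ⟨s, hs ⟨⟩⟩
  · obtain ⟨s, hs⟩ := (h U).2 (t ⟨⟩)
    exact ⟨s, fun _ => hs, fun s' hs' => (h U).1 ((hs' ⟨⟩).trans hs.symm)⟩

/-- A family of sections over `V` is universal if a morphism to a sheaf of modules extended from `V`
is the same thing as a family of sections of that sheaf over `V`. -/
def IsUniversal (M : X.Modules) (V : X.Opens) (e : Fin r → Γ(M, V)) : Prop :=
  ∀ N : X.Modules, IsGlued N (fun _ : PUnit.{u + 1} => V) →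
    Function.Bijective fun (φ : M ⟶ N) (p : Fin r) => sec φ V (e p)

lemma IsFrame.isUniversal {V : X.Opens} {e : Fin r → Γ(M, V)} (he : IsFrame M V e) :
    IsUniversal M V e := by
  intro N hN
  constructor
  · intro φ ψ h
    exact hom_ext_of_frames hN (fun _ => e) (fun _ => he) fun _ p => congrFun h p
  · intro σ
    obtain ⟨φ, hφ⟩ := exists_hom_of_frames hN (fun _ => e) (fun _ => he) (fun _ => σ)
      fun _ _ => ⟨fun p q => if q = p then 1 else 0, fun p => by simp, fun p => by simp⟩
    exact ⟨φ, funext fun p => hφ ⟨⟩ p⟩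

/-- The free module on `V`, extended to `X`, realized as the gluing along the identity matrix for a
one-element index set. -/
lemma exists_isFrame_isGlued (r : ℕ) (V : X.Opens) :
    ∃ (L : X.Modules) (e : Fin r → Γ(L, V)), IsGlued L (fun _ : PUnit.{u + 1} => V) ∧
      IsFrame L V e := by
  let g : ∀ _ _ : PUnit.{u + 1}, Fin r → Fin r → Γ(X, V ⊓ V) := fun _ _ p q => if p = q then 1 else 0
  have hg : ∀ (p q : Fin r) {W : X.Opens} (h : W ≤ V ⊓ V),
      X.resO h (g ⟨⟩ ⟨⟩ p q) = if p = q then 1 else 0 := by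
    intro p q W h
    simp only [g]
    split_ifs
    · exact map_one _
    · exact map_zero _
  refine ⟨ofCocycle (V := fun _ => V) g, ofCocycleFrame (V := fun _ => V) g ?_ ⟨⟩,
    isGlued_ofCocycle _, isFrame_ofCocycleFrame (V := fun _ => V) g _ (fun _ _ _ => rfl) _⟩
  intro _ _ _ p q
  simp only [hg]
  simp

section Localization

variable (M) (V : X.Opens)

/-- The sheaf of modules extended from the restriction of `M` to `V`. -/
noncomputable def loc : X.Modules := (pushforward V.ι).obj (M.restrict V.ι)

/-- The canonical morphism. -/
noncomputable def toLoc : M ⟶ M.loc V := (restrictAdjunction V.ι).unit.app M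

variable {M} in
/-- Functoriality of the extension of restrictions. -/
noncomputable def locMap (φ : M ⟶ N) : M.loc V ⟶ N.loc V :=
  (pushforward V.ι).map ((restrictFunctor V.ι).map φ)

variable {M} in
lemma toLoc_naturality (φ : M ⟶ N) : φ ≫ N.toLoc V = M.toLoc V ≫ locMap V φ :=
  (restrictAdjunction V.ι).unit.naturality φ

lemma loc_res {U W : X.Opens} (h : W ≤ U) :
    (M.loc V).res h = M.res (V.ι.image_mono (V.ι.preimage_mono h)) := rfl

lemma sec_toLoc (U : X.Opens) :
    (sec (M.toLoc V) U : Γ(M, U) → Γ(M.loc V, U)) = M.res (V.ι.image_preimage_le U) := rfl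

lemma isGlued_loc : IsGlued (M.loc V) (fun _ : PUnit.{u + 1} => V) := by
  rw [isGlued_const_iff]
  intro U
  have h : V.ι ''ᵁ V.ι ⁻¹ᵁ U ≤ V.ι ''ᵁ V.ι ⁻¹ᵁ (U ⊓ V) :=
    V.ι.image_mono (le_inf le_rfl (le_top.trans (Scheme.Opens.ι_preimage_self V).ge))
  rw [loc_res]
  exact res_bijective_of_eq _ h

lemma toLoc_bijective {U : X.Opens} (h : U ≤ V) : Function.Bijective (sec (M.toLoc V) U) := by
  rw [sec_toLoc]
  refine res_bijective_of_eq _ ?_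
  rw [Scheme.Hom.image_preimage_eq_opensRange_inf, Scheme.Opens.opensRange_ι]
  exact le_inf h le_rfl

end Localization

/-- Compare `M` with the extended free module `L` through maps `α : M ⟶ L` and `β : L ⟶ M.loc V`
given by the two universal properties. Both `α ≫ β` and `β ≫ locMap V α` are canonical maps that are
bijective over the open subsets of `V`, so `α` is bijective there by two-out-of-six and carries `e`
to the frame of `L`. -/
lemma IsUniversal.isFrame {V : X.Opens} {e : Fin r → Γ(M, V)} (he : IsUniversal M V e) :
    IsFrame M V e := by
  obtain ⟨L, e', hL, hL'⟩ := exists_isFrame_isGlued (X := X) r V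
  obtain ⟨α, hα⟩ := (he L hL).2 e'
  obtain ⟨β, hβ⟩ := (hL'.isUniversal _ (M.isGlued_loc V)).2 fun p => sec (M.toLoc V) V (e p)
  have hα' : ∀ p, sec α V (e p) = e' p := congrFun hα
  have hβ' : ∀ p, sec β V (e' p) = sec (M.toLoc V) V (e p) := congrFun hβ
  have h1 : α ≫ β = M.toLoc V := (he _ (M.isGlued_loc V)).1 (funext fun p => by
    show sec (α ≫ β) V (e p) = _
    rw [sec_comp, hα', hβ'])
  have h2 : β ≫ locMap V α = L.toLoc V :=
    (hL'.isUniversal _ (L.isGlued_loc V)).1 (funext fun p => by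
      show sec (β ≫ locMap V α) V (e' p) = sec (L.toLoc V) V (e' p)
      rw [sec_comp, hβ', ← sec_comp, ← toLoc_naturality, sec_comp, hα'])
  refine (IsFrame.of_sec_bijective α (fun U hU => ?_) e).mpr ?_
  · have b1 : Function.Bijective (sec β U ∘ sec α U) := by
      have := M.toLoc_bijective V hU
      rw [← h1] at this
      exact this
    have b2 : Function.Bijective (sec (locMap V α) U ∘ sec β U) := by
      have := L.toLoc_bijective V hU
      rw [← h2] at this
      exact this
    have b3 : Function.Bijective (sec β U) := ⟨b2.1.of_comp, b1.2.of_comp⟩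
    exact (b3.of_comp_iff' _).mp b1
  · simpa only [hα'] using hL'

/-- Frames are detected by their universal property. -/
lemma isUniversal_iff {V : X.Opens} {e : Fin r → Γ(M, V)} : IsUniversal M V e ↔ IsFrame M V e :=
  ⟨IsUniversal.isFrame, IsFrame.isUniversal⟩

/-! ### Pullback of sections -/

section Pullback

variable (f : X ⟶ Y) (P Q : Y.Modules)

/-- The pullback of sections. -/
noncomputable def pb (U : Y.Opens) : Γ(P, U) →+ Γ((pullback f).obj P, f ⁻¹ᵁ U) :=
  (sec ((pullbackPushforwardAdjunction f).unit.app P) U).toAddMonoidHom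

variable {P Q}

lemma pb_smul {U : Y.Opens} (c : Γ(Y, U)) (s : Γ(P, U)) : pb f P U (c • s) = f.app U c • pb f P U s :=
  (sec ((pullbackPushforwardAdjunction f).unit.app P) U).map_smul c s

lemma pb_res {U V : Y.Opens} (h : V ≤ U) (s : Γ(P, U)) :
    pb f P V (P.res h s) = res _ (f.preimage_mono h) (pb f P U s) :=
  sec_res ((pullbackPushforwardAdjunction f).unit.app P) h s

lemma pb_naturality (φ : P ⟶ Q) {U : Y.Opens} (s : Γ(P, U)) :
    sec ((pullback f).map φ) (f ⁻¹ᵁ U) (pb f P U s) = pb f Q U (sec φ U s) :=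
  (congrArg (fun χ => sec χ U s) ((pullbackPushforwardAdjunction f).unit.naturality φ)).symm

lemma sec_homEquiv {N : X.Modules} (φ : (pullback f).obj P ⟶ N) {U : Y.Opens} (s : Γ(P, U)) :
    sec ((pullbackPushforwardAdjunction f).homEquiv _ _ φ) U s = sec φ (f ⁻¹ᵁ U) (pb f P U s) :=
  congrArg (fun χ => sec χ U s) ((pullbackPushforwardAdjunction f).homEquiv_unit P N φ)

/-- The pullback of a frame is a frame. -/
lemma IsFrame.pullback {V : Y.Opens} {e : Fin r → Γ(P, V)} (he : IsFrame P V e) :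
    IsFrame ((pullback f).obj P) (f ⁻¹ᵁ V) fun p => pb f P V (e p) := by
  -- The universal property passes through the adjunction between pullback and pushforward, since
  -- the pushforward of a module extended from `f ⁻¹ᵁ V` is extended from `V`. No formula for the
  -- sections of a pullback is needed.
  rw [← isUniversal_iff] at he ⊢
  intro N hN
  have hN' : IsGlued ((pushforward f).obj N) (fun _ : PUnit.{u + 1} => V) := by
    rw [isGlued_const_iff] at hN ⊢
    exact fun U => hN (f ⁻¹ᵁ U)
  have key : (fun (φ : (Modules.pullback f).obj P ⟶ N) (p : Fin r) =>
        sec φ (f ⁻¹ᵁ V) (pb f P V (e p))) =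
      (fun (φ : P ⟶ (pushforward f).obj N) (p : Fin r) => sec φ V (e p)) ∘
        (pullbackPushforwardAdjunction f).homEquiv P N := by
    funext φ p
    exact (sec_homEquiv f φ (e p)).symm
  rw [key]
  exact (he _ hN').comp ((pullbackPushforwardAdjunction f).homEquiv P N).bijective

end Pullback

/-! ### Vector bundles -/

/-- Morphisms out of the free sheaf are families of global sections, and compatible families of
sections are sections over the whole space; so the canonical sections are universal. -/
lemma exists_isFrame_freeModule (r : ℕ) (X : Scheme.{u}) :
    ∃ e : Fin r → Γ(GenericBundles.freeModule r X, ⊤), IsFrame (GenericBundles.freeModule r X) ⊤ e := by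
  have ev : ∀ N : SheafOfModules X.ringCatSheaf, Function.Bijective
      fun s : N.sections => (show Γ((N : X.Modules), ⊤) from s.1 (.op ⊤)) := by
    intro N
    constructor
    · intro s t h
      refine Subtype.ext (funext fun U => ?_)
      rw [← s.2 (homOfLE le_top : U.unop ⟶ ⊤).op, ← t.2 (homOfLE le_top : U.unop ⟶ ⊤).op]
      exact congrArg _ h
    · intro s
      refine ⟨⟨fun U => res (N : X.Modules) le_top s, fun {U W} f => ?_⟩, res_self _ _⟩
      exact res_res (M := (N : X.Modules)) le_top f.unop.le s
  refine ⟨fun p => (SheafOfModules.freeSection (R := X.ringCatSheaf) (ULift.up p)).1 (.op ⊤),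
    IsUniversal.isFrame fun N _ => ?_⟩
  have h1 : Function.Bijective fun (s : ULift.{u} (Fin r) → (show SheafOfModules X.ringCatSheaf from N).sections) =>
      fun p : Fin r => (show Γ(N, ⊤) from (s (ULift.up p)).1 (.op ⊤)) := by
    have := (ev N).comp_left (α := Fin r)
    exact this.comp (Equiv.arrowCongr Equiv.ulift (Equiv.refl _)).bijective
  exact h1.comp (SheafOfModules.freeHomEquiv (show SheafOfModules X.ringCatSheaf from N)).bijective

lemma exists_iso_of_isFrame_top {e : Fin r → Γ(M, ⊤)} (he : IsFrame M ⊤ e) {e' : Fin r → Γ(N, ⊤)}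
    (he' : IsFrame N ⊤ e') : Nonempty (M ≅ N) := by
  have hG : ∀ N : X.Modules, IsGlued N (fun _ : PUnit.{u + 1} => (⊤ : X.Opens)) := fun N =>
    isGlued_of_iSup_eq_top _ _ (iSup_const)
  obtain ⟨φ, hφ⟩ := (he.isUniversal _ (hG N)).2 e'
  obtain ⟨ψ, hψ⟩ := (he'.isUniversal _ (hG M)).2 e
  refine ⟨⟨φ, ψ, (he.isUniversal _ (hG M)).1 ?_, (he'.isUniversal _ (hG N)).1 ?_⟩⟩
  · funext p
    exact (congrArg (sec ψ ⊤) (congrFun hφ p)).trans (congrFun hψ p)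
  · funext p
    exact (congrArg (sec φ ⊤) (congrFun hψ p)).trans (congrFun hφ p)

lemma IsFrame.of_restrict {V : X.Opens} {e : Fin r → Γ(M.restrict V.ι, ⊤)}
    (he : IsFrame (M.restrict V.ι) ⊤ e) :
    IsFrame M (V.ι ''ᵁ ⊤) (fun p => show Γ(M, V.ι ''ᵁ ⊤) from e p) := by
  intro U hU
  have hU' : U ≤ V := hU.trans (by rw [Scheme.Opens.ι_image_top])
  obtain ⟨W, rfl⟩ : ∃ W : V.toScheme.Opens, V.ι ''ᵁ W = U :=
    ⟨V.ι ⁻¹ᵁ U, by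
      rw [Scheme.Hom.image_preimage_eq_opensRange_inf, Scheme.Opens.opensRange_ι]
      exact inf_eq_right.mpr hU'⟩
  have h := he W le_top
  -- Functions on the open subscheme act on sections of the restriction through `appIso`.
  have key : ∀ c : Fin r → Γ(V, W), (∑ p, c p • res (M.restrict V.ι) le_top (e p)) =
      ∑ p, ((V.ι.appIso W).inv (c p)) • M.res hU (show Γ(M, V.ι ''ᵁ ⊤) from e p) := fun c => rfl
  have hb : Function.Bijective fun (c : Fin r → Γ(V, W)) (p : Fin r) => (V.ι.appIso W).inv (c p) :=
    (ConcreteCategory.bijective_of_isIso (V.ι.appIso W).inv).comp_left (α := Fin r)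
  rw [← Function.Bijective.of_comp_iff _ hb]
  exact h

/-- Vector bundles are the sheaves of modules that locally have a frame. -/
theorem isVectorBundle_iff : GenericBundles.IsVectorBundle r M ↔
    ∀ x : X, ∃ V : X.Opens, x ∈ V ∧ ∃ e : Fin r → Γ(M, V), IsFrame M V e := by
  refine forall_congr' fun x => ⟨?_, ?_⟩
  · rintro ⟨V, hx, ⟨i⟩⟩
    obtain ⟨e, he⟩ := exists_isFrame_freeModule r V.toScheme
    let j := (restrictFunctorIsoPullback V.ι).app M ≪≫ i
    have := (IsFrame.of_sec_bijective j.inv (fun U _ => sec_bijective_of_isIso _ U) e).mp he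
    exact ⟨V.ι ''ᵁ ⊤, by rwa [Scheme.Opens.ι_image_top], _, this.of_restrict⟩
  · rintro ⟨V, hx, e, he⟩
    obtain ⟨e', he'⟩ := exists_isFrame_freeModule r V.toScheme
    have h := he.pullback V.ι
    have hV : V.ι ⁻¹ᵁ V = ⊤ := Scheme.Opens.ι_preimage_self V
    exact ⟨V, hx, exists_iso_of_isFrame_top (h.mono hV.ge) he'⟩

end AlgebraicGeometry.Scheme.Modules

end

/-! ### Base change of morphisms, computed in frames. -/

section

namespace AlgebraicGeometry.Scheme.Modules

section PullbackComp

variable {X Y Z : Scheme.{u}} (f : X ⟶ Y) (g : Y ⟶ Z) (M : Z.Modules)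

/-- The composition isomorphism for pullbacks is conjugate to the one for pushforwards, so it is
compatible with the units of the adjunctions, that is, with pullback of sections. -/
lemma sec_pullbackComp_inv {U : Z.Opens} (s : Γ(M, U)) :
    sec ((pullbackComp f g).inv.app M) ((f ≫ g) ⁻¹ᵁ U) (pb (f ≫ g) M U s) =
      pb f _ (g ⁻¹ᵁ U) (pb g M U s) := by
  have h := unit_conjugateEquiv
    ((pullbackPushforwardAdjunction g).comp (pullbackPushforwardAdjunction f))
    (pullbackPushforwardAdjunction (f ≫ g)) (pullbackComp f g).inv M
  rw [conjugateEquiv_pullbackComp_inv] at h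
  have h2 := congrArg (fun χ => sec χ U s) h
  refine h2.symm.trans ?_
  rw [Adjunction.comp_unit_app]
  rfl

end PullbackComp

open GenericBundles

section BaseChange

variable {Y₁ Y₂ W W' : Scheme.{u}} {M₁ : Y₁.Modules} {M₂ : Y₂.Modules} {f₁ : W ⟶ Y₁} {f₂ : W ⟶ Y₂}

/-- Base change of a morphism between pullbacks. -/
noncomputable def baseChangeHom (φ : (pullback f₁).obj M₁ ⟶ (pullback f₂).obj M₂) (g : W' ⟶ W)
    (g₁ : W' ⟶ Y₁) (g₂ : W' ⟶ Y₂) (h₁ : g ≫ f₁ = g₁) (h₂ : g ≫ f₂ = g₂) :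
    (pullback g₁).obj M₁ ⟶ (pullback g₂).obj M₂ :=
  Pseudofunctor.LocallyDiscreteOpToCat.pullHom (F := modPull) (M₁ := M₁) (M₂ := M₂)
    φ g g₁ g₂ h₁ h₂

lemma pullIso_hom (φ : (pullback f₁).obj M₁ ≅ (pullback f₂).obj M₂) (g : W' ⟶ W)
    (g₁ : W' ⟶ Y₁) (g₂ : W' ⟶ Y₂) (h₁ : g ≫ f₁ = g₁) (h₂ : g ≫ f₂ = g₂) :
    (pullIso φ g g₁ g₂ h₁ h₂).hom = baseChangeHom φ.hom g g₁ g₂ h₁ h₂ := rfl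

/-- Unwinds the pseudofunctor, so that base change can be evaluated on pulled back sections. -/
lemma baseChangeHom_eq (φ : (pullback f₁).obj M₁ ⟶ (pullback f₂).obj M₂) (g : W' ⟶ W) :
    baseChangeHom φ g (g ≫ f₁) (g ≫ f₂) rfl rfl =
      (pullbackComp g f₁).inv.app M₁ ≫ (pullback g).map φ ≫ (pullbackComp g f₂).hom.app M₂ := by
  unfold baseChangeHom Pseudofunctor.LocallyDiscreteOpToCat.pullHom
  have e1 := modPull.mapComp'_eq_mapComp f₁.op.toLoc g.op.toLoc
  have e2 := modPull.mapComp'_eq_mapComp f₂.op.toLoc g.op.toLoc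
  refine congrArg₂ (fun a b => a ≫ (pullback g).map φ ≫ b) ?_ ?_
  · exact (congrArg (fun χ => χ.hom.toNatTrans.app M₁) e1).trans rfl
  · exact (congrArg (fun χ => χ.inv.toNatTrans.app M₂) e2).trans rfl

end BaseChange

end Modules

/-! ### Pullback of functions and sections to open subsets -/

section PullbackSections

variable {X Y Z : Scheme.{u}} (f : X ⟶ Y)

/-- The pullback of functions along a morphism. -/
noncomputable def pbO {U : Y.Opens} {V : X.Opens} (h : V ≤ f ⁻¹ᵁ U) : Γ(Y, U) →+* Γ(X, V) :=
  (f.appLE U V h).hom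

lemma resO_pbO {U : Y.Opens} {V W : X.Opens} (h : V ≤ f ⁻¹ᵁ U) (h' : W ≤ V) (s : Γ(Y, U)) :
    X.resO h' (pbO f h s) = pbO f (h'.trans h) s :=
  congrArg (fun k => k.hom s) (f.appLE_map h (homOfLE h').op)

lemma pbO_resO {U U' : Y.Opens} {V : X.Opens} (h' : U' ≤ U) (h : V ≤ f ⁻¹ᵁ U') (s : Γ(Y, U)) :
    pbO f h (Y.resO h' s) = pbO f (h.trans (f.preimage_mono h')) s :=
  congrArg (fun k => k.hom s) (f.map_appLE h (homOfLE h').op)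

lemma pbO_pbO (g : Y ⟶ Z) (k : X ⟶ Z) (e : f ≫ g = k) {U : Z.Opens} {V : Y.Opens} {W : X.Opens}
    (h : V ≤ g ⁻¹ᵁ U) (h' : W ≤ f ⁻¹ᵁ V) (s : Γ(Z, U)) :
    pbO f h' (pbO g h s) = pbO k (by subst e; exact h'.trans (f.preimage_mono h)) s := by
  subst e
  exact congrArg (fun k => k.hom s) (Scheme.Hom.appLE_comp_appLE f g U V W h h')

lemma pbO_app {U : Y.Opens} (s : Γ(Y, U)) : f.app U s = pbO f le_rfl s :=
  (congrArg (fun k => k.hom s) (f.appLE_eq_app (U := U))).symm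

namespace Modules

variable (P : Y.Modules)

/-- The pullback of sections along a morphism, restricted to an open subset. -/
noncomputable def pbr {U : Y.Opens} {V : X.Opens} (h : V ≤ f ⁻¹ᵁ U) :
    Γ(P, U) →+ Γ((pullback f).obj P, V) :=
  (res _ h).comp (pb f P U)

variable {P} {r : ℕ}

lemma pbr_def {U : Y.Opens} {V : X.Opens} (h : V ≤ f ⁻¹ᵁ U) (s : Γ(P, U)) :
    pbr f P h s = res _ h (pb f P U s) := rfl

lemma res_pbr {U : Y.Opens} {V W : X.Opens} (h : V ≤ f ⁻¹ᵁ U) (h' : W ≤ V) (s : Γ(P, U)) :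
    res _ h' (pbr f P h s) = pbr f P (h'.trans h) s :=
  res_res _ _ _

lemma pbr_res {U U' : Y.Opens} {V : X.Opens} (h' : U' ≤ U) (h : V ≤ f ⁻¹ᵁ U') (s : Γ(P, U)) :
    pbr f P h (P.res h' s) = pbr f P (h.trans (f.preimage_mono h')) s := by
  rw [pbr_def, pb_res, res_res, pbr_def]

lemma pbr_smul {U : Y.Opens} {V : X.Opens} (h : V ≤ f ⁻¹ᵁ U) (c : Γ(Y, U)) (s : Γ(P, U)) :
    pbr f P h (c • s) = pbO f h c • pbr f P h s := by
  rw [pbr_def, pb_smul, res_smul, pbO_app, resO_pbO, pbr_def]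

lemma pbr_sum_smul {U : Y.Opens} {V : X.Opens} (h : V ≤ f ⁻¹ᵁ U) (c : Fin r → Γ(Y, U))
    (s : Fin r → Γ(P, U)) :
    pbr f P h (∑ p, c p • s p) = ∑ p, pbO f h (c p) • pbr f P h (s p) := by
  rw [map_sum]
  exact Finset.sum_congr rfl fun p _ => pbr_smul f h _ _

lemma pbr_naturality {P Q : Y.Modules} (φ : P ⟶ Q) {U : Y.Opens} {V : X.Opens} (h : V ≤ f ⁻¹ᵁ U)
    (s : Γ(P, U)) : sec ((pullback f).map φ) V (pbr f P h s) = pbr f Q h (sec φ U s) := by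
  rw [pbr_def, sec_res, pb_naturality, pbr_def]

lemma IsFrame.pbr {U : Y.Opens} {V : X.Opens} (h : V ≤ f ⁻¹ᵁ U) {e : Fin r → Γ(P, U)}
    (he : IsFrame P U e) : IsFrame ((Modules.pullback f).obj P) V fun p => pbr f P h (e p) :=
  (he.pullback f).mono h

lemma IsFrame.exists_eq_self {M : X.Modules} {V : X.Opens} {e : Fin r → Γ(M, V)}
    (he : IsFrame M V e) (s : Γ(M, V)) : ∃ c : Fin r → Γ(X, V), s = ∑ p, c p • e p := by
  obtain ⟨c, hc⟩ := he.exists_eq le_rfl s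
  exact ⟨c, hc.trans (Finset.sum_congr rfl fun p _ => by rw [res_self])⟩

lemma IsFrame.ext_self {M : X.Modules} {V : X.Opens} {e : Fin r → Γ(M, V)}
    (he : IsFrame M V e) {c d : Fin r → Γ(X, V)} (h : ∑ p, c p • e p = ∑ p, d p • e p) : c = d := by
  refine he.ext le_rfl ?_
  rw [Finset.sum_congr rfl fun p _ => congrArg (c p • ·) (res_self le_rfl (e p)),
    Finset.sum_congr rfl fun p _ => congrArg (d p • ·) (res_self le_rfl (e p))]
  exact h

variable {Y₁ Y₂ W W' : Scheme.{u}} {M₁ : Y₁.Modules} {M₂ : Y₂.Modules} {f₁ : W ⟶ Y₁} {f₂ : W ⟶ Y₂}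

/-- The coordinates of a base change are the pullbacks of the coordinates. -/
lemma sec_baseChangeHom (φ : (pullback f₁).obj M₁ ⟶ (pullback f₂).obj M₂) (g : W' ⟶ W)
    (g₁ : W' ⟶ Y₁) (g₂ : W' ⟶ Y₂) (e₁ : g ≫ f₁ = g₁) (e₂ : g ≫ f₂ = g₂) {U₁ : Y₁.Opens}
    {U₂ : Y₂.Opens} {V : W.Opens} {V' : W'.Opens} (h₁ : V ≤ f₁ ⁻¹ᵁ U₁) (h₂ : V ≤ f₂ ⁻¹ᵁ U₂)
    (hV : V' ≤ g ⁻¹ᵁ V) (h₁' : V' ≤ g₁ ⁻¹ᵁ U₁) (h₂' : V' ≤ g₂ ⁻¹ᵁ U₂) (s : Γ(M₁, U₁))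
    (t : Fin r → Γ(M₂, U₂)) (c : Fin r → Γ(W, V))
    (h : sec φ V (pbr f₁ M₁ h₁ s) = ∑ p, c p • pbr f₂ M₂ h₂ (t p)) :
    sec (baseChangeHom φ g g₁ g₂ e₁ e₂) V' (pbr g₁ M₁ h₁' s) =
      ∑ p, pbO g hV (c p) • pbr g₂ M₂ h₂' (t p) := by
  subst e₁ e₂
  -- Pulling back a section along `g ≫ f` or in two steps gives corresponding sections; `key'` is
  -- the inverse direction.
  have key : ∀ {Y : Scheme.{u}} (f : W ⟶ Y) (M : Y.Modules) {U : Y.Opens} (h : V ≤ f ⁻¹ᵁ U)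
      (h' : V' ≤ (g ≫ f) ⁻¹ᵁ U) (s : Γ(M, U)),
      sec ((pullbackComp g f).inv.app M) V' (pbr (g ≫ f) M h' s) =
        pbr g _ hV (pbr f M h s) := by
    intro Y f M U h h' s
    rw [pbr_def (g ≫ f), sec_res, sec_pullbackComp_inv, pbr_def f, pbr_res, pbr_def]
    rfl
  have key' : ∀ {Y : Scheme.{u}} (f : W ⟶ Y) (M : Y.Modules) {U : Y.Opens} (h : V ≤ f ⁻¹ᵁ U)
      (h' : V' ≤ (g ≫ f) ⁻¹ᵁ U) (s : Γ(M, U)),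
      sec ((pullbackComp g f).hom.app M) V' (pbr g _ hV (pbr f M h s)) =
        pbr (g ≫ f) M h' s := by
    intro Y f M U h h' s
    rw [← key f M h h', ← sec_comp, ← NatTrans.comp_app, Iso.inv_hom_id]
    rfl
  rw [baseChangeHom_eq, sec_comp, sec_comp, key f₁ M₁ h₁ h₁']
  refine (congrArg (sec ((pullbackComp g f₂).hom.app M₂) V') (pbr_naturality g φ hV _)).trans ?_
  rw [h, pbr_sum_smul, map_sum]
  refine Finset.sum_congr rfl fun p _ => ?_
  rw [_root_.map_smul, key' f₂ M₂ h₂ h₂']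

variable (M₁ M₂ f₁ f₂ r) in
/-- A finite cover of `W` by open subsets on which `f₁^* M₁` and `f₂^* M₂` have frames that are
pulled back from `M₁` and `M₂`. -/
structure FrameCover where
  /-- The index type. -/
  ι : Type u
  finite : Finite ι
  /-- The cover. -/
  V : ι → W.Opens
  iSup_eq : ⨆ a, V a = ⊤
  /-- Opens on which `M₁` has a frame. -/
  U₁ : ι → Y₁.Opens
  /-- Opens on which `M₂` has a frame. -/
  U₂ : ι → Y₂.Opens
  le₁ : ∀ a, V a ≤ f₁ ⁻¹ᵁ U₁ a
  le₂ : ∀ a, V a ≤ f₂ ⁻¹ᵁ U₂ a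
  /-- The frames of `M₁`. -/
  e₁ : ∀ a, Fin r → Γ(M₁, U₁ a)
  /-- The frames of `M₂`. -/
  e₂ : ∀ a, Fin r → Γ(M₂, U₂ a)
  frame₁ : ∀ a, IsFrame M₁ (U₁ a) (e₁ a)
  frame₂ : ∀ a, IsFrame M₂ (U₂ a) (e₂ a)

lemma nonempty_frameCover [CompactSpace W] (h₁ : GenericBundles.IsVectorBundle r M₁)
    (h₂ : GenericBundles.IsVectorBundle r M₂) :
    Nonempty (FrameCover r M₁ M₂ f₁ f₂) := by
  rw [isVectorBundle_iff] at h₁ h₂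
  choose U₁ hU₁ e₁ he₁ using h₁
  choose U₂ hU₂ e₂ he₂ using h₂
  let V : W → W.Opens := fun x => f₁ ⁻¹ᵁ U₁ (f₁ x) ⊓ f₂ ⁻¹ᵁ U₂ (f₂ x)
  obtain ⟨t, ht⟩ := CompactSpace.elim_nhds_subcover (fun x => (V x : Set W))
    fun x => (V x).isOpen.mem_nhds ⟨hU₁ _, hU₂ _⟩
  refine ⟨⟨t, inferInstance, fun x => V x, ?_, fun x => U₁ (f₁ x), fun x => U₂ (f₂ x),
    fun x => inf_le_left, fun x => inf_le_right, fun x => e₁ _, fun x => e₂ _, fun x => he₁ _,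
    fun x => he₂ _⟩⟩
  refine top_le_iff.mp fun x _ => ?_
  obtain ⟨y, hy, hxy⟩ := Set.mem_iUnion₂.mp (ht.ge (Set.mem_univ x))
  exact Opens.mem_iSup.mpr ⟨⟨y, hy⟩, hxy⟩

end Modules

end PullbackSections

end AlgebraicGeometry.Scheme

end

/-! ### Functions on a limit of noetherian schemes. -/

section

lemma CategoryTheory.IsCofiltered.exists_forall_of_finite {C : Type*} [Category* C] [IsCofiltered C]
    {ι : Type*} [Finite ι] (Q : ι → C → Prop) (hQ : ∀ a {x y : C} (_ : x ⟶ y), Q a y → Q a x)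
    (h : ∀ a, ∃ x, Q a x) : ∃ x, ∀ a, Q a x := by
  obtain ⟨x, hx⟩ := IsFiltered.exists_forall_of_finite (C := Cᵒᵖ) (fun a x => Q a x.unop)
    (fun a x y f hx => hQ a f.unop hx) fun a => (h a).imp' Opposite.op fun _ h => h
  exact ⟨x.unop, hx⟩

namespace AlgebraicGeometry.Scheme

section Limit

variable {I : Type u} [SmallCategory I] [IsCofiltered I] (D : I ⥤ Scheme.{u}) (c : Cone D)
  (hc : IsLimit c) [∀ {i j} (f : i ⟶ j), IsAffineHom (D.map f)] [∀ i, IsNoetherian (D.obj i)]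

lemma isCompact_of_isNoetherian {X : Scheme.{u}} [IsNoetherian X] (U : X.Opens) :
    IsCompact (U : Set X) := NoetherianSpace.isCompact _

include hc in
lemma exists_pbO_eq {i : I} {U : (D.obj i).Opens} (s t : Γ(D.obj i, U))
    (h : pbO (c.π.app i) le_rfl s = pbO (c.π.app i) le_rfl t) :
    ∃ j : Over i, pbO (D.map j.hom) le_rfl s = pbO (D.map j.hom) le_rfl t := by
  simp only [← pbO_app] at h ⊢
  obtain ⟨j, f, hf⟩ := exists_app_map_eq_map_of_isLimit D c hc (isCompact_of_isNoetherian U) s t h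
  exact ⟨Over.mk f, hf⟩

omit [IsCofiltered I] [∀ {i j} (f : i ⟶ j), IsAffineHom (D.map f)] [∀ i, IsNoetherian (D.obj i)] in
lemma pbO_eq_of_hom {i : I} {j k : Over i} (f : k ⟶ j) {U : (D.obj i).Opens} {s t : Γ(D.obj i, U)}
    (h : pbO (D.map j.hom) le_rfl s = pbO (D.map j.hom) le_rfl t) :
    pbO (D.map k.hom) le_rfl s = pbO (D.map k.hom) le_rfl t := by
  have e : D.map f.left ≫ D.map j.hom = D.map k.hom := by rw [← D.map_comp, Over.w]
  have hle : D.map k.hom ⁻¹ᵁ U ≤ D.map f.left ⁻¹ᵁ D.map j.hom ⁻¹ᵁ U := by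
    rw [← e]; exact le_rfl
  have := congrArg (pbO (D.map f.left) hle) h
  rwa [pbO_pbO _ _ _ e, pbO_pbO _ _ _ e] at this

omit [IsCofiltered I] [∀ {i j} (f : i ⟶ j), IsAffineHom (D.map f)] [∀ i, IsNoetherian (D.obj i)] in
lemma preimage_le_π {i : I} (j : Over i) (U : (D.obj i).Opens) :
    c.π.app i ⁻¹ᵁ U ≤ c.π.app j.left ⁻¹ᵁ D.map j.hom ⁻¹ᵁ U := by
  rw [← c.w j.hom]; exact le_rfl

include hc in
lemma exists_pbO {i : I} {U : (D.obj i).Opens} (s : Γ(c.pt, c.π.app i ⁻¹ᵁ U)) :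
    ∃ (j : Over i) (t : Γ(D.obj j.left, D.map j.hom ⁻¹ᵁ U)),
      pbO (c.π.app j.left) (preimage_le_π D c j U) t = s := by
  have (j : Over i) : CompactSpace ((opensDiagram D i U).obj j) :=
    isCompact_iff_compactSpace.mp (isCompact_of_isNoetherian (D.map j.hom ⁻¹ᵁ U))
  have (j : Over i) : QuasiSeparatedSpace ((opensDiagram D i U).obj j) :=
    inferInstanceAs (QuasiSeparatedSpace (D.map j.hom ⁻¹ᵁ U).toScheme)
  -- The preimages of `U` form a limit diagram of their own, in which a function on `U` becomes a
  -- global function.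
  obtain ⟨j, t, ht⟩ := exists_appTop_π_eq_of_isLimit _ _ (isLimitOpensCone D c hc i U)
    ((c.π.app i ⁻¹ᵁ U).topIso.inv s)
  refine ⟨j, (D.map j.hom ⁻¹ᵁ U).topIso.hom t, ?_⟩
  have e : ((opensCone D c i U).π.app j).appTop =
      (D.map j.hom ⁻¹ᵁ U).topIso.hom ≫
        (c.π.app j.left).appLE _ _ (preimage_le_π D c j U) ≫ (c.π.app i ⁻¹ᵁ U).topIso.inv :=
    Scheme.Hom.resLE_app_top _ _
  rw [e] at ht
  have := congrArg (c.π.app i ⁻¹ᵁ U).topIso.hom.hom ht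
  refine Eq.trans ?_ (this.symm.trans ?_)
  · exact (congrArg (fun k => k.hom ((c.π.app j.left).appLE _ _ (preimage_le_π D c j U)
      ((D.map j.hom ⁻¹ᵁ U).topIso.hom t))) (c.π.app i ⁻¹ᵁ U).topIso.inv_hom_id).symm
  · exact congrArg (fun k => k.hom s) (c.π.app i ⁻¹ᵁ U).topIso.inv_hom_id

end Limit

end AlgebraicGeometry.Scheme

end

/-! ### Equality of morphisms of bundles descends. -/

section

namespace AlgebraicGeometry.Scheme.Modules

section Frames

variable {X : Scheme.{u}} {M N : X.Modules} {r : ℕ} {ι : Type*} {V : ι → X.Opens}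

lemma hom_ext_of_cover (hV : ⨆ a, V a = ⊤) (e : ∀ a, Fin r → Γ(M, V a))
    (he : ∀ a, IsFrame M (V a) (e a)) {φ ψ : M ⟶ N}
    (h : ∀ a p, sec φ (V a) (e a p) = sec ψ (V a) (e a p)) : φ = ψ :=
  hom_ext_of_frames (isGlued_of_iSup_eq_top N V hV) e he h

end Frames

section Limit

variable {I : Type u} [SmallCategory I] [IsCofiltered I] (D : I ⥤ Scheme.{u}) (c : Cone D)
  (hc : IsLimit c) [∀ {i j} (f : i ⟶ j), IsAffineHom (D.map f)] [∀ i, IsNoetherian (D.obj i)]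
  {r : ℕ} {i : I} {Y₁ Y₂ : Scheme.{u}} {f₁ : D.obj i ⟶ Y₁} {f₂ : D.obj i ⟶ Y₂}
  {M₁ : Y₁.Modules} {M₂ : Y₂.Modules}

lemma FrameCover.hom_ext {W W' : Scheme.{u}} {f₁ : W ⟶ Y₁} {f₂ : W ⟶ Y₂}
    (C : FrameCover r M₁ M₂ f₁ f₂) (g : W' ⟶ W) (g₁ : W' ⟶ Y₁)
    (l : ∀ a, g ⁻¹ᵁ C.V a ≤ g₁ ⁻¹ᵁ C.U₁ a) {N : W'.Modules} {φ ψ : (pullback g₁).obj M₁ ⟶ N}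
    (h : ∀ a p, sec φ (g ⁻¹ᵁ C.V a) (pbr g₁ M₁ (l a) (C.e₁ a p)) =
      sec ψ (g ⁻¹ᵁ C.V a) (pbr g₁ M₁ (l a) (C.e₁ a p))) : φ = ψ :=
  hom_ext_of_cover (Scheme.Hom.iSup_preimage_eq_top g C.iSup_eq)
    (fun a p => pbr g₁ M₁ (l a) (C.e₁ a p)) (fun a => (C.frame₁ a).pbr g₁ (l a)) h

/-- Two base changes agree if and only if their coordinates agree. -/
lemma baseChangeHom_eq_iff {W W' : Scheme.{u}} {f₁ : W ⟶ Y₁} {f₂ : W ⟶ Y₂}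
    (C : FrameCover r M₁ M₂ f₁ f₂) (φ ψ : (pullback f₁).obj M₁ ⟶ (pullback f₂).obj M₂)
    (k l : ∀ a, Fin r → Fin r → Γ(W, C.V a))
    (hk : ∀ a p, sec φ (C.V a) (pbr f₁ M₁ (C.le₁ a) (C.e₁ a p)) =
      ∑ q, k a p q • pbr f₂ M₂ (C.le₂ a) (C.e₂ a q))
    (hl : ∀ a p, sec ψ (C.V a) (pbr f₁ M₁ (C.le₁ a) (C.e₁ a p)) =
      ∑ q, l a p q • pbr f₂ M₂ (C.le₂ a) (C.e₂ a q))
    (g : W' ⟶ W) (g₁ : W' ⟶ Y₁) (g₂ : W' ⟶ Y₂) (h₁ : g ≫ f₁ = g₁) (h₂ : g ≫ f₂ = g₂) :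
    baseChangeHom φ g g₁ g₂ h₁ h₂ = baseChangeHom ψ g g₁ g₂ h₁ h₂ ↔
      ∀ a p q, pbO g le_rfl (k a p q) = pbO g le_rfl (l a p q) := by
  have l1 : ∀ a, g ⁻¹ᵁ C.V a ≤ g₁ ⁻¹ᵁ C.U₁ a := fun a => by
    subst h₁; exact g.preimage_mono (C.le₁ a)
  have l2 : ∀ a, g ⁻¹ᵁ C.V a ≤ g₂ ⁻¹ᵁ C.U₂ a := fun a => by
    subst h₂; exact g.preimage_mono (C.le₂ a)
  have e1 := fun a p => sec_baseChangeHom φ g g₁ g₂ h₁ h₂ _ (C.le₂ a) le_rfl (l1 a) (l2 a) _ _ _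
    (hk a p)
  have e2 := fun a p => sec_baseChangeHom ψ g g₁ g₂ h₁ h₂ _ (C.le₂ a) le_rfl (l1 a) (l2 a) _ _ _
    (hl a p)
  constructor
  · intro h a p q
    have := e1 a p
    rw [h, e2] at this
    exact congrFun (((C.frame₂ a).pbr g₂ (l2 a)).ext_self this).symm q
  · intro h
    refine C.hom_ext g g₁ l1 fun a p => ?_
    rw [e1, e2]
    exact Finset.sum_congr rfl fun q _ => by rw [h a p q]

lemma FrameCover.exists_coords {W : Scheme.{u}} {f₁ : W ⟶ Y₁} {f₂ : W ⟶ Y₂}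
    (C : FrameCover r M₁ M₂ f₁ f₂) (φ : (pullback f₁).obj M₁ ⟶ (pullback f₂).obj M₂) :
    ∃ k : ∀ a, Fin r → Fin r → Γ(W, C.V a), ∀ a p,
      sec φ (C.V a) (pbr f₁ M₁ (C.le₁ a) (C.e₁ a p)) =
        ∑ q, k a p q • pbr f₂ M₂ (C.le₂ a) (C.e₂ a q) := by
  choose k hk using fun (a : C.ι) (p : Fin r) => ((C.frame₂ a).pbr f₂ (C.le₂ a)).exists_eq_self
    (sec φ (C.V a) (pbr f₁ M₁ (C.le₁ a) (C.e₁ a p)))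
  exact ⟨k, hk⟩

include hc in
/-- Two morphisms that agree over the limit agree at some stage. -/
theorem exists_baseChangeHom_eq (hM₁ : GenericBundles.IsVectorBundle r M₁)
    (hM₂ : GenericBundles.IsVectorBundle r M₂) (φ ψ : (pullback f₁).obj M₁ ⟶ (pullback f₂).obj M₂)
    (h : baseChangeHom φ (c.π.app i) _ _ rfl rfl = baseChangeHom ψ (c.π.app i) _ _ rfl rfl) :
    ∃ j : Over i, baseChangeHom φ (D.map j.hom) _ _ rfl rfl =
      baseChangeHom ψ (D.map j.hom) _ _ rfl rfl := by
  obtain ⟨C⟩ := nonempty_frameCover (f₁ := f₁) (f₂ := f₂) hM₁ hM₂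
  have := C.finite
  obtain ⟨k, hk⟩ := C.exists_coords φ
  obtain ⟨l, hl⟩ := C.exists_coords ψ
  have key := (baseChangeHom_eq_iff C φ ψ k l hk hl (c.π.app i) _ _ rfl rfl).mp h
  -- The two morphisms agree exactly when finitely many matrix entries do, and each of these
  -- equations holds at some stage.
  obtain ⟨j, hj⟩ := IsCofiltered.exists_forall_of_finite
    (fun (x : C.ι × Fin r × Fin r) (j : Over i) =>
      pbO (D.map j.hom) le_rfl (k x.1 x.2.1 x.2.2) = pbO (D.map j.hom) le_rfl (l x.1 x.2.1 x.2.2))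
    (fun x _ _ f h => pbO_eq_of_hom D f h) fun x => exists_pbO_eq D c hc _ _ (key _ _ _)
  exact ⟨j, (baseChangeHom_eq_iff C φ ψ k l hk hl (D.map j.hom) _ _ rfl rfl).mpr
    fun a p q => hj (a, p, q)⟩

end Limit

end AlgebraicGeometry.Scheme.Modules

end

/-! ### Matrices that define a morphism of bundles. -/

section

namespace AlgebraicGeometry.Scheme.Modules

variable {r : ℕ} {Y Y₁ Y₂ W W' : Scheme.{u}} {M : Y.Modules} {M₁ : Y₁.Modules} {M₂ : Y₂.Modules}

lemma baseChangeHom_id {f : W ⟶ Y} (g : W' ⟶ W) (g₁ : W' ⟶ Y) (h : g ≫ f = g₁) :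
    baseChangeHom (𝟙 ((pullback f).obj M)) g g₁ g₁ h h = 𝟙 _ :=
  GenericBundles.pullHom_refl (F := GenericBundles.modPull) (M₁ := M) (f₁ := f) g g₁ h

/-- `sec_baseChangeHom` for the identity: relations between pulled back sections, such as transition
matrices, persist under further pullback. -/
lemma pbr_eq_sum {f : W ⟶ Y} (g : W' ⟶ W) (g₁ : W' ⟶ Y) (e : g ≫ f = g₁) {U₁ U₂ : Y.Opens}
    {V : W.Opens} {V' : W'.Opens} (h₁ : V ≤ f ⁻¹ᵁ U₁) (h₂ : V ≤ f ⁻¹ᵁ U₂)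
    (hV : V' ≤ g ⁻¹ᵁ V) (h₁' : V' ≤ g₁ ⁻¹ᵁ U₁) (h₂' : V' ≤ g₁ ⁻¹ᵁ U₂) (s : Γ(M, U₁))
    (t : Fin r → Γ(M, U₂)) (c : Fin r → Γ(W, V))
    (h : pbr f M h₁ s = ∑ p, c p • pbr f M h₂ (t p)) :
    pbr g₁ M h₁' s = ∑ p, pbO g hV (c p) • pbr g₁ M h₂' (t p) := by
  have := sec_baseChangeHom (𝟙 ((pullback f).obj M)) g g₁ g₁ e e h₁ h₂ hV h₁' h₂' s t c h
  rw [baseChangeHom_id, sec_id] at this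
  exact this

lemma sum_smul_sum_smul {X : Scheme.{u}} {N : X.Modules} {U : X.Opens} (c : Fin r → Γ(X, U))
    (k : Fin r → Fin r → Γ(X, U)) (n : Fin r → Γ(N, U)) :
    ∑ p, c p • ∑ q, k p q • n q = ∑ q, (∑ p, c p * k p q) • n q := by
  simp only [Finset.smul_sum, smul_smul, Finset.sum_smul]
  exact Finset.sum_comm

namespace FrameCover

variable {f₁ : W ⟶ Y₁} {f₂ : W ⟶ Y₂} (C : FrameCover r M₁ M₂ f₁ f₂)

/-- The matrices of a morphism are compatible with the transition matrices of the frames. -/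
def Compat (m m' : ∀ a b, Fin r → Fin r → Γ(W, C.V a ⊓ C.V b)) (g : W' ⟶ W)
    (k : ∀ a, Fin r → Fin r → Γ(W', g ⁻¹ᵁ C.V a)) : Prop :=
  ∀ a b p q, ∑ t, pbO g (le_refl (g ⁻¹ᵁ (C.V a ⊓ C.V b))) (m a b p t) *
      W'.resO (g.preimage_mono inf_le_left) (k a t q) =
    ∑ t, W'.resO (g.preimage_mono inf_le_right) (k b p t) *
      pbO g (le_refl (g ⁻¹ᵁ (C.V a ⊓ C.V b))) (m' a b t q)

lemma exists_transition₁ : ∃ m : ∀ a b, Fin r → Fin r → Γ(W, C.V a ⊓ C.V b), ∀ a b p,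
    pbr f₁ M₁ (inf_le_right.trans (C.le₁ b)) (C.e₁ b p) =
      ∑ q, m a b p q • pbr f₁ M₁ (inf_le_left.trans (C.le₁ a)) (C.e₁ a q) := by
  choose m hm using fun a b p => ((C.frame₁ a).pbr f₁ ((inf_le_left :
    C.V a ⊓ C.V b ≤ _).trans (C.le₁ a))).exists_eq_self
      (pbr f₁ M₁ (inf_le_right.trans (C.le₁ b)) (C.e₁ b p))
  exact ⟨m, hm⟩

lemma exists_transition₂ : ∃ m : ∀ a b, Fin r → Fin r → Γ(W, C.V a ⊓ C.V b), ∀ a b p,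
    pbr f₂ M₂ (inf_le_right.trans (C.le₂ b)) (C.e₂ b p) =
      ∑ q, m a b p q • pbr f₂ M₂ (inf_le_left.trans (C.le₂ a)) (C.e₂ a q) := by
  choose m hm using fun a b p => ((C.frame₂ a).pbr f₂ ((inf_le_left :
    C.V a ⊓ C.V b ≤ _).trans (C.le₂ a))).exists_eq_self
      (pbr f₂ M₂ (inf_le_right.trans (C.le₂ b)) (C.e₂ b p))
  exact ⟨m, hm⟩

section Gluing

variable {C} {m m' : ∀ a b, Fin r → Fin r → Γ(W, C.V a ⊓ C.V b)}
  (hm : ∀ a b p, pbr f₁ M₁ (inf_le_right.trans (C.le₁ b)) (C.e₁ b p) =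
    ∑ q, m a b p q • pbr f₁ M₁ (inf_le_left.trans (C.le₁ a)) (C.e₁ a q))
  (hm' : ∀ a b p, pbr f₂ M₂ (inf_le_right.trans (C.le₂ b)) (C.e₂ b p) =
    ∑ q, m' a b p q • pbr f₂ M₂ (inf_le_left.trans (C.le₂ a)) (C.e₂ a q))
  (g : W' ⟶ W) (g₁ : W' ⟶ Y₁) (g₂ : W' ⟶ Y₂) (h₁ : g ≫ f₁ = g₁) (h₂ : g ≫ f₂ = g₂)
  (l₁ : ∀ a, g ⁻¹ᵁ C.V a ≤ g₁ ⁻¹ᵁ C.U₁ a) (l₂ : ∀ a, g ⁻¹ᵁ C.V a ≤ g₂ ⁻¹ᵁ C.U₂ a)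
  (k : ∀ a, Fin r → Fin r → Γ(W', g ⁻¹ᵁ C.V a))

include hm hm' h₁ h₂ in
-- Over the overlap, the image of the frame element of index `b` is expanded in the target frame of
-- index `a` in two ways: changing the frame before or after applying `φ`.
lemma compat_of_hom (φ : (pullback g₁).obj M₁ ⟶ (pullback g₂).obj M₂)
    (hk : ∀ a p, sec φ (g ⁻¹ᵁ C.V a) (pbr g₁ M₁ (l₁ a) (C.e₁ a p)) =
      ∑ q, k a p q • pbr g₂ M₂ (l₂ a) (C.e₂ a q)) : C.Compat m m' g k := by
  intro a b p q
  set V := g ⁻¹ᵁ (C.V a ⊓ C.V b)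
  have ia : V ≤ g ⁻¹ᵁ C.V a := g.preimage_mono inf_le_left
  have ib : V ≤ g ⁻¹ᵁ C.V b := g.preimage_mono inf_le_right
  have t₁ := pbr_eq_sum g g₁ h₁ _ _ le_rfl (ib.trans (l₁ b)) (ia.trans (l₁ a)) _ _ _ (hm a b p)
  have t₂ := fun t => pbr_eq_sum g g₂ h₂ _ _ le_rfl (ib.trans (l₂ b)) (ia.trans (l₂ a)) _ _ _
    (hm' a b t)
  have hka : ∀ t, sec φ V (pbr g₁ M₁ (ia.trans (l₁ a)) (C.e₁ a t)) =
      ∑ q, W'.resO ia (k a t q) • pbr g₂ M₂ (ia.trans (l₂ a)) (C.e₂ a q) := fun t => by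
    rw [← res_pbr g₁ (l₁ a) ia, sec_res, hk, res_sum_smul]
    simp only [res_pbr]
  have hkb : sec φ V (pbr g₁ M₁ (ib.trans (l₁ b)) (C.e₁ b p)) =
      ∑ q, W'.resO ib (k b p q) • pbr g₂ M₂ (ib.trans (l₂ b)) (C.e₂ b q) := by
    rw [← res_pbr g₁ (l₁ b) ib, sec_res, hk, res_sum_smul]
    simp only [res_pbr]
  rw [t₁, map_sum] at hkb
  simp only [_root_.map_smul, hka, t₂, sum_smul_sum_smul] at hkb
  exact congrFun (((C.frame₂ a).pbr g₂ (ia.trans (l₂ a))).ext_self hkb) q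

include hm hm' h₁ h₂ in
lemma exists_hom_of_compat (hk : C.Compat m m' g k) :
    ∃ φ : (pullback g₁).obj M₁ ⟶ (pullback g₂).obj M₂, ∀ a p,
      sec φ (g ⁻¹ᵁ C.V a) (pbr g₁ M₁ (l₁ a) (C.e₁ a p)) =
        ∑ q, k a p q • pbr g₂ M₂ (l₂ a) (C.e₂ a q) := by
  refine exists_hom_of_frames (V := fun a => g ⁻¹ᵁ C.V a)
    (isGlued_of_iSup_eq_top _ _ (Scheme.Hom.iSup_preimage_eq_top g C.iSup_eq))
    (fun a p => pbr g₁ M₁ (l₁ a) (C.e₁ a p)) (fun a => (C.frame₁ a).pbr g₁ (l₁ a))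
    (fun a p => ∑ q, k a p q • pbr g₂ M₂ (l₂ a) (C.e₂ a q)) fun a b => ?_
  have ia : g ⁻¹ᵁ (C.V a ⊓ C.V b) ≤ g ⁻¹ᵁ C.V a := g.preimage_mono inf_le_left
  have ib : g ⁻¹ᵁ (C.V a ⊓ C.V b) ≤ g ⁻¹ᵁ C.V b := g.preimage_mono inf_le_right
  have t₁ := fun p => pbr_eq_sum g g₁ h₁ _ _ (le_refl (g ⁻¹ᵁ (C.V a ⊓ C.V b)))
    (ib.trans (l₁ b)) (ia.trans (l₁ a)) _ _ _ (hm a b p)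
  have t₂ := fun t => pbr_eq_sum g g₂ h₂ _ _ (le_refl (g ⁻¹ᵁ (C.V a ⊓ C.V b)))
    (ib.trans (l₂ b)) (ia.trans (l₂ a)) _ _ _ (hm' a b t)
  have t₃ : ∀ p, res ((pullback g₂).obj M₂) ib (∑ q, k b p q • pbr g₂ M₂ (l₂ b) (C.e₂ b q)) =
      ∑ q, pbO g (le_refl (g ⁻¹ᵁ (C.V a ⊓ C.V b))) (m a b p q) •
        res _ ia (∑ t, k a q t • pbr g₂ M₂ (l₂ a) (C.e₂ a t)) := fun p => by
    simp only [res_sum_smul, res_pbr, t₂, sum_smul_sum_smul]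
    exact Finset.sum_congr rfl fun q _ => congrArg (· • _) (hk a b p q).symm
  refine ⟨fun p q => pbO g (le_refl (g ⁻¹ᵁ (C.V a ⊓ C.V b))) (m a b p q), fun p => ?_, t₃⟩
  refine (res_pbr g₁ (l₁ b) ib _).trans ((t₁ p).trans (Finset.sum_congr rfl fun q _ => ?_))
  exact congrArg (_ • ·) (res_pbr g₁ (l₁ a) ia _).symm

end Gluing

end FrameCover

end AlgebraicGeometry.Scheme.Modules

end

/-! ### Morphisms of bundles over the limit come from a stage. -/

section

namespace AlgebraicGeometry.Scheme.Modules

section Limit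

variable {I : Type u} [SmallCategory I] [IsCofiltered I] (D : I ⥤ Scheme.{u}) (c : Cone D)
  (hc : IsLimit c) [∀ {i j} (f : i ⟶ j), IsAffineHom (D.map f)] [∀ i, IsNoetherian (D.obj i)]
  {r : ℕ} {i : I} {Y₁ Y₂ : Scheme.{u}} {f₁ : D.obj i ⟶ Y₁} {f₂ : D.obj i ⟶ Y₂}
  {M₁ : Y₁.Modules} {M₂ : Y₂.Modules}

include hc in
/-- A finite family of functions over the limit comes from some stage. -/
lemma exists_pbO_family {κ : Type*} [Finite κ] (U : κ → (D.obj i).Opens)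
    (s : ∀ x, Γ(c.pt, c.π.app i ⁻¹ᵁ U x)) :
    ∃ (j : Over i) (t : ∀ x, Γ(D.obj j.left, D.map j.hom ⁻¹ᵁ U x)),
      ∀ x, pbO (c.π.app j.left) (preimage_le_π D c j (U x)) (t x) = s x := by
  obtain ⟨j, hj⟩ := IsCofiltered.exists_forall_of_finite
    (fun (x : κ) (j : Over i) => ∃ t : Γ(D.obj j.left, D.map j.hom ⁻¹ᵁ U x),
      pbO (c.π.app j.left) (preimage_le_π D c j (U x)) t = s x)
    (fun x j j' f ⟨t, ht⟩ => by
      have e : D.map f.left ≫ D.map j'.hom = D.map j.hom := by rw [← D.map_comp, Over.w]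
      have hle : D.map j.hom ⁻¹ᵁ U x ≤ D.map f.left ⁻¹ᵁ D.map j'.hom ⁻¹ᵁ U x := by
        rw [← e]; exact le_rfl
      refine ⟨pbO (D.map f.left) hle t, ?_⟩
      rw [pbO_pbO _ _ _ (c.w f.left)]
      exact ht) fun x => exists_pbO D c hc (s x)
  choose t ht using hj
  exact ⟨j, t, ht⟩

include hc in
/-- A finite family of equations between functions holds at some stage if it holds over the
limit. -/
lemma exists_pbO_eq_family {κ : Type*} [Finite κ] (U : κ → (D.obj i).Opens)
    (s t : ∀ x, Γ(D.obj i, U x))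
    (h : ∀ x, pbO (c.π.app i) le_rfl (s x) = pbO (c.π.app i) le_rfl (t x)) :
    ∃ j : Over i, ∀ x, pbO (D.map j.hom) le_rfl (s x) = pbO (D.map j.hom) le_rfl (t x) :=
  IsCofiltered.exists_forall_of_finite _ (fun _ _ _ f h => pbO_eq_of_hom D f h)
    fun x => exists_pbO_eq D c hc _ _ (h x)

/-- Writes compatibility after a further pullback as equality of pulled back functions, the form in
which equations descend along the limit. -/
lemma FrameCover.compat_iff {W W' : Scheme.{u}} {f₁ : W ⟶ Y₁} {f₂ : W ⟶ Y₂}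
    (C : FrameCover r M₁ M₂ f₁ f₂) (m m' : ∀ a b, Fin r → Fin r → Γ(W, C.V a ⊓ C.V b))
    (g : W' ⟶ W) (k : ∀ a, Fin r → Fin r → Γ(W', g ⁻¹ᵁ C.V a)) {W'' : Scheme.{u}}
    (h : W'' ⟶ W') (gh : W'' ⟶ W) (e : h ≫ g = gh)
    (l : ∀ a, gh ⁻¹ᵁ C.V a ≤ h ⁻¹ᵁ g ⁻¹ᵁ C.V a) :
    C.Compat m m' gh (fun a p q => pbO h (l a) (k a p q)) ↔ ∀ a b p q,
      pbO h (le_refl (h ⁻¹ᵁ g ⁻¹ᵁ (C.V a ⊓ C.V b)))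
        (∑ t, pbO g (le_refl (g ⁻¹ᵁ (C.V a ⊓ C.V b))) (m a b p t) *
          W'.resO (g.preimage_mono inf_le_left) (k a t q)) =
      pbO h (le_refl (h ⁻¹ᵁ g ⁻¹ᵁ (C.V a ⊓ C.V b)))
        (∑ t, W'.resO (g.preimage_mono inf_le_right) (k b p t) *
          pbO g (le_refl (g ⁻¹ᵁ (C.V a ⊓ C.V b))) (m' a b t q)) := by
  subst e
  refine forall₄_congr fun a b p q => ?_
  simp only [map_sum, map_mul, pbO_pbO h g _ rfl, resO_pbO, pbO_resO]
  rfl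

include hc in
/-- A morphism over the limit comes from some stage. -/
theorem exists_baseChangeHom (hM₁ : GenericBundles.IsVectorBundle r M₁)
    (hM₂ : GenericBundles.IsVectorBundle r M₂)
    (φ : (pullback (c.π.app i ≫ f₁)).obj M₁ ⟶ (pullback (c.π.app i ≫ f₂)).obj M₂) :
    ∃ (j : Over i) (φ' : (pullback (D.map j.hom ≫ f₁)).obj M₁ ⟶
      (pullback (D.map j.hom ≫ f₂)).obj M₂),
      baseChangeHom φ' (c.π.app j.left) _ _ (by rw [← Category.assoc, c.w])
        (by rw [← Category.assoc, c.w]) = φ := by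
  obtain ⟨C⟩ := nonempty_frameCover (f₁ := f₁) (f₂ := f₂) hM₁ hM₂
  have := C.finite
  obtain ⟨m, hm⟩ := C.exists_transition₁
  obtain ⟨m', hm'⟩ := C.exists_transition₂
  have l₁ : ∀ a, c.π.app i ⁻¹ᵁ C.V a ≤ (c.π.app i ≫ f₁) ⁻¹ᵁ C.U₁ a := fun a =>
    (c.π.app i).preimage_mono (C.le₁ a)
  have l₂ : ∀ a, c.π.app i ⁻¹ᵁ C.V a ≤ (c.π.app i ≫ f₂) ⁻¹ᵁ C.U₂ a := fun a =>
    (c.π.app i).preimage_mono (C.le₂ a)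
  choose k₀ hk₀ using fun a p => ((C.frame₂ a).pbr _ (l₂ a)).exists_eq_self
    (sec φ (c.π.app i ⁻¹ᵁ C.V a) (pbr _ M₁ (l₁ a) (C.e₁ a p)))
  have hC₀ := FrameCover.compat_of_hom hm hm' (c.π.app i) _ _ rfl rfl l₁ l₂ k₀ φ hk₀
  -- Two passages to a later stage: the matrix entries are lifted to the stage `j`, and then their
  -- compatibility, so far known only over the limit, is made to hold at a further stage `l`.
  obtain ⟨j, k₁, hk₁⟩ := exists_pbO_family D c hc
    (fun x : C.ι × Fin r × Fin r => C.V x.1) fun x => k₀ x.1 x.2.1 x.2.2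
  let k : ∀ a, Fin r → Fin r → Γ(D.obj j.left, D.map j.hom ⁻¹ᵁ C.V a) := fun a p q => k₁ (a, p, q)
  have hk : k₀ = fun a p q => pbO (c.π.app j.left) (preimage_le_π D c j _) (k a p q) :=
    funext fun a => funext fun p => funext fun q => (hk₁ (a, p, q)).symm
  rw [hk, FrameCover.compat_iff C m m' (D.map j.hom) k (c.π.app j.left) _ (c.w j.hom)] at hC₀
  obtain ⟨l, hl⟩ := exists_pbO_eq_family D c hc
    (fun x : C.ι × C.ι × Fin r × Fin r => D.map j.hom ⁻¹ᵁ (C.V x.1 ⊓ C.V x.2.1)) _ _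
    fun x => hC₀ x.1 x.2.1 x.2.2.1 x.2.2.2
  have e : D.map l.hom ≫ D.map j.hom = D.map (l.hom ≫ j.hom) := (D.map_comp _ _).symm
  have hle : ∀ a, D.map (l.hom ≫ j.hom) ⁻¹ᵁ C.V a ≤ D.map l.hom ⁻¹ᵁ D.map j.hom ⁻¹ᵁ C.V a :=
    fun a => by rw [← e]; exact le_rfl
  have hC := (FrameCover.compat_iff C m m' (D.map j.hom) k (D.map l.hom) _ e hle).mpr
    fun a b p q => hl (a, b, p, q)
  have l₁' : ∀ a, D.map (l.hom ≫ j.hom) ⁻¹ᵁ C.V a ≤ (D.map (l.hom ≫ j.hom) ≫ f₁) ⁻¹ᵁ C.U₁ a :=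
    fun a => (D.map (l.hom ≫ j.hom)).preimage_mono (C.le₁ a)
  have l₂' : ∀ a, D.map (l.hom ≫ j.hom) ⁻¹ᵁ C.V a ≤ (D.map (l.hom ≫ j.hom) ≫ f₂) ⁻¹ᵁ C.U₂ a :=
    fun a => (D.map (l.hom ≫ j.hom)).preimage_mono (C.le₂ a)
  obtain ⟨φ', hφ'⟩ := FrameCover.exists_hom_of_compat hm hm' (D.map (l.hom ≫ j.hom)) _ _ rfl rfl
    l₁' l₂' _ hC
  refine ⟨Over.mk (l.hom ≫ j.hom), φ', ?_⟩
  refine C.hom_ext (c.π.app i) _ l₁ fun a p => ?_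
  have hV : c.π.app i ⁻¹ᵁ C.V a ≤ c.π.app l.left ⁻¹ᵁ D.map (l.hom ≫ j.hom) ⁻¹ᵁ C.V a :=
    preimage_le_π D c (Over.mk (l.hom ≫ j.hom)) _
  refine (sec_baseChangeHom φ' (c.π.app l.left) _ _ _ _ _ (l₂' a) hV _ (l₂ a) _ _ _
    (hφ' a p)).trans ?_
  rw [hk₀]
  refine Finset.sum_congr rfl fun q _ => congrArg (· • _) ?_
  rw [hk, pbO_pbO _ _ _ (c.w l.hom)]

end Limit

end AlgebraicGeometry.Scheme.Modules

end

/-! ### Isomorphisms of bundles descend. -/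

section

namespace AlgebraicGeometry.Scheme.Modules

open GenericBundles

section BaseChange

variable {Y₁ Y₂ Y₃ W W' W'' : Scheme.{u}} {M₁ : Y₁.Modules} {M₂ : Y₂.Modules} {M₃ : Y₃.Modules}
  {f₁ : W ⟶ Y₁} {f₂ : W ⟶ Y₂} {f₃ : W ⟶ Y₃}

lemma baseChangeHom_comp (φ : (pullback f₁).obj M₁ ⟶ (pullback f₂).obj M₂)
    (ψ : (pullback f₂).obj M₂ ⟶ (pullback f₃).obj M₃) (g : W' ⟶ W) (g₁ : W' ⟶ Y₁)
    (g₂ : W' ⟶ Y₂) (g₃ : W' ⟶ Y₃) (h₁ : g ≫ f₁ = g₁) (h₂ : g ≫ f₂ = g₂) (h₃ : g ≫ f₃ = g₃) :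
    baseChangeHom (φ ≫ ψ) g g₁ g₃ h₁ h₃ =
      baseChangeHom φ g g₁ g₂ h₁ h₂ ≫ baseChangeHom ψ g g₂ g₃ h₂ h₃ :=
  pullHom_comp (F := modPull) (M₁ := M₁) (M₂ := M₂) (M₃ := M₃) φ ψ g g₁ g₂ g₃ h₁ h₂ h₃

lemma baseChangeHom_baseChangeHom (φ : (pullback f₁).obj M₁ ⟶ (pullback f₂).obj M₂) (g : W' ⟶ W)
    (g₁ : W' ⟶ Y₁) (g₂ : W' ⟶ Y₂) (h₁ : g ≫ f₁ = g₁) (h₂ : g ≫ f₂ = g₂) (g' : W'' ⟶ W')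
    (g₁' : W'' ⟶ Y₁) (g₂' : W'' ⟶ Y₂) (h₁' : g' ≫ g₁ = g₁') (h₂' : g' ≫ g₂ = g₂') (e : W'' ⟶ W)
    (he : g' ≫ g = e) :
    baseChangeHom (baseChangeHom φ g g₁ g₂ h₁ h₂) g' g₁' g₂' h₁' h₂' =
      baseChangeHom φ e g₁' g₂' (by rw [← he, Category.assoc, h₁, h₁'])
        (by rw [← he, Category.assoc, h₂, h₂']) := by
  subst he
  exact Pseudofunctor.LocallyDiscreteOpToCat.pullHom_pullHom
    (F := modPull) (M₁ := M₁) (M₂ := M₂) φ g g₁ g₂ g' g₁' g₂' h₁ h₂ h₁' h₂'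

end BaseChange

section Limit

variable {I : Type u} [SmallCategory I] [IsCofiltered I] (D : I ⥤ Scheme.{u}) (c : Cone D)
  (hc : IsLimit c) [∀ {i j} (f : i ⟶ j), IsAffineHom (D.map f)] [∀ i, IsNoetherian (D.obj i)]
  {r : ℕ} {i : I} {Y₁ Y₂ : Scheme.{u}} {f₁ : D.obj i ⟶ Y₁} {f₂ : D.obj i ⟶ Y₂}
  {M₁ : Y₁.Modules} {M₂ : Y₂.Modules}

include hc in
/-- Two isomorphisms that agree over the limit agree at some stage. -/
theorem exists_pullIso_eq (hM₁ : IsVectorBundle r M₁) (hM₂ : IsVectorBundle r M₂)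
    (φ ψ : (pullback f₁).obj M₁ ≅ (pullback f₂).obj M₂)
    (h : pullIso φ (c.π.app i) _ _ rfl rfl = pullIso ψ (c.π.app i) _ _ rfl rfl) :
    ∃ j : Over i, pullIso φ (D.map j.hom) _ _ rfl rfl = pullIso ψ (D.map j.hom) _ _ rfl rfl := by
  obtain ⟨j, hj⟩ := exists_baseChangeHom_eq D c hc hM₁ hM₂ φ.hom ψ.hom (congrArg Iso.hom h)
  exact ⟨j, Iso.ext hj⟩

include hc in
/-- A retraction over the limit is a retraction at some stage. -/
lemma exists_comp_eq_id (hM₁ : IsVectorBundle r M₁)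
    (φ : (pullback f₁).obj M₁ ⟶ (pullback f₂).obj M₂)
    (ψ : (pullback f₂).obj M₂ ⟶ (pullback f₁).obj M₁)
    (h : baseChangeHom φ (c.π.app i) _ _ rfl rfl ≫ baseChangeHom ψ (c.π.app i) _ _ rfl rfl = 𝟙 _) :
    ∃ j : Over i, baseChangeHom φ (D.map j.hom) _ _ rfl rfl ≫
      baseChangeHom ψ (D.map j.hom) _ _ rfl rfl = 𝟙 _ := by
  obtain ⟨j, hj⟩ := exists_baseChangeHom_eq D c hc hM₁ hM₁ (φ ≫ ψ) (𝟙 _)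
    ((baseChangeHom_comp φ ψ _ _ _ _ rfl rfl rfl).trans (h.trans (baseChangeHom_id _ _ rfl).symm))
  exact ⟨j, (baseChangeHom_comp φ ψ _ _ _ _ rfl rfl rfl).symm.trans
    (hj.trans (baseChangeHom_id _ _ rfl))⟩

omit [IsCofiltered I] [∀ {i j} (f : i ⟶ j), IsAffineHom (D.map f)] [∀ i, IsNoetherian (D.obj i)] in
lemma comp_eq_id_of_hom {i : I} {f₁ : D.obj i ⟶ Y₁} {f₂ : D.obj i ⟶ Y₂}
    (φ : (pullback f₁).obj M₁ ⟶ (pullback f₂).obj M₂)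
    (ψ : (pullback f₂).obj M₂ ⟶ (pullback f₁).obj M₁) {j k : Over i} (u : k ⟶ j)
    (h : baseChangeHom φ (D.map j.hom) _ _ rfl rfl ≫
      baseChangeHom ψ (D.map j.hom) _ _ rfl rfl = 𝟙 _) :
    baseChangeHom φ (D.map k.hom) _ _ rfl rfl ≫
      baseChangeHom ψ (D.map k.hom) _ _ rfl rfl = 𝟙 _ := by
  have e : D.map u.left ≫ D.map j.hom = D.map k.hom := by rw [← D.map_comp, Over.w]
  have h₁ : D.map u.left ≫ D.map j.hom ≫ f₁ = D.map k.hom ≫ f₁ := by rw [← e, Category.assoc]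
  have h₂ : D.map u.left ≫ D.map j.hom ≫ f₂ = D.map k.hom ≫ f₂ := by rw [← e, Category.assoc]
  have := congrArg (fun χ => baseChangeHom χ (D.map u.left) _ _ h₁ h₁) h
  refine Eq.trans ?_ (this.trans (baseChangeHom_id _ _ h₁))
  refine Eq.trans ?_ (baseChangeHom_comp _ _ _ _ _ _ h₁ h₂ h₁).symm
  exact (congrArg₂ (· ≫ ·) (baseChangeHom_baseChangeHom φ _ _ _ rfl rfl _ _ _ h₁ h₂ _ e)
    (baseChangeHom_baseChangeHom ψ _ _ _ rfl rfl _ _ _ h₂ h₁ _ e)).symm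

include hc in
/-- A pair of morphisms that are inverse to each other over the limit defines an isomorphism at
some stage. -/
lemma exists_iso_hom_eq (hM₁ : IsVectorBundle r M₁) (hM₂ : IsVectorBundle r M₂)
    (φ : (pullback f₁).obj M₁ ⟶ (pullback f₂).obj M₂)
    (ψ : (pullback f₂).obj M₂ ⟶ (pullback f₁).obj M₁) {g₁ : c.pt ⟶ Y₁} {g₂ : c.pt ⟶ Y₂}
    (e₁ : c.π.app i ≫ f₁ = g₁) (e₂ : c.π.app i ≫ f₂ = g₂)
    (h : baseChangeHom φ (c.π.app i) g₁ g₂ e₁ e₂ ≫ baseChangeHom ψ (c.π.app i) g₂ g₁ e₂ e₁ = 𝟙 _)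
    (h' : baseChangeHom ψ (c.π.app i) g₂ g₁ e₂ e₁ ≫ baseChangeHom φ (c.π.app i) g₁ g₂ e₁ e₂ = 𝟙 _) :
    ∃ (j : Over i) (χ : (pullback (D.map j.hom ≫ f₁)).obj M₁ ≅
      (pullback (D.map j.hom ≫ f₂)).obj M₂), χ.hom = baseChangeHom φ (D.map j.hom) _ _ rfl rfl := by
  subst e₁ e₂
  obtain ⟨l₁, hl₁⟩ := exists_comp_eq_id D c hc hM₁ φ ψ h
  obtain ⟨l₂, hl₂⟩ := exists_comp_eq_id D c hc hM₂ ψ φ h'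
  obtain ⟨m, p, q, -⟩ : ∃ (m : Over i) (_ : m ⟶ l₁) (_ : m ⟶ l₂), True :=
    ⟨_, IsCofiltered.minToLeft l₁ l₂, IsCofiltered.minToRight l₁ l₂, trivial⟩
  exact ⟨m, ⟨_, _, comp_eq_id_of_hom D φ ψ p hl₁, comp_eq_id_of_hom D ψ φ q hl₂⟩, rfl⟩

include hc in
/-- A pair of morphisms over the limit comes from some stage. -/
lemma exists_baseChangeHom_pair (hM₁ : IsVectorBundle r M₁) (hM₂ : IsVectorBundle r M₂)
    (φ : (pullback (c.π.app i ≫ f₁)).obj M₁ ⟶ (pullback (c.π.app i ≫ f₂)).obj M₂)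
    (ψ : (pullback (c.π.app i ≫ f₂)).obj M₂ ⟶ (pullback (c.π.app i ≫ f₁)).obj M₁) :
    ∃ (j : Over i) (e₁ : c.π.app j.left ≫ D.map j.hom ≫ f₁ = c.π.app i ≫ f₁)
      (e₂ : c.π.app j.left ≫ D.map j.hom ≫ f₂ = c.π.app i ≫ f₂)
      (φ' : (pullback (D.map j.hom ≫ f₁)).obj M₁ ⟶ (pullback (D.map j.hom ≫ f₂)).obj M₂)
      (ψ' : (pullback (D.map j.hom ≫ f₂)).obj M₂ ⟶ (pullback (D.map j.hom ≫ f₁)).obj M₁),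
      baseChangeHom φ' (c.π.app j.left) _ _ e₁ e₂ = φ ∧
        baseChangeHom ψ' (c.π.app j.left) _ _ e₂ e₁ = ψ := by
  obtain ⟨j₁, φ₁, h₁⟩ := exists_baseChangeHom D c hc hM₁ hM₂ φ
  obtain ⟨j₂, ψ₁, h₂⟩ := exists_baseChangeHom D c hc hM₂ hM₁ ψ
  obtain ⟨k, u, v, -⟩ : ∃ (k : Over i) (_ : k ⟶ j₁) (_ : k ⟶ j₂), True :=
    ⟨_, IsCofiltered.minToLeft j₁ j₂, IsCofiltered.minToRight j₁ j₂, trivial⟩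
  have e₁ : ∀ {Y : Scheme.{u}} (f : D.obj i ⟶ Y) {j : Over i} (w : k ⟶ j),
      D.map w.left ≫ D.map j.hom ≫ f = D.map k.hom ≫ f := fun f j w => by
    rw [← Category.assoc, ← D.map_comp, Over.w]
  have e₂ : ∀ {Y : Scheme.{u}} (f : D.obj i ⟶ Y) (j : Over i),
      c.π.app j.left ≫ D.map j.hom ≫ f = c.π.app i ≫ f := fun f j => by
    rw [← Category.assoc, c.w]
  exact ⟨k, e₂ f₁ k, e₂ f₂ k, baseChangeHom φ₁ (D.map u.left) _ _ (e₁ f₁ u) (e₁ f₂ u),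
    baseChangeHom ψ₁ (D.map v.left) _ _ (e₁ f₂ v) (e₁ f₁ v),
    (baseChangeHom_baseChangeHom φ₁ _ _ _ _ _ _ _ _ _ _ _ (c.w u.left)).trans h₁,
    (baseChangeHom_baseChangeHom ψ₁ _ _ _ _ _ _ _ _ _ _ _ (c.w v.left)).trans h₂⟩

include hc in
/-- An isomorphism over the limit comes from some stage. -/
theorem exists_pullIso (hM₁ : IsVectorBundle r M₁) (hM₂ : IsVectorBundle r M₂)
    (φ : (pullback (c.π.app i ≫ f₁)).obj M₁ ≅ (pullback (c.π.app i ≫ f₂)).obj M₂) :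
    ∃ (j : Over i) (φ' : (pullback (D.map j.hom ≫ f₁)).obj M₁ ≅
      (pullback (D.map j.hom ≫ f₂)).obj M₂),
      pullIso φ' (c.π.app j.left) _ _ (by rw [← Category.assoc, c.w])
        (by rw [← Category.assoc, c.w]) = φ := by
  obtain ⟨k, e₁, e₂, φ₂, ψ₂, hφ₂, hψ₂⟩ :=
    exists_baseChangeHom_pair D c hc hM₁ hM₂ φ.hom φ.inv
  obtain ⟨m, χ, hχ⟩ := exists_iso_hom_eq D c hc hM₁ hM₂ φ₂ ψ₂ e₁ e₂
    (by rw [hφ₂, hψ₂, φ.hom_inv_id]) (by rw [hφ₂, hψ₂, φ.inv_hom_id])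
  -- The targets are variables so that two successive transition maps can be replaced by the
  -- transition map of their composite, which equals them only propositionally.
  have key : ∀ (g₁ : D.obj m.left ⟶ Y₁) (g₂ : D.obj m.left ⟶ Y₂)
      (_ : D.map m.hom ≫ D.map k.hom ≫ f₁ = g₁) (_ : D.map m.hom ≫ D.map k.hom ≫ f₂ = g₂)
      (k₁ : c.π.app m.left ≫ g₁ = c.π.app i ≫ f₁) (k₂ : c.π.app m.left ≫ g₂ = c.π.app i ≫ f₂),
      ∃ φ' : (pullback g₁).obj M₁ ≅ (pullback g₂).obj M₂,
        pullIso φ' (c.π.app m.left) _ _ k₁ k₂ = φ := by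
    rintro _ _ rfl rfl k₁ k₂
    refine ⟨χ, Iso.ext ?_⟩
    rw [pullIso_hom, hχ]
    exact (baseChangeHom_baseChangeHom φ₂ _ _ _ rfl rfl _ _ _ k₁ k₂ _ (c.w m.hom)).trans hφ₂
  have e₃ : ∀ {Y : Scheme.{u}} (f : D.obj i ⟶ Y),
      D.map m.hom ≫ D.map k.hom ≫ f = D.map (m.hom ≫ k.hom) ≫ f := fun f => by
    rw [D.map_comp, Category.assoc]
  exact ⟨Over.mk (m.hom ≫ k.hom), key _ _ (e₃ f₁) (e₃ f₂) _ _⟩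

end Limit

end AlgebraicGeometry.Scheme.Modules

end

/-! ### Bundles over the limit come from a stage. -/

section

namespace AlgebraicGeometry.Scheme.Modules

section Transition

variable {X X' : Scheme.{u}} {M N : X.Modules} {r : ℕ} {ι : Type*} {V : ι → X.Opens}

variable (M) in
/-- The matrices `g` are the transition matrices between the families of sections `e`. -/
def HasTransition (V : ι → X.Opens) (e : ∀ a, Fin r → Γ(M, V a))
    (g : ∀ a b, Fin r → Fin r → Γ(X, V a ⊓ V b)) : Prop :=
  ∀ a b p, M.res inf_le_left (e a p) = ∑ q, g a b p q • M.res inf_le_right (e b q)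

variable {e : ∀ a, Fin r → Γ(M, V a)} {e' : ∀ a, Fin r → Γ(N, V a)}
  {g : ∀ a b, Fin r → Fin r → Γ(X, V a ⊓ V b)}

lemma exists_hasTransition (he : ∀ a, IsFrame M (V a) (e a)) :
    ∃ g, HasTransition M V e g := by
  choose g hg using fun a b p => (he b).exists_eq (inf_le_right : V a ⊓ V b ≤ V b)
    (M.res inf_le_left (e a p))
  exact ⟨g, hg⟩

namespace HasTransition

lemma res_eq (h : HasTransition M V e g) (a b : ι) (p : Fin r) {W : X.Opens} (l : W ≤ V a ⊓ V b) :
    M.res (l.trans inf_le_left) (e a p) =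
      ∑ q, X.resO l (g a b p q) • M.res (l.trans inf_le_right) (e b q) := by
  have := congrArg (M.res l) (h a b p)
  rwa [res_sum_smul, res_res, Finset.sum_congr rfl fun q _ => congrArg (_ • ·) (res_res _ _ _)]
    at this

lemma diag (h : HasTransition M V e g) (he : ∀ a, IsFrame M (V a) (e a)) (a : ι) (p q : Fin r) :
    g a a p q = if p = q then 1 else 0 := by
  have := (he a).ext inf_le_right (c := g a a p) (d := fun q => if p = q then 1 else 0) ?_
  · exact congrFun this q
  · rw [← h a a p]
    simp only [ite_smul, one_smul, zero_smul, Finset.sum_ite_eq, Finset.mem_univ, if_true]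

/-- Passing from the frame `a` to the frame `c` directly or through `b` gives the same coordinates,
by uniqueness. -/
lemma cocycle (h : HasTransition M V e g) (he : ∀ a, IsFrame M (V a) (e a)) (a b c : ι)
    (p q : Fin r) :
    X.resO (inf_le_inf_left _ inf_le_right : V a ⊓ (V b ⊓ V c) ≤ V a ⊓ V c) (g a c p q) =
      ∑ t, X.resO (inf_le_inf_left _ inf_le_left : V a ⊓ (V b ⊓ V c) ≤ V a ⊓ V b) (g a b p t) *
        X.resO inf_le_right (g b c t q) := by
  refine congrFun ((he c).ext (inf_le_right.trans inf_le_right : V a ⊓ (V b ⊓ V c) ≤ V c)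
    (c := fun q => X.resO _ (g a c p q)) (d := fun q => ∑ t : Fin r,
      X.resO (inf_le_inf_left _ inf_le_left : V a ⊓ (V b ⊓ V c) ≤ V a ⊓ V b) (g a b p t) *
        X.resO inf_le_right (g b c t q)) ?_) q
  refine (h.res_eq a c p _).symm.trans ((h.res_eq a b p
    (inf_le_inf_left _ inf_le_left : V a ⊓ (V b ⊓ V c) ≤ V a ⊓ V b)).trans ?_)
  rw [Finset.sum_congr rfl fun t _ => congrArg (_ • ·) (h.res_eq b c t inf_le_right)]
  simp only [Finset.smul_sum, Finset.sum_smul, smul_smul]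
  exact Finset.sum_comm

lemma mono (h : HasTransition M V e g) {W : ι → X.Opens} (hW : ∀ a, W a ≤ V a) :
    HasTransition M W (fun a p => M.res (hW a) (e a p))
      fun a b p q => X.resO (inf_le_inf (hW a) (hW b)) (g a b p q) := by
  intro a b p
  simp only [res_res]
  exact h.res_eq a b p (inf_le_inf (hW a) (hW b))

lemma pbr (h : HasTransition M V e g) (f : X' ⟶ X) :
    HasTransition ((pullback f).obj M) (fun a => f ⁻¹ᵁ V a)
      (fun a p => pbr f M le_rfl (e a p))
      fun a b p q => pbO f (le_refl (f ⁻¹ᵁ (V a ⊓ V b))) (g a b p q) := by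
  intro a b p
  have := congrArg (Modules.pbr f M (le_refl (f ⁻¹ᵁ (V a ⊓ V b)))) (h a b p)
  rw [pbr_sum_smul, pbr_res, Finset.sum_congr rfl fun q _ => congrArg (_ • ·) (pbr_res f _ _ _)]
    at this
  refine (res_pbr f _ _ _).trans (this.trans (Finset.sum_congr rfl fun q _ => ?_))
  exact congrArg (_ • ·) (res_pbr f _ _ _).symm

lemma exists_hom (hV : ⨆ a, V a = ⊤) (he : ∀ a, IsFrame M (V a) (e a))
    (h : HasTransition M V e g) (h' : HasTransition N V e' g) :
    ∃ φ : M ⟶ N, ∀ a p, sec φ (V a) (e a p) = e' a p :=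
  exists_hom_of_frames (isGlued_of_iSup_eq_top N V hV) e he e' fun a b =>
    -- The indices are swapped: `exists_hom_of_frames` expresses the frame `b` through the frame
    -- `a`, while `g a b` expresses `a` through `b`.
    ⟨fun p q => X.resO (inf_comm _ _).le (g b a p q), fun p => h.res_eq b a p (inf_comm _ _).le,
      fun p => h'.res_eq b a p (inf_comm _ _).le⟩

/-- Modules with the same transition matrices are isomorphic. -/
lemma nonempty_iso (hV : ⨆ a, V a = ⊤) (he : ∀ a, IsFrame M (V a) (e a))
    (he' : ∀ a, IsFrame N (V a) (e' a)) (h : HasTransition M V e g) (h' : HasTransition N V e' g) :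
    Nonempty (M ≅ N) := by
  obtain ⟨φ, hφ⟩ := exists_hom hV he h h'
  obtain ⟨ψ, hψ⟩ := exists_hom hV he' h' h
  refine ⟨φ, ψ, hom_ext_of_cover hV e he fun a p => ?_, hom_ext_of_cover hV e' he' fun a p => ?_⟩
  · rw [sec_comp, hφ, hψ, sec_id]
  · rw [sec_comp, hψ, hφ, sec_id]

end HasTransition

end Transition

section Limit

open GenericBundles

variable {I : Type u} [SmallCategory I] [IsCofiltered I] (D : I ⥤ Scheme.{u}) (c : Cone D)
  (hc : IsLimit c) [∀ {i j} (f : i ⟶ j), IsAffineHom (D.map f)] [∀ i, IsNoetherian (D.obj i)]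
  {r : ℕ}

include hc in
/-- A finite cover by quasi-compact open subsets of the limit comes from some stage. -/
lemma exists_cover {ι : Type*} [Finite ι] (U : ι → c.pt.Opens)
    (hU : ∀ a, IsCompact (U a : Set c.pt)) (h : ⨆ a, U a = ⊤) :
    ∃ (i : I) (V : ι → (D.obj i).Opens), ⨆ a, V a = ⊤ ∧ ∀ a, c.π.app i ⁻¹ᵁ V a = U a := by
  obtain ⟨i, hi⟩ := IsCofiltered.exists_forall_of_finite
    (fun a i => ∃ V : (D.obj i).Opens, c.π.app i ⁻¹ᵁ V = U a)
    (fun a i j f ⟨V, hV⟩ => ⟨D.map f ⁻¹ᵁ V, by rw [← hV, ← c.w f]; rfl⟩)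
    fun a => (exists_preimage_eq D c hc (U a) (hU a)).imp fun i ⟨V, _, hV⟩ => ⟨V, hV⟩
  choose V hV using hi
  -- The lifted open subsets need not cover the stage where they are first defined. Their union
  -- pulls back to the whole limit, hence becomes everything at a later stage.
  obtain ⟨j, f, hj⟩ := exists_map_eq_top D c hc (⨆ a, V a) (by
    rw [Scheme.Hom.preimage_iSup, ← h]
    exact iSup_congr hV)
  refine ⟨j, fun a => D.map f ⁻¹ᵁ V a, ?_, fun a => ?_⟩
  · rw [← hj, Scheme.Hom.preimage_iSup]
  · rw [← hV, ← c.w f]; rfl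

include hc in
/-- The transition matrices of a module over the limit come from some stage. -/
lemma exists_transition_eq_pbO {ι : Type*} [Finite ι] {i : I} {V : ι → (D.obj i).Opens}
    {E : c.pt.Modules} {e : ∀ a, Fin r → Γ(E, c.π.app i ⁻¹ᵁ V a)}
    {m : ∀ a b, Fin r → Fin r → Γ(c.pt, c.π.app i ⁻¹ᵁ (V a ⊓ V b))}
    (hm : HasTransition E (fun a => c.π.app i ⁻¹ᵁ V a) e m) :
    ∃ (j : Over i) (g : ∀ a b, Fin r → Fin r →
        Γ(D.obj j.left, D.map j.hom ⁻¹ᵁ (V a ⊓ V b))),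
      HasTransition E (fun a => c.π.app j.left ⁻¹ᵁ D.map j.hom ⁻¹ᵁ V a)
        (fun a p => E.res (by rw [← c.w j.hom]; exact le_rfl) (e a p))
        fun a b p q => pbO (c.π.app j.left)
          (le_refl (c.π.app j.left ⁻¹ᵁ D.map j.hom ⁻¹ᵁ (V a ⊓ V b))) (g a b p q) := by
  obtain ⟨j, t, ht⟩ := exists_pbO_family D c hc (fun x : ι × ι × Fin r × Fin r => V x.1 ⊓ V x.2.1)
    fun x => m x.1 x.2.1 x.2.2.1 x.2.2.2
  have hle : ∀ U : (D.obj i).Opens,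
      c.π.app j.left ⁻¹ᵁ D.map j.hom ⁻¹ᵁ U ≤ c.π.app i ⁻¹ᵁ U := fun U => by
    rw [← c.w j.hom]; exact le_rfl
  refine ⟨j, fun a b p q => t (a, b, p, q), ?_⟩
  have := hm.mono fun a => hle (V a)
  have key : ∀ a b p q, c.pt.resO (hle (V a ⊓ V b)) (m a b p q) =
      pbO (c.π.app j.left) le_rfl (t (a, b, p, q)) := fun a b p q => by
    rw [← ht (a, b, p, q), resO_pbO]
  intro a b p
  refine (this a b p).trans (Finset.sum_congr rfl fun q _ => ?_)
  exact congrArg (· • _) (key a b p q)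

include hc in
/-- The cocycle relations hold at some stage if they hold over the limit. -/
lemma exists_cocycle {ι : Type*} [Finite ι] {i : I} {V : ι → (D.obj i).Opens}
    {E : c.pt.Modules} {e : ∀ a, Fin r → Γ(E, c.π.app i ⁻¹ᵁ V a)}
    (he : ∀ a, IsFrame E (c.π.app i ⁻¹ᵁ V a) (e a))
    (g : ∀ a b, Fin r → Fin r → Γ(D.obj i, V a ⊓ V b))
    (h : HasTransition E (fun a => c.π.app i ⁻¹ᵁ V a) e
      fun a b p q => pbO (c.π.app i) (le_refl (c.π.app i ⁻¹ᵁ (V a ⊓ V b))) (g a b p q)) :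
    ∃ j : Over i,
      (∀ a b d p q, pbO (D.map j.hom) (le_refl (D.map j.hom ⁻¹ᵁ (V a ⊓ (V b ⊓ V d))))
          ((D.obj i).resO (inf_le_inf_left _ inf_le_right) (g a d p q)) =
        pbO (D.map j.hom) (le_refl (D.map j.hom ⁻¹ᵁ (V a ⊓ (V b ⊓ V d))))
          (∑ t, (D.obj i).resO (inf_le_inf_left _ inf_le_left) (g a b p t) *
            (D.obj i).resO inf_le_right (g b d t q))) ∧
      ∀ a p q, pbO (D.map j.hom) (le_refl (D.map j.hom ⁻¹ᵁ (V a ⊓ V a))) (g a a p q) =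
        pbO (D.map j.hom) (le_refl (D.map j.hom ⁻¹ᵁ (V a ⊓ V a))) (if p = q then 1 else 0) := by
  obtain ⟨j₁, h₁⟩ := exists_pbO_eq_family D c hc
    (fun x : ι × ι × ι × Fin r × Fin r => V x.1 ⊓ (V x.2.1 ⊓ V x.2.2.1))
    (fun x => (D.obj i).resO (inf_le_inf_left _ inf_le_right) (g x.1 x.2.2.1 x.2.2.2.1 x.2.2.2.2))
    (fun x => ∑ t, (D.obj i).resO (inf_le_inf_left _ inf_le_left) (g x.1 x.2.1 x.2.2.2.1 t) *
      (D.obj i).resO inf_le_right (g x.2.1 x.2.2.1 t x.2.2.2.2)) fun ⟨a, b, d, p, q⟩ => by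
    simp only [map_sum, map_mul, pbO_resO]
    exact (resO_pbO _ _ _ _).symm.trans ((h.cocycle he a b d p q).trans
      (Finset.sum_congr rfl fun t _ => congrArg₂ (· * ·) (resO_pbO _ _ _ _) (resO_pbO _ _ _ _)))
  obtain ⟨j₂, h₂⟩ := exists_pbO_eq_family D c hc
    (fun x : ι × Fin r × Fin r => V x.1 ⊓ V x.1) (fun x => g x.1 x.1 x.2.1 x.2.2)
    (fun x => if x.2.1 = x.2.2 then 1 else 0) fun ⟨a, p, q⟩ => by
    rw [apply_ite (pbO _ _), map_one, map_zero]
    exact h.diag he a p q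
  obtain ⟨j, u, v, -⟩ : ∃ (j : Over i) (_ : j ⟶ j₁) (_ : j ⟶ j₂), True :=
    ⟨_, IsCofiltered.minToLeft j₁ j₂, IsCofiltered.minToRight j₁ j₂, trivial⟩
  exact ⟨j, fun a b d p q => pbO_eq_of_hom D u (h₁ (a, b, d, p, q)),
    fun a p q => pbO_eq_of_hom D v (h₂ (a, p, q))⟩

include hc in
/-- A vector bundle over the limit that is given by transition matrices over some stage comes from
a later stage. -/
lemma exists_isVectorBundle_of_hasTransition {ι : Type u} [Finite ι] {i : I}
    {V : ι → (D.obj i).Opens} (hV : ⨆ a, V a = ⊤) {E : c.pt.Modules}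
    {e : ∀ a, Fin r → Γ(E, c.π.app i ⁻¹ᵁ V a)} (he : ∀ a, IsFrame E (c.π.app i ⁻¹ᵁ V a) (e a))
    (g : ∀ a b, Fin r → Fin r → Γ(D.obj i, V a ⊓ V b))
    (h : HasTransition E (fun a => c.π.app i ⁻¹ᵁ V a) e
      fun a b p q => pbO (c.π.app i) (le_refl (c.π.app i ⁻¹ᵁ (V a ⊓ V b))) (g a b p q)) :
    ∃ (j : I) (E' : (D.obj j).Modules), IsVectorBundle r E' ∧
      Nonempty ((pullback (c.π.app j)).obj E' ≅ E) := by
  obtain ⟨j, h₁, h₂⟩ := exists_cocycle D c hc he g h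
  let W : ι → (D.obj j.left).Opens := fun a => D.map j.hom ⁻¹ᵁ V a
  have hW : ⨆ a, W a = ⊤ := Scheme.Hom.iSup_preimage_eq_top _ hV
  let g' : ∀ a b, Fin r → Fin r → Γ(D.obj j.left, W a ⊓ W b) := fun a b p q =>
    pbO (D.map j.hom) (le_refl (D.map j.hom ⁻¹ᵁ (V a ⊓ V b))) (g a b p q)
  have hg : ∀ a b d p q,
      (D.obj j.left).resO (inf_le_inf_left _ inf_le_right : W a ⊓ (W b ⊓ W d) ≤ W a ⊓ W d)
        (g' a d p q) =
      ∑ t, (D.obj j.left).resO (inf_le_inf_left _ inf_le_left : W a ⊓ (W b ⊓ W d) ≤ W a ⊓ W b)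
        (g' a b p t) * (D.obj j.left).resO inf_le_right (g' b d t q) := by
    intro a b d p q
    have := h₁ a b d p q
    simp only [map_sum, map_mul, pbO_resO] at this
    exact (resO_pbO _ _ _ _).trans (this.trans
      (Finset.sum_congr rfl fun t _ => congrArg₂ (· * ·) (resO_pbO _ _ _ _).symm
        (resO_pbO _ _ _ _).symm))
  have hg' : ∀ a p q, g' a a p q = if p = q then 1 else 0 := fun a p q =>
    (h₂ a p q).trans (by rw [apply_ite (pbO _ _), map_one, map_zero]; rfl)
  have hF := isFrame_ofCocycleFrame g' hg hg'
  have hT : HasTransition (ofCocycle g') W (ofCocycleFrame g' hg) g' := res_ofCocycleFrame g' hg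
  refine ⟨j.left, ofCocycle g', isVectorBundle_iff.mpr fun x => ?_, ?_⟩
  · obtain ⟨a, ha⟩ := Opens.mem_iSup.mp (hW.ge (Opens.mem_top x))
    exact ⟨W a, ha, _, hF a⟩
  · have hle : ∀ U : (D.obj i).Opens,
        c.π.app j.left ⁻¹ᵁ D.map j.hom ⁻¹ᵁ U ≤ c.π.app i ⁻¹ᵁ U := fun U => by
      rw [← c.w j.hom]; exact le_rfl
    -- The pullback of the glued module and `E` have the same transition matrices on the same cover.
    refine HasTransition.nonempty_iso (Scheme.Hom.iSup_preimage_eq_top (c.π.app j.left) hW)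
      (fun a => (hF a).pbr (c.π.app j.left) (le_refl (c.π.app j.left ⁻¹ᵁ W a)))
      (fun a => (he a).mono (hle (V a))) (hT.pbr (c.π.app j.left)) ?_
    intro a b p
    refine (h.mono (fun a => hle (V a)) a b p).trans (Finset.sum_congr rfl fun q _ => ?_)
    refine congrArg (· • _) ((resO_pbO _ _ _ _).trans ?_)
    exact (pbO_pbO _ _ _ (c.w j.hom) _ _ _).symm

include hc in
/-- A vector bundle over the limit comes from some stage. -/
theorem exists_isVectorBundle [IsNoetherian c.pt] (E : c.pt.Modules) (hE : IsVectorBundle r E) :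
    ∃ (j : I) (E' : (D.obj j).Modules), IsVectorBundle r E' ∧
      Nonempty ((pullback (c.π.app j)).obj E' ≅ E) := by
  rw [isVectorBundle_iff] at hE
  choose U hU e he using hE
  obtain ⟨t, ht⟩ := CompactSpace.elim_nhds_subcover (fun x => (U x : Set c.pt))
    fun x => (U x).isOpen.mem_nhds (hU x)
  obtain ⟨i, V, hV, hVU⟩ := exists_cover D c hc (fun x : t => U x)
    (fun x => isCompact_of_isNoetherian _) (top_le_iff.mp fun x _ => by
      obtain ⟨y, hy, hxy⟩ := Set.mem_iUnion₂.mp (ht.ge (Set.mem_univ x))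
      exact Opens.mem_iSup.mpr ⟨⟨y, hy⟩, hxy⟩)
  have he' : ∀ x : t, IsFrame E (c.π.app i ⁻¹ᵁ V x) fun p => E.res (hVU x).le (e x p) :=
    fun x => (he x).mono _
  obtain ⟨m, hm⟩ := exists_hasTransition he'
  obtain ⟨j, g, hg⟩ := exists_transition_eq_pbO D c hc hm
  exact exists_isVectorBundle_of_hasTransition D c hc (V := fun a => D.map j.hom ⁻¹ᵁ V a)
    (Scheme.Hom.iSup_preimage_eq_top _ hV) (fun a => (he' a).mono _) g hg

end Limit

end AlgebraicGeometry.Scheme.Modules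

end

/-! ### Descent over an open subset of the limit. -/

section

namespace AlgebraicGeometry.Scheme.Modules

open GenericBundles

/-- Base changes along equal morphisms live between different, merely isomorphic, objects; equality
of two base changes can still be transported. -/
lemma pullIso_eq_pullIso_iff {W W' Y₁ Y₂ : Scheme.{u}} {M₁ : Y₁.Modules} {M₂ : Y₂.Modules}
    {f₁ : W ⟶ Y₁} {f₂ : W ⟶ Y₂} (φ ψ : (pullback f₁).obj M₁ ≅ (pullback f₂).obj M₂)
    {g g' : W' ⟶ W} (e : g = g') {g₁ g₁' : W' ⟶ Y₁} {g₂ g₂' : W' ⟶ Y₂} (h₁ : g ≫ f₁ = g₁)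
    (h₂ : g ≫ f₂ = g₂) (h₁' : g' ≫ f₁ = g₁') (h₂' : g' ≫ f₂ = g₂') :
    pullIso φ g g₁ g₂ h₁ h₂ = pullIso ψ g g₁ g₂ h₁ h₂ ↔
      pullIso φ g' g₁' g₂' h₁' h₂' = pullIso ψ g' g₁' g₂' h₁' h₂' := by
  subst e h₁ h₂ h₁' h₂'
  rfl

section Limit

variable {I : Type u} [SmallCategory I] [IsCofiltered I] (D : I ⥤ Scheme.{u}) (c : Cone D)
  (hc : IsLimit c) [∀ {i j} (f : i ⟶ j), IsAffineHom (D.map f)] [∀ i, IsNoetherian (D.obj i)]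
  {r : ℕ} {i : I} (V : (D.obj i).Opens) {Y₁ Y₂ : Scheme.{u}}
  {f₁ : V.toScheme ⟶ Y₁} {f₂ : V.toScheme ⟶ Y₂} {M₁ : Y₁.Modules} {M₂ : Y₂.Modules}

/-- Open subschemes of noetherian schemes are noetherian. -/
instance {X : Scheme.{u}} [IsNoetherian X] (U : X.Opens) : IsNoetherian U.toScheme where
  toCompactSpace := isCompact_iff_compactSpace.mp (isCompact_of_isNoetherian U)

instance (j : Over i) : IsNoetherian ((opensDiagram D i V).obj j) :=
  inferInstanceAs (IsNoetherian (D.map j.hom ⁻¹ᵁ V).toScheme)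

omit [IsCofiltered I] [∀ {i j} (f : i ⟶ j), IsAffineHom (D.map f)] [∀ i, IsNoetherian (D.obj i)] in
lemma map_id_preimage_le : D.map (𝟙 i) ⁻¹ᵁ V ≤ V := by
  rw [D.map_id]; exact le_rfl

/-- The identification of the terminal object of `opensDiagram D i V` with `V`. -/
noncomputable def opensDiagramTerminal :
    (opensDiagram D i V).obj (Over.mk (𝟙 i)) ⟶ V.toScheme :=
  (D.obj i).homOfLE (map_id_preimage_le D V)

omit [IsCofiltered I] [∀ {i j} (f : i ⟶ j), IsAffineHom (D.map f)] [∀ i, IsNoetherian (D.obj i)] in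
-- In the diagram of preimages, `V` itself appears only as the preimage under `D.map (𝟙 i)`; the
-- comparison map corrects for this.
lemma opensDiagram_map_terminal {j : Over i} (f : j ⟶ Over.mk (𝟙 i)) :
    (opensDiagram D i V).map f ≫ opensDiagramTerminal D V =
      (D.map j.hom).resLE V (D.map j.hom ⁻¹ᵁ V) le_rfl := by
  have e : f.left = j.hom := (Category.comp_id _).symm.trans (Over.w f)
  refine (Scheme.Hom.resLE_map (D.map f.left) _ _).trans ?_
  congr 1
  rw [e]

omit [IsCofiltered I] [∀ {i j} (f : i ⟶ j), IsAffineHom (D.map f)] [∀ i, IsNoetherian (D.obj i)] in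
lemma opensCone_π_terminal :
    (opensCone D c i V).π.app (Over.mk (𝟙 i)) ≫ opensDiagramTerminal D V =
      (c.π.app i).resLE V (c.π.app i ⁻¹ᵁ V) le_rfl :=
  Scheme.Hom.resLE_map (c.π.app i) _ _

include hc in
/-- Two isomorphisms over an open subset that agree over the limit agree at some stage. -/
theorem exists_pullIso_resLE_eq (hM₁ : IsVectorBundle r M₁) (hM₂ : IsVectorBundle r M₂)
    (φ ψ : (pullback f₁).obj M₁ ≅ (pullback f₂).obj M₂)
    (h : pullIso φ ((c.π.app i).resLE V (c.π.app i ⁻¹ᵁ V) le_rfl) _ _ rfl rfl =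
      pullIso ψ ((c.π.app i).resLE V (c.π.app i ⁻¹ᵁ V) le_rfl) _ _ rfl rfl) :
    ∃ (j : I) (f : j ⟶ i), pullIso φ ((D.map f).resLE V (D.map f ⁻¹ᵁ V) le_rfl) _ _ rfl rfl =
      pullIso ψ ((D.map f).resLE V (D.map f ⁻¹ᵁ V) le_rfl) _ _ rfl rfl := by
  let t := opensDiagramTerminal D V
  -- The isomorphisms are first moved to the object of the diagram representing `V`; further base
  -- change from there is base change from `V`.
  have key : ∀ {W : Scheme.{u}} (k : W ⟶ (opensDiagram D i V).obj (Over.mk (𝟙 i)))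
      (k' : W ⟶ V.toScheme) (_ : k ≫ t = k'),
      pullIso (pullIso φ t _ _ rfl rfl) k _ _ rfl rfl =
        pullIso (pullIso ψ t _ _ rfl rfl) k _ _ rfl rfl ↔
      pullIso φ k' _ _ rfl rfl = pullIso ψ k' _ _ rfl rfl := by
    rintro W k _ rfl
    rw [pullIso_pullIso φ t _ _ rfl rfl k _ _ rfl rfl _ rfl,
      pullIso_pullIso ψ t _ _ rfl rfl k _ _ rfl rfl _ rfl]
    exact pullIso_eq_pullIso_iff φ ψ rfl _ _ _ _
  obtain ⟨j, hj⟩ := exists_pullIso_eq (opensDiagram D i V) (opensCone D c i V)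
    (isLimitOpensCone D c hc i V) hM₁ hM₂ (i := Over.mk (𝟙 i)) (pullIso φ t _ _ rfl rfl)
    (pullIso ψ t _ _ rfl rfl) ((key _ _ (opensCone_π_terminal D c V)).mpr h)
  exact ⟨j.left.left, j.left.hom, (key _ _ (opensDiagram_map_terminal D V j.hom)).mp hj⟩

omit [IsCofiltered I] [∀ {i j} (f : i ⟶ j), IsAffineHom (D.map f)] [∀ i, IsNoetherian (D.obj i)] in
lemma preimage_le_π' {j : I} (f : j ⟶ i) :
    c.π.app i ⁻¹ᵁ V ≤ c.π.app j ⁻¹ᵁ D.map f ⁻¹ᵁ V :=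
  preimage_le_π D c (Over.mk f) V

include hc in
/-- An isomorphism over an open subset of the limit comes from some stage. -/
theorem exists_pullIso_resLE (hM₁ : IsVectorBundle r M₁) (hM₂ : IsVectorBundle r M₂)
    {g₁ : (c.π.app i ⁻¹ᵁ V).toScheme ⟶ Y₁} {g₂ : (c.π.app i ⁻¹ᵁ V).toScheme ⟶ Y₂}
    (h₁ : (c.π.app i).resLE V (c.π.app i ⁻¹ᵁ V) le_rfl ≫ f₁ = g₁)
    (h₂ : (c.π.app i).resLE V (c.π.app i ⁻¹ᵁ V) le_rfl ≫ f₂ = g₂)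
    (φ : (pullback g₁).obj M₁ ≅ (pullback g₂).obj M₂) :
    ∃ (j : I) (f : j ⟶ i), ∀ (k₁ : (D.map f ⁻¹ᵁ V).toScheme ⟶ Y₁)
      (k₂ : (D.map f ⁻¹ᵁ V).toScheme ⟶ Y₂)
      (_ : (D.map f).resLE V (D.map f ⁻¹ᵁ V) le_rfl ≫ f₁ = k₁)
      (_ : (D.map f).resLE V (D.map f ⁻¹ᵁ V) le_rfl ≫ f₂ = k₂)
      (l₁ : (c.π.app j).resLE (D.map f ⁻¹ᵁ V) (c.π.app i ⁻¹ᵁ V) (preimage_le_π' D c V f) ≫ k₁ = g₁)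
      (l₂ : (c.π.app j).resLE (D.map f ⁻¹ᵁ V) (c.π.app i ⁻¹ᵁ V) (preimage_le_π' D c V f) ≫ k₂ = g₂),
      ∃ φ' : (pullback k₁).obj M₁ ≅ (pullback k₂).obj M₂, pullIso φ' _ _ _ l₁ l₂ = φ := by
  let t := opensDiagramTerminal D V
  have e : ∀ {Y : Scheme.{u}} (f : V.toScheme ⟶ Y) {g : (c.π.app i ⁻¹ᵁ V).toScheme ⟶ Y}
      (_ : (c.π.app i).resLE V (c.π.app i ⁻¹ᵁ V) le_rfl ≫ f = g),
      (opensCone D c i V).π.app (Over.mk (𝟙 i)) ≫ t ≫ f = g := by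
    rintro Y f _ rfl
    rw [← Category.assoc]
    exact congrArg (· ≫ f) (opensCone_π_terminal D c V)
  obtain rfl := e f₁ h₁
  obtain rfl := e f₂ h₂
  obtain ⟨j, φ', hφ'⟩ := exists_pullIso (opensDiagram D i V) (opensCone D c i V)
    (isLimitOpensCone D c hc i V) hM₁ hM₂ (i := Over.mk (𝟙 i)) φ
  refine ⟨j.left.left, j.left.hom, ?_⟩
  have e' : ∀ {Y : Scheme.{u}} (f : V.toScheme ⟶ Y),
      (opensDiagram D i V).map j.hom ≫ t ≫ f =
        (D.map j.left.hom).resLE V (D.map j.left.hom ⁻¹ᵁ V) le_rfl ≫ f := fun f => by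
    rw [← Category.assoc]
    exact congrArg (· ≫ f) (opensDiagram_map_terminal D V j.hom)
  -- The structure maps are arbitrary up to a proof of equality, so that later uses can present them
  -- as restrictions of whichever composite is at hand.
  intro k₁ k₂ q₁ q₂ l₁ l₂
  obtain rfl := (e' f₁).trans q₁
  obtain rfl := (e' f₂).trans q₂
  exact ⟨φ', hφ'⟩

include hc in
/-- A vector bundle over an open subset of the limit comes from some stage. -/
theorem exists_isVectorBundle_resLE [IsNoetherian c.pt] (E : (c.π.app i ⁻¹ᵁ V).toScheme.Modules)
    (hE : IsVectorBundle r E) :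
    ∃ (j : I) (f : j ⟶ i) (E' : (D.map f ⁻¹ᵁ V).toScheme.Modules), IsVectorBundle r E' ∧
      Nonempty ((pullback ((c.π.app j).resLE (D.map f ⁻¹ᵁ V) (c.π.app i ⁻¹ᵁ V)
        (preimage_le_π' D c V f))).obj E' ≅ E) := by
  have : IsNoetherian (opensCone D c i V).pt :=
    (inferInstance : ∀ U : c.pt.Opens, IsNoetherian U.toScheme) (c.π.app i ⁻¹ᵁ V)
  obtain ⟨j, E', hE', e⟩ := exists_isVectorBundle (opensDiagram D i V) (opensCone D c i V)
    (isLimitOpensCone D c hc i V) E hE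
  exact ⟨j.left, j.hom, E', hE', e⟩

end Limit

end AlgebraicGeometry.Scheme.Modules

end

/-! ### Equality of germs descends. -/

section

namespace GenericBundles

open Opposite

variable {B : Scheme.{u}} (X : Over B)

/-- The functor `T ↦ X_T`. -/
noncomputable def famFunctor : Over B ⥤ Scheme.{u} where
  obj T := fam X T
  map g := famMap X g
  map_id T := famMap_id X T
  map_comp g h := (famMap_comp X g h).symm

section Limit

variable {X} {r : ℕ} {J : Type u} [SmallCategory J] [IsFiltered J] {T : Jᵒᵖ ⥤ Over B} {s : Cone T}

variable (X s) in
/-- `X_s` is the limit of the noetherian schemes `X_{T_j}` along affine transition maps, and bigness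
of open subsets descends from `X_s` to some `X_{T_j}`. -/
structure IsGoodLimit : Prop where
  isLimit : Nonempty (IsLimit ((famFunctor X).mapCone s))
  isAffineHom : ∀ i j (f : i ⟶ j), IsAffineHom ((T ⋙ famFunctor X).map f)
  isNoetherian : ∀ i, IsNoetherian ((T ⋙ famFunctor X).obj i)
  isNoetherian_pt : IsNoetherian ((famFunctor X).mapCone s).pt
  exists_isBig : ∀ (i : Jᵒᵖ) (U : (fam X (T.obj i)).Opens),
    IsBig X (famMap X (s.π.app i) ⁻¹ᵁ U) →
      ∃ (j : Jᵒᵖ) (f : j ⟶ i), IsBig X (famMap X (T.map f) ⁻¹ᵁ U)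

lemma preimage_famMap_comp {T₁ T₂ T₃ : Over B} {g : T₁ ⟶ T₂} {h : T₂ ⟶ T₃} {k : T₁ ⟶ T₃}
    (e : g ≫ h = k) (U : (fam X T₃).Opens) :
    famMap X g ⁻¹ᵁ famMap X h ⁻¹ᵁ U = famMap X k ⁻¹ᵁ U := by
  rw [← e, ← famMap_comp]; rfl

namespace IsGoodLimit

variable (hs : IsGoodLimit X s)
include hs

/-- A big open subset comes from a big open subset at some stage. -/
lemma exists_isBig_preimage_eq {W : (fam X s.pt).Opens} (hW : IsBig X W) :
    ∃ (i : Jᵒᵖ) (V : (fam X (T.obj i)).Opens), IsBig X V ∧ famMap X (s.π.app i) ⁻¹ᵁ V = W := by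
  have := hs.isAffineHom
  have := hs.isNoetherian
  obtain ⟨hc⟩ := hs.isLimit
  have := hs.isNoetherian_pt
  obtain ⟨i, V, -, hV⟩ := exists_preimage_eq _ _ hc W (NoetherianSpace.isCompact _)
  replace hV : famMap X (s.π.app i) ⁻¹ᵁ V = W := hV
  obtain ⟨j, f, hf⟩ := hs.exists_isBig i V (hV ▸ hW)
  exact ⟨j, _, hf, (preimage_famMap_comp (s.w f) V).trans hV⟩

/-- A big open subset comes from a big open subset of a given open subset at some stage. -/
lemma exists_isBig_preimage_eq_le {W : (fam X s.pt).Opens} (hW : IsBig X W) {i : Jᵒᵖ}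
    (U : (fam X (T.obj i)).Opens) (hU : W ≤ famMap X (s.π.app i) ⁻¹ᵁ U) :
    ∃ (j : Jᵒᵖ) (f : j ⟶ i) (V : (fam X (T.obj j)).Opens), IsBig X V ∧
      famMap X (s.π.app j) ⁻¹ᵁ V = W ∧ V ≤ famMap X (T.map f) ⁻¹ᵁ U := by
  obtain ⟨j, V, -, hV⟩ := hs.exists_isBig_preimage_eq hW
  obtain ⟨k, f, g, -⟩ : ∃ (k : Jᵒᵖ) (_ : k ⟶ i) (_ : k ⟶ j), True :=
    ⟨_, IsCofiltered.minToLeft i j, IsCofiltered.minToRight i j, trivial⟩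
  have h : famMap X (s.π.app k) ⁻¹ᵁ (famMap X (T.map g) ⁻¹ᵁ V ⊓ famMap X (T.map f) ⁻¹ᵁ U) = W := by
    rw [Scheme.Hom.preimage_inf, preimage_famMap_comp (s.w g), preimage_famMap_comp (s.w f), hV]
    exact inf_eq_left.mpr hU
  -- Intersecting with the preimage of `U` keeps the preimage in the limit but may lose bigness at
  -- the stage `k`; bigness is recovered at a later stage.
  obtain ⟨l, p, hp⟩ := hs.exists_isBig k _ (h.symm ▸ hW)
  refine ⟨l, p ≫ f, _, hp, (preimage_famMap_comp (s.w p) _).trans h, ?_⟩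
  rw [← preimage_famMap_comp (T.map_comp p f).symm]
  exact Scheme.Hom.preimage_mono _ inf_le_right

omit hs in
lemma _root_.GenericBundles.IsoOnBig.res_self {S T₁ T₂ : Over B} {a : fam X S ⟶ fam X T₁}
    {x : PartialBundle X r T₁} {b : fam X S ⟶ fam X T₂} {y : PartialBundle X r T₂}
    (φ : IsoOnBig a x b y) : φ.res φ.W le_rfl = φ.iso :=
  pullIso_id _ _ (Scheme.homOfLE_rfl _ _) _ _

variable {i : Jᵒᵖ} {T₁ T₂ : Over B} {x : PartialBundle X r T₁} {y : PartialBundle X r T₂}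
  {a : fam X (T.obj i) ⟶ fam X T₁} {b : fam X (T.obj i) ⟶ fam X T₂}

open Scheme.Modules in
-- The case in which the open subset of agreement is the preimage of a big open subset `V` at the
-- stage `i`; it reduces to `exists_pullIso_resLE_eq`.
lemma exists_rel_pull (φ ψ : IsoOnBig a x b y) {V : (fam X (T.obj i)).Opens} (hV : IsBig X V)
    (h₁ : V ≤ φ.W) (h₂ : V ≤ ψ.W)
    (h : (φ.pull (s.π.app i) _ _ rfl rfl).res (famMap X (s.π.app i) ⁻¹ᵁ V)
        ((famMap X (s.π.app i)).preimage_mono h₁) =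
      (ψ.pull (s.π.app i) _ _ rfl rfl).res (famMap X (s.π.app i) ⁻¹ᵁ V)
        ((famMap X (s.π.app i)).preimage_mono h₂)) :
    ∃ (j : Jᵒᵖ) (f : j ⟶ i), IsoOnBig.Rel (φ.pull (T.map f) _ _ rfl rfl)
      (ψ.pull (T.map f) _ _ rfl rfl) := by
  have := hs.isAffineHom
  have := hs.isNoetherian
  obtain ⟨hc⟩ := hs.isLimit
  have h' := (φ.pull_res (s.π.app i) _ _ rfl rfl V h₁ _ le_rfl _).symm.trans
    (h.trans (ψ.pull_res (s.π.app i) _ _ rfl rfl V h₂ _ le_rfl _))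
  obtain ⟨j, f, hf⟩ := exists_pullIso_resLE_eq (T ⋙ famFunctor X) _ hc V
    x.isVectorBundle y.isVectorBundle (φ.res V h₁) (ψ.res V h₂)
    ((pullIso_eq_pullIso_iff _ _ rfl _ _ rfl rfl).mp h')
  refine ⟨j, f, famMap X (T.map f) ⁻¹ᵁ V, hV.preimage _, (famMap X (T.map f)).preimage_mono h₁,
    (famMap X (T.map f)).preimage_mono h₂, ?_⟩
  exact (φ.pull_res (T.map f) _ _ rfl rfl V h₁ _ le_rfl _).trans
    (((pullIso_eq_pullIso_iff _ _ rfl _ _ rfl rfl).mpr hf).trans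
      (ψ.pull_res (T.map f) _ _ rfl rfl V h₂ _ le_rfl _).symm)

/-- Germs that agree over the limit agree at some stage. -/
theorem exists_pull_eq (φ ψ : Germ a x b y)
    (h : φ.pull (s.π.app i) _ _ rfl rfl = ψ.pull (s.π.app i) _ _ rfl rfl) :
    ∃ (j : Jᵒᵖ) (f : j ⟶ i), φ.pull (T.map f) _ _ rfl rfl = ψ.pull (T.map f) _ _ rfl rfl := by
  induction φ using Quotient.inductionOn with | _ φ
  induction ψ using Quotient.inductionOn with | _ ψ
  obtain ⟨W, hW, h₁, h₂, e⟩ := Quotient.exact h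
  -- The open subset on which the germs agree over the limit is brought to a stage, inside both
  -- domains of definition.
  obtain ⟨j, f, V, hV, rfl, hVU⟩ := hs.exists_isBig_preimage_eq_le hW (φ.W ⊓ ψ.W) (le_inf h₁ h₂)
  have l₁ : V ≤ famMap X (T.map f) ⁻¹ᵁ φ.W := hVU.trans (Scheme.Hom.preimage_mono _ inf_le_left)
  have l₂ : V ≤ famMap X (T.map f) ⁻¹ᵁ ψ.W := hVU.trans (Scheme.Hom.preimage_mono _ inf_le_right)
  have ha : ∀ {T₁ : Over B} (a : fam X (T.obj i) ⟶ fam X T₁),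
      famMap X (s.π.app j) ≫ famMap X (T.map f) ≫ a = famMap X (s.π.app i) ≫ a := fun a => by
    rw [← Category.assoc, famMap_comp, s.w]
  have e' : ∀ (a' : fam X s.pt ⟶ fam X T₁) (b' : fam X s.pt ⟶ fam X T₂)
      (k₁ : famMap X (s.π.app i) ≫ a = a') (k₂ : famMap X (s.π.app i) ≫ b = b')
      (l₁ : famMap X (s.π.app j) ⁻¹ᵁ V ≤ (φ.pull (s.π.app i) a' b' k₁ k₂).W)
      (l₂ : famMap X (s.π.app j) ⁻¹ᵁ V ≤ (ψ.pull (s.π.app i) a' b' k₁ k₂).W),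
      (φ.pull (s.π.app i) a' b' k₁ k₂).res (famMap X (s.π.app j) ⁻¹ᵁ V) l₁ =
        (ψ.pull (s.π.app i) a' b' k₁ k₂).res (famMap X (s.π.app j) ⁻¹ᵁ V) l₂ := by
    rintro _ _ rfl rfl _ _
    exact e
  obtain ⟨k, g, hg⟩ := hs.exists_rel_pull (φ.pull (T.map f) _ _ rfl rfl)
    (ψ.pull (T.map f) _ _ rfl rfl) hV l₁ l₂ (by
    exact (φ.pull_pull_res (T.map f) _ _ rfl rfl (s.π.app j) _ _ rfl rfl (s.π.app i) (s.w f)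
        (ha a).symm (ha b).symm φ.W le_rfl V l₁ _ le_rfl h₁ l₁ _ h₁).trans
      ((e' _ _ _ _ _ _).trans
        (ψ.pull_pull_res (T.map f) _ _ rfl rfl (s.π.app j) _ _ rfl rfl (s.π.app i) (s.w f)
          (ha a).symm (ha b).symm ψ.W le_rfl V l₂ _ le_rfl h₂ l₂ _ h₂).symm))
  have ha' : ∀ {T₁ : Over B} (a : fam X (T.obj i) ⟶ fam X T₁),
      famMap X (T.map g) ≫ famMap X (T.map f) ≫ a = famMap X (T.map (g ≫ f)) ≫ a := fun a => by
    rw [← Category.assoc, famMap_comp, T.map_comp]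
  have key : ∀ (a' : fam X (T.obj k) ⟶ fam X T₁) (b' : fam X (T.obj k) ⟶ fam X T₂)
      (k₁ : famMap X (T.map g) ≫ famMap X (T.map f) ≫ a = a')
      (k₂ : famMap X (T.map g) ≫ famMap X (T.map f) ≫ b = b'),
      (Germ.pull (T.map f) _ _ rfl rfl (Quotient.mk _ φ)).pull (T.map g) a' b' k₁ k₂ =
        (Germ.pull (T.map f) _ _ rfl rfl (Quotient.mk _ ψ)).pull (T.map g) a' b' k₁ k₂ := by
    rintro _ _ rfl rfl
    exact Quotient.sound hg
  exact ⟨k, g ≫ f, (Germ.pull_pull _ _ _ _ _ _ _ _ _ _ _ (T.map_comp g f).symm _ _ _).symm.trans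
    ((key _ _ (ha' a) (ha' b)).trans
      (Germ.pull_pull _ _ _ _ _ _ _ _ _ _ _ (T.map_comp g f).symm _ _ _))⟩

end IsGoodLimit

end Limit

end GenericBundles

end

/-! ### Germs and objects descend; the equivalence of categories. -/

section

namespace GenericBundles

open Opposite

variable {B : Scheme.{u}} {X : Over B} {r : ℕ} {J : Type u} [SmallCategory J] [IsFiltered J]
  {T : Jᵒᵖ ⥤ Over B} {s : Cone T}

/-- Agreement is tested on the whole domain of `φ`, where restriction changes nothing. -/
lemma IsoOnBig.rel_pull_mk {S S' T₁ T₂ : Over B} {a : fam X S ⟶ fam X T₁}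
    {b : fam X S ⟶ fam X T₂} {x : PartialBundle X r T₁} {y : PartialBundle X r T₂} (g : S' ⟶ S)
    (ψ : IsoOnBig a x b y) {a' : fam X S' ⟶ fam X T₁} {b' : fam X S' ⟶ fam X T₂}
    (k₁ : famMap X g ≫ a = a') (k₂ : famMap X g ≫ b = b') (φ : IsoOnBig a' x b' y)
    (hle : φ.W ≤ famMap X g ⁻¹ᵁ ψ.W)
    (n₁ : (famMap X g).resLE ψ.W φ.W hle ≫ a.resLE x.U ψ.W ψ.le₁ = a'.resLE x.U φ.W φ.le₁)
    (n₂ : (famMap X g).resLE ψ.W φ.W hle ≫ b.resLE y.U ψ.W ψ.le₂ = b'.resLE y.U φ.W φ.le₂)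
    (h : pullIso ψ.iso ((famMap X g).resLE ψ.W φ.W hle) _ _ n₁ n₂ = φ.iso) :
    IsoOnBig.Rel (ψ.pull g a' b' k₁ k₂) φ := by
  refine ⟨φ.W, φ.isBig, hle, le_rfl, ?_⟩
  refine (ψ.pull_res g a' b' k₁ k₂ ψ.W le_rfl φ.W hle _).trans (Eq.trans ?_ φ.res_self.symm)
  rw [ψ.res_self]
  exact h

namespace IsGoodLimit

variable (hs : IsGoodLimit X s)
include hs

variable {i : Jᵒᵖ} {T₁ T₂ : Over B} {x : PartialBundle X r T₁} {y : PartialBundle X r T₂}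

open Scheme.Modules in
-- The domain is assumed to come from the stage `i`, so `exists_pullIso_resLE` applies on `V`. The
-- maps `a'`, `b'` are quantified over to allow any presentation of the composites with the
-- transition map.
lemma exists_isoOnBig {a : fam X (T.obj i) ⟶ fam X T₁} {b : fam X (T.obj i) ⟶ fam X T₂}
    {a₀ : fam X s.pt ⟶ fam X T₁} {b₀ : fam X s.pt ⟶ fam X T₂} (ha : famMap X (s.π.app i) ≫ a = a₀)
    (hb : famMap X (s.π.app i) ≫ b = b₀) {V : (fam X (T.obj i)).Opens} (hV : IsBig X V)
    (h₁ : V ≤ a ⁻¹ᵁ x.U) (h₂ : V ≤ b ⁻¹ᵁ y.U) (φ : IsoOnBig a₀ x b₀ y)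
    (hφ : φ.W = famMap X (s.π.app i) ⁻¹ᵁ V) :
    ∃ (j : Jᵒᵖ) (f : j ⟶ i), ∀ (a' : fam X (T.obj j) ⟶ fam X T₁) (b' : fam X (T.obj j) ⟶ fam X T₂)
      (_ : famMap X (T.map f) ≫ a = a') (_ : famMap X (T.map f) ≫ b = b')
      (k₁ : famMap X (s.π.app j) ≫ a' = a₀) (k₂ : famMap X (s.π.app j) ≫ b' = b₀),
      ∃ φ' : IsoOnBig a' x b' y, IsoOnBig.Rel (φ'.pull (s.π.app j) a₀ b₀ k₁ k₂) φ := by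
  have := hs.isAffineHom
  have := hs.isNoetherian
  obtain ⟨hc⟩ := hs.isLimit
  obtain ⟨W, hW, l₁, l₂, e⟩ := φ
  obtain rfl : W = famMap X (s.π.app i) ⁻¹ᵁ V := hφ
  subst ha hb
  have p₁ : (famMap X (s.π.app i)).resLE V (famMap X (s.π.app i) ⁻¹ᵁ V) le_rfl ≫ a.resLE x.U V h₁ =
      (famMap X (s.π.app i) ≫ a).resLE x.U _ l₁ := Scheme.Hom.resLE_comp_resLE _ _ _ _
  have p₂ : (famMap X (s.π.app i)).resLE V (famMap X (s.π.app i) ⁻¹ᵁ V) le_rfl ≫ b.resLE y.U V h₂ =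
      (famMap X (s.π.app i) ≫ b).resLE y.U _ l₂ := Scheme.Hom.resLE_comp_resLE _ _ _ _
  obtain ⟨j, f, H⟩ := exists_pullIso_resLE (T ⋙ famFunctor X) _ hc V
    x.isVectorBundle y.isVectorBundle p₁ p₂ e
  refine ⟨j, f, ?_⟩
  rintro _ _ rfl rfl k₁ k₂
  let V' := famMap X (T.map f) ⁻¹ᵁ V
  have m₁ : V' ≤ (famMap X (T.map f) ≫ a) ⁻¹ᵁ x.U := (famMap X (T.map f)).preimage_mono h₁
  have m₂ : V' ≤ (famMap X (T.map f) ≫ b) ⁻¹ᵁ y.U := (famMap X (T.map f)).preimage_mono h₂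
  have q₁ : (famMap X (T.map f)).resLE V V' le_rfl ≫ a.resLE x.U V h₁ =
      (famMap X (T.map f) ≫ a).resLE x.U V' m₁ := Scheme.Hom.resLE_comp_resLE _ _ _ _
  have q₂ : (famMap X (T.map f)).resLE V V' le_rfl ≫ b.resLE y.U V h₂ =
      (famMap X (T.map f) ≫ b).resLE y.U V' m₂ := Scheme.Hom.resLE_comp_resLE _ _ _ _
  have r₁ : (famMap X (s.π.app j)).resLE V' (famMap X (s.π.app i) ⁻¹ᵁ V)
        (preimage_famMap_comp (s.w f) V).ge ≫ (famMap X (T.map f) ≫ a).resLE x.U V' m₁ =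
      (famMap X (s.π.app i) ≫ a).resLE x.U _ l₁ := by
    rw [Scheme.Hom.resLE_comp_resLE]
    congr 1
  have r₂ : (famMap X (s.π.app j)).resLE V' (famMap X (s.π.app i) ⁻¹ᵁ V)
        (preimage_famMap_comp (s.w f) V).ge ≫ (famMap X (T.map f) ≫ b).resLE y.U V' m₂ =
      (famMap X (s.π.app i) ≫ b).resLE y.U _ l₂ := by
    rw [Scheme.Hom.resLE_comp_resLE]
    congr 1
  obtain ⟨φ'', hφ''⟩ := H _ _ q₁ q₂ r₁ r₂
  exact ⟨⟨V', hV.preimage _, m₁, m₂, φ''⟩, IsoOnBig.rel_pull_mk _ _ k₁ k₂ _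
    (preimage_famMap_comp (s.w f) V).ge r₁ r₂ hφ''⟩

/-- A germ over the limit comes from some stage. -/
theorem exists_germ {a : fam X (T.obj i) ⟶ fam X T₁} {b : fam X (T.obj i) ⟶ fam X T₂}
    {a₀ : fam X s.pt ⟶ fam X T₁} {b₀ : fam X s.pt ⟶ fam X T₂} (ha : famMap X (s.π.app i) ≫ a = a₀)
    (hb : famMap X (s.π.app i) ≫ b = b₀) (φ : Germ a₀ x b₀ y) :
    ∃ (j : Jᵒᵖ) (f : j ⟶ i), ∀ (a' : fam X (T.obj j) ⟶ fam X T₁) (b' : fam X (T.obj j) ⟶ fam X T₂)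
      (_ : famMap X (T.map f) ≫ a = a') (_ : famMap X (T.map f) ≫ b = b')
      (k₁ : famMap X (s.π.app j) ≫ a' = a₀) (k₂ : famMap X (s.π.app j) ≫ b' = b₀),
      ∃ φ' : Germ a' x b' y, φ'.pull (s.π.app j) a₀ b₀ k₁ k₂ = φ := by
  induction φ using Quotient.inductionOn with | _ φ
  have hle : φ.W ≤ famMap X (s.π.app i) ⁻¹ᵁ (a ⁻¹ᵁ x.U ⊓ b ⁻¹ᵁ y.U) := by
    subst ha hb
    exact le_inf φ.le₁ φ.le₂
  obtain ⟨j, f, V, hV, hVW, hVU⟩ := hs.exists_isBig_preimage_eq_le φ.isBig _ hle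
  have e : ∀ {T₁ : Over B} (a : fam X (T.obj i) ⟶ fam X T₁),
      famMap X (s.π.app j) ≫ famMap X (T.map f) ≫ a = famMap X (s.π.app i) ≫ a := fun a => by
    rw [← Category.assoc, famMap_comp, s.w]
  obtain ⟨k, g, H⟩ := hs.exists_isoOnBig ((e a).trans ha) ((e b).trans hb) hV
    (hVU.trans (Scheme.Hom.preimage_mono _ inf_le_left))
    (hVU.trans (Scheme.Hom.preimage_mono _ inf_le_right)) φ hVW.symm
  refine ⟨k, g ≫ f, ?_⟩
  rintro a' b' h₁ h₂ k₁ k₂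
  rw [T.map_comp, ← famMap_comp, Category.assoc] at h₁ h₂
  obtain ⟨φ', hφ'⟩ := H a' b' h₁ h₂ k₁ k₂
  exact ⟨Quotient.mk _ φ', Quotient.sound hφ'⟩

/-- An object of `F(s)` comes from some stage. -/
theorem exists_nonempty_hom (x : PartialBundle X r s.pt) :
    ∃ (j : Jᵒᵖ) (y : PartialBundle X r (T.obj j)), Nonempty (y.baseChange (s.π.app j) ⟶ x) := by
  have := hs.isAffineHom
  have := hs.isNoetherian
  have := hs.isNoetherian_pt
  obtain ⟨hc⟩ := hs.isLimit
  obtain ⟨U, hU, E, hE⟩ := x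
  obtain ⟨i, V, hV, rfl⟩ := hs.exists_isBig_preimage_eq hU
  obtain ⟨j, f, E', hE', ⟨e⟩⟩ :=
    Scheme.Modules.exists_isVectorBundle_resLE (T ⋙ famFunctor X) _ hc V E hE
  let y : PartialBundle X r (T.obj j) := ⟨famMap X (T.map f) ⁻¹ᵁ V, hV.preimage _, E', hE'⟩
  -- The isomorphism with `E` is rewritten with target the pullback of `E` along the identity, the
  -- form used by morphisms of `F`; `baseChangeGerm` identifies the source with the base change of
  -- `y`.
  let χ : IsoOnBig (famMap X (s.π.app j)) y (𝟙 (fam X s.pt))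
      (⟨famMap X (s.π.app i) ⁻¹ᵁ V, hU, E, hE⟩ : PartialBundle X r s.pt) :=
    { W := famMap X (s.π.app i) ⁻¹ᵁ V
      isBig := hU
      le₁ := (preimage_famMap_comp (s.w f) V).ge
      le₂ := le_rfl
      iso := e ≪≫ (Scheme.Modules.pullbackId _).symm.app E ≪≫
        (Scheme.Modules.pullbackCongr (by
          exact ((Scheme.Hom.resLE_id _).trans (Scheme.homOfLE_rfl _ _)).symm)).app E }
  exact ⟨j, y, ⟨(y.baseChangeGerm (s.π.app j)).trans (Quotient.mk _ χ)⟩⟩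

/-- The two representatives are moved to a common index by `IsFiltered.bowtie`, which equalizes both
pairs of structure maps; `exists_pull_eq` then makes the germs equal further on. -/
theorem faithful : (colimComparison X r T s).Faithful where
  map_injective {x y} φ ψ h := by
    induction φ using Quotient.inductionOn with | _ φ
    induction ψ using Quotient.inductionOn with | _ ψ
    have h' : φ.eval s = ψ.eval s := (PartialBundle.homEquiv _ _ _ _).injective h
    obtain ⟨m, u, v, hf, hg⟩ := IsFiltered.bowtie φ.f ψ.f φ.g ψ.g
    have key := (ColimRep.push_pull s φ.germ u _ _ rfl rfl).trans
      (h'.trans (ColimRep.push_pull s ψ.germ v _ _ hf.symm hg.symm).symm)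
    have key' : ∀ (a' : fam X s.pt ⟶ _) (b' : fam X s.pt ⟶ _)
        (k₁ : famMap X (s.π.app (op m)) ≫ famMap X (T.map (φ.f ≫ u).op) = a')
        (k₂ : famMap X (s.π.app (op m)) ≫ famMap X (T.map (φ.g ≫ u).op) = b'),
        (push φ.germ u _ _ rfl rfl).pull (s.π.app (op m)) a' b' k₁ k₂ =
          (push ψ.germ v _ _ hf.symm hg.symm).pull (s.π.app (op m)) a' b' k₁ k₂ := by
      intro a' b' k₁ k₂
      obtain rfl := k₁.symm.trans ((famMap_comp X _ _).trans (congrArg _ (s.w _)))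
      obtain rfl := k₂.symm.trans ((famMap_comp X _ _).trans (congrArg _ (s.w _)))
      exact key
    obtain ⟨n, p, hp⟩ := hs.exists_pull_eq _ _ (key' _ _ rfl rfl)
    obtain ⟨p, rfl⟩ : ∃ q : m ⟶ n.unop, q.op = p := ⟨p.unop, rfl⟩
    have hp' : push (push φ.germ u _ _ rfl rfl) p _ _ rfl rfl =
        push (push ψ.germ v _ _ hf.symm hg.symm) p _ _ rfl rfl := by
      have H : ∀ (a' : fam X (T.obj n) ⟶ _) (b' : fam X (T.obj n) ⟶ _)
          (k₁ : famMap X (T.map p.op) ≫ famMap X (T.map (φ.f ≫ u).op) = a')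
          (k₂ : famMap X (T.map p.op) ≫ famMap X (T.map (φ.g ≫ u).op) = b'),
          (push φ.germ u _ _ rfl rfl).pull (T.map p.op) a' b' k₁ k₂ =
            (push ψ.germ v _ _ hf.symm hg.symm).pull (T.map p.op) a' b' k₁ k₂ := by
        rintro _ _ rfl rfl
        exact hp
      exact H _ _ _ _
    exact Quotient.sound ⟨n.unop, u ≫ p, v ≫ p, (φ.f ≫ u) ≫ p, (φ.g ≫ u) ≫ p,
      (Category.assoc _ _ _).symm, (Category.assoc _ _ _).symm, by rw [hf, Category.assoc],
      by rw [hg, Category.assoc], (push_push φ.germ u _ _ rfl rfl p _ _ _ _ _ rfl).symm.trans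
        (hp'.trans (push_push ψ.germ v _ _ _ _ p _ _ _ _ _ rfl))⟩

/-- Source and target are first compared over an index above both; `exists_germ` then produces the
representative at a later one. -/
theorem full : (colimComparison X r T s).Full where
  map_surjective {x y} φ := by
    obtain ⟨φ, rfl⟩ := (PartialBundle.homEquiv _ _ _ _).surjective φ
    let l := IsFiltered.max x.idx y.idx
    let f : x.idx ⟶ l := IsFiltered.leftToMax _ _
    let g : y.idx ⟶ l := IsFiltered.rightToMax _ _
    obtain ⟨j, p, hp⟩ := hs.exists_germ (a := famMap X (T.map f.op)) (b := famMap X (T.map g.op))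
      ((famMap_comp X _ _).trans (congrArg _ (s.w _)))
      ((famMap_comp X _ _).trans (congrArg _ (s.w _))) φ
    obtain ⟨φ', hφ'⟩ := hp (famMap X (T.map (f ≫ p.unop).op)) (famMap X (T.map (g ≫ p.unop).op))
      ((famMap_comp X _ _).trans (congrArg _ (T.map_comp _ _).symm))
      ((famMap_comp X _ _).trans (congrArg _ (T.map_comp _ _).symm))
      ((famMap_comp X _ _).trans (congrArg _ (s.w _)))
      ((famMap_comp X _ _).trans (congrArg _ (s.w _)))
    exact ⟨Quotient.mk _ ⟨j.unop, f ≫ p.unop, g ≫ p.unop, φ'⟩, congrArg (PartialBundle.homEquiv _ _ _ _) hφ'⟩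

theorem essSurj : (colimComparison X r T s).EssSurj where
  mem_essImage x := by
    obtain ⟨j, y, ⟨e⟩⟩ := hs.exists_nonempty_hom x
    exact ⟨⟨j.unop, y⟩, ⟨(Groupoid.isoEquivHom _ _).symm e⟩⟩

theorem isEquivalence : (colimComparison X r T s).IsEquivalence where
  faithful := hs.faithful
  full := hs.full
  essSurj := hs.essSurj

end IsGoodLimit

end GenericBundles

end

/-! ### `X_R` as a good limit of the `X_{R_α}`. -/

section

namespace GenericBundles

section Limit

variable {B : Scheme.{u}} (X : Over B)

/-- The projections `X_T ⟶ T`. -/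
noncomputable def famProjNatTrans : famFunctor X ⟶ Over.forget B where
  app T := famProj X T
  naturality _ _ g := famMap_snd X g

/-- The functor `T ↦ X_T` preserves connected limits. -/
noncomputable def isLimitFamFunctorMapCone {I : Type*} [Category* I] [IsConnected I]
    {T : I ⥤ Over B} {s : Cone T} (hs : IsLimit s) : IsLimit ((famFunctor X).mapCone s) :=
  isLimitOfIsPullbackOfIsConnected (Functor.whiskerLeft T (famProjNatTrans X)) _
    ((Over.forget B).mapCone s)
    { hom := famProj X s.pt
      w := fun i => (famMap_snd X (s.π.app i)).symm }
    (fun i => famMap_isPullback X (s.π.app i)) (isLimitOfPreserves (Over.forget B) hs)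

lemma isAffineHom_famMap {S T : Over B} (g : S ⟶ T) (hg : IsAffineHom g.left) :
    IsAffineHom (famMap X g) :=
  MorphismProperty.of_isPullback (famMap_isPullback X g).flip hg

lemma isNoetherian_fam [LocallyOfFiniteType X.hom] [QuasiCompact X.hom] (T : Over B)
    [IsNoetherian T.left] : IsNoetherian (fam X T) where
  toIsLocallyNoetherian := inferInstance
  toCompactSpace := QuasiCompact.compactSpace_of_compactSpace (pullback.snd X.hom T.hom)

end Limit

section Algebra

variable {k : Type u} [Field k] (X : Over (Spec (CommRingCat.of k))) [IsProper X.hom]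
  [IrreducibleSpace X.left] {J : Type u} [SmallCategory J] [IsFiltered J] (R : J ⥤ CommAlgCat.{u} k)
  [∀ j, IsNoetherianRing (R.obj j)] (c : Cocone R) (hc : IsColimit c) [IsNoetherianRing c.pt]

include hc in
lemma isGoodLimit_algSpec :
    IsGoodLimit X ((algSpec (CommRingCat.of k)).mapCone c.op) where
  isLimit := by
    -- Base change and the forgetful functor from schemes over `Spec k` preserve only connected
    -- limits; filteredness supplies the connectedness.
    have := IsFiltered.isConnected J
    have : IsConnected Jᵒᵖ := inferInstance
    have : PreservesLimit R.op (algSpec (CommRingCat.of k)) :=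
      (preservesLimitsOfSize_algSpec (R := CommRingCat.of k)).preservesLimitsOfShape.preservesLimit
    exact ⟨isLimitFamFunctorMapCone X (isLimitOfPreserves (algSpec (CommRingCat.of k)) hc.op)⟩
  isAffineHom i j f := isAffineHom_famMap X _ (by
    change IsAffineHom (Spec.map _)
    infer_instance)
  isNoetherian i :=
    have : IsNoetherian ((R.op ⋙ algSpec (CommRingCat.of k)).obj i).left :=
      inferInstanceAs (IsNoetherian (Spec (CommRingCat.of (R.obj i.unop))))
    isNoetherian_fam X _
  isNoetherian_pt :=
    have : IsNoetherian ((algSpec (CommRingCat.of k)).mapCone c.op).pt.left :=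
      inferInstanceAs (IsNoetherian (Spec (CommRingCat.of c.pt)))
    isNoetherian_fam X _
  exists_isBig i U h := by
    -- Quasi-compactness of `X` makes the charts finite in number, and irreducibility provides their
    -- Noether normalizations with prime nilradical.
    have : CompactSpace X.left := QuasiCompact.compactSpace_of_compactSpace X.hom
    obtain ⟨j, f, hf⟩ := exists_isBig_preimage_algSpec R c hc i.unop U h
    exact ⟨.op j, f.op, hf⟩

end Algebra

end GenericBundles

end

theorem mainTheorem7 {k : Type u} [Field k] (X : Over (Spec (CommRingCat.of k)))
    [IsProper X.hom] [IrreducibleSpace X.left] (r : ℕ) {J : Type u} [SmallCategory J]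
    [IsFiltered J] (R : J ⥤ CommAlgCat.{u} k) [∀ j, IsNoetherianRing (R.obj j)]
    (c : Cocone R) (hc : IsColimit c) [IsNoetherianRing c.pt] :
    (GenericBundles.colimComparison X r (R.op ⋙ algSpec (CommRingCat.of k))
      ((algSpec (CommRingCat.of k)).mapCone c.op)).IsEquivalence :=
  (GenericBundles.isGoodLimit_algSpec X R c hc).isEquivalence
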